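/- Let $n\ge 1$ be an integer. For a tuple $\vec d=(d_1,\dots,d_k)$ of positive integers, $k\ge 1$, put $$F_n(\vec d)=\frac{\gcd(\vec d)}{\gcd(\gcd(\vec d),\,n+1)},\qquad \gcd(\vec d)=\gcd(d_1,\dots,d_k).$$ Let $D_1,\dots,D_k\subset\mathbb{CP}^n$ be the zero sets of homogeneous polynomials $F_1,\dots,F_k$ of degrees $d_1,\dots,d_k$ that are generic in the following sense: each $F_i$ is irreducible, and at every point of $\mathbb{CP}^n$ the differentials of those $F_i$ that vanish there are linearly independent, so that $D_1,\dots,D_k$ are smooth and are the irreducible components of a simple normal crossing divisor $D=D_1\cup\dots\cup D_k$. (For $n\ge 2$ irreducibility follows from smoothness; for $n=1$ it means that all $d_i=1$.) For $\varepsilon>0$ let $$X_{\varepsilon}=\Big\{[z]\in\mathbb{CP}^n \;:\; \frac{|F_1(z)\cdots F_k(z)|}{|z|^{d_1+\dots+d_k}}\ge\varepsilon\Big\},$$ with the Fubini–Study symplectic form. For $\varepsilon$ sufficiently small this is (up to a positive factor in the form) the Weinstein domain $X^{2n}_{\vec d}$, the complement of a small neighborhood of $D$. Let $F'_1,\dots,F'_{k'}$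 be a second generic collection, of degrees $\vec{d'}=(d'_1,\dots,d'_{k'})$, $k'\ge1$, with the corresponding sets $X'_{\varepsilon'}$. An *almost symplectic embedding* of $X_\varepsilon$ into $X'_{\varepsilon'}$ is a codimension zero smooth embedding $\iota:X_\varepsilon\hookrightarrow X'_{\varepsilon'}$ such that $\iota^*\omega'$ and $\omega$ are homotopic through nondegenerate two-forms on $X_\varepsilon$, where $\omega,\omega'$ are the symplectic forms. Then, if there is an almost symplectic embedding of $X^{2n}_{\vec d}$ into $X^{2n}_{\vec{d'}}$, the integer $F_n(\vec d)$ divides $F_n(\vec{d'})$. More precisely: there is $\varepsilon_0>0$, depending only on $n$ and $F_1,\dots,F_k$, such that for all $0<\varepsilon\le\varepsilon_0$, all $\vec{d'}$ and generic $F'_1,\dots,F'_{k'}$ and all $\varepsilon'>0$, the existence of an almost symplectic embedding of $X_\varepsilon$ into $X'_{\varepsilon'}$ implies $F_n(\vec d)\mid F_n(\vec{d'})$. -/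

import Mathlib

open scoped Manifold ContDiff Topology LinearAlgebra.Projectivization

noncomputable section

/-! ### Complex projective space as a smooth manifold -/

/-- Complex projective space `ℂℙⁿ`: the lines in `ℂⁿ⁺¹`. -/
abbrev CP (n : ℕ) : Type := ℙ ℂ (Fin (n + 1) → ℂ)

namespace CP

variable {n : ℕ}

/-- The quotient topology from `ℂⁿ⁺¹ ∖ {0}`. -/
instance : TopologicalSpace (CP n) :=
  inferInstanceAs (TopologicalSpace
    (Quotient (projectivizationSetoid ℂ (Fin (n + 1) → ℂ))))

/-- The open set `Uᵢ = {[z] : zᵢ ≠ 0}`. -/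
def affineOpen (i : Fin (n + 1)) : Set (CP n) :=
  {p | Projectivization.lift (fun v : {v : Fin (n + 1) → ℂ // v ≠ 0} => v.1 i ≠ 0) (by
    rintro ⟨a, ha⟩ ⟨b, hb⟩ t h
    have ht : t ≠ 0 := by
      rintro rfl
      exact ha (by simpa using h)
    have h' : a = t • b := h
    subst h'
    simp [ht]) p}

/-- The affine coordinates `[z] ↦ (z_j / zᵢ)_{j ≠ i}` on `Uᵢ`. -/
def affineCoord (i : Fin (n + 1)) : CP n → (Fin n → ℂ) :=
  Projectivization.lift (fun v j => v.1 (i.succAbove j) / v.1 i) (by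
    rintro ⟨a, ha⟩ ⟨b, hb⟩ t h
    have ht : t ≠ 0 := by
      rintro rfl
      exact ha (by simpa using h)
    have h' : a = t • b := h
    subst h'
    funext j
    exact mul_div_mul_left _ _ ht)

theorem insertNth_one_ne_zero (i : Fin (n + 1)) (w : Fin n → ℂ) :
    (i.insertNth (1 : ℂ) w : Fin (n + 1) → ℂ) ≠ 0 := by
  intro h
  have := congrFun h i
  simp at this

/-- The inverse of the affine coordinates: `w ↦ [w with 1 inserted in position i]`. -/
def affineInv (i : Fin (n + 1)) (w : Fin n → ℂ) : CP n :=
  Projectivization.mk ℂ (i.insertNth (1 : ℂ) w) (insertNth_one_ne_zero i w)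

theorem mk_mem_affineOpen (i : Fin (n + 1)) (v : Fin (n + 1) → ℂ) (hv : v ≠ 0) :
    Projectivization.mk ℂ v hv ∈ affineOpen i ↔ v i ≠ 0 := Iff.rfl

theorem affineCoord_mk (i : Fin (n + 1)) (v : Fin (n + 1) → ℂ) (hv : v ≠ 0) :
    affineCoord i (Projectivization.mk ℂ v hv) = fun j => v (i.succAbove j) / v i := rfl

theorem continuous_mk' :
    Continuous (fun v : {v : Fin (n + 1) → ℂ // v ≠ 0} => Projectivization.mk' ℂ v) :=
  continuous_quotient_mk'

theorem isOpen_affineOpen (i : Fin (n + 1)) : IsOpen (affineOpen i : Set (CP n)) := by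
  have hq : Topology.IsQuotientMap
      (fun v : {v : Fin (n + 1) → ℂ // v ≠ 0} => Projectivization.mk' ℂ v) :=
    isQuotientMap_quotient_mk'
  rw [← hq.isOpen_preimage]
  exact isOpen_ne_fun ((continuous_apply i).comp continuous_subtype_val) continuous_const

/-- The standard affine chart `Uᵢ ≃ ℂⁿ`. -/
def affineChart (i : Fin (n + 1)) : OpenPartialHomeomorph (CP n) (Fin n → ℂ) where
  toFun := affineCoord i
  invFun := affineInv i
  source := affineOpen i
  target := Set.univ
  map_source' := fun _ _ => Set.mem_univ _
  map_target' := fun w _ => by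
    rw [affineInv, mk_mem_affineOpen]
    simp
  left_inv' := by
    intro p
    induction p using Projectivization.ind with
    | h v hv =>
      intro h
      rw [mk_mem_affineOpen] at h
      rw [affineCoord_mk, affineInv, Projectivization.mk_eq_mk_iff']
      refine ⟨(v i)⁻¹, ?_⟩
      funext j
      refine Fin.succAboveCases i ?_ (fun j => ?_) j
      · simp [h]
      · simp [div_eq_inv_mul]
  right_inv' := by
    intro w _
    rw [affineInv, affineCoord_mk]
    simp
  open_source := isOpen_affineOpen i
  open_target := isOpen_univ
  continuousOn_toFun := by
    have hq : Topology.IsQuotientMap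
        (fun v : {v : Fin (n + 1) → ℂ // v ≠ 0} => Projectivization.mk' ℂ v) :=
      isQuotientMap_quotient_mk'
    rw [hq.continuousOn_isOpen_iff (isOpen_affineOpen i)]
    refine continuousOn_pi.2 fun j => ContinuousOn.div ?_ ?_ fun v hv => hv
    · exact ((continuous_apply _).comp continuous_subtype_val).continuousOn
    · exact ((continuous_apply _).comp continuous_subtype_val).continuousOn
  continuousOn_invFun := by
    have h1 : Continuous fun w : Fin n → ℂ =>
        (⟨i.insertNth (1 : ℂ) w, insertNth_one_ne_zero i w⟩ :
          {v : Fin (n + 1) → ℂ // v ≠ 0}) :=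
      Continuous.subtype_mk
        (Continuous.finInsertNth (A := fun _ => ℂ) i continuous_const continuous_id) _
    exact (continuous_mk'.comp h1).continuousOn

theorem exists_mem_affineOpen (p : CP n) : ∃ i, p ∈ affineOpen i := by
  induction p using Projectivization.ind with
  | h v hv =>
    obtain ⟨i, hi⟩ := Function.ne_iff.1 hv
    exact ⟨i, hi⟩

/-- `ℂℙⁿ` with its `n + 1` standard affine charts. -/
instance : ChartedSpace (Fin n → ℂ) (CP n) where
  atlas := Set.range affineChart
  chartAt p := affineChart (exists_mem_affineOpen p).choose
  mem_chart_source p := (exists_mem_affineOpen p).choose_spec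
  chart_mem_atlas _ := Set.mem_range_self _

/-- `ℂℙⁿ` is a smooth (real, `2n`-dimensional) manifold. -/
instance : IsManifold 𝓘(ℝ, Fin n → ℂ) ∞ (CP n) := by
  refine isManifold_of_contDiffOn _ _ _ ?_
  rintro _ _ ⟨i, rfl⟩ ⟨j, rfl⟩
  have hnum : ∀ l, ContDiff ℝ ∞ fun w : Fin n → ℂ =>
      (i.insertNth (1 : ℂ) w : Fin (n + 1) → ℂ) l := by
    intro l
    refine Fin.succAboveCases i ?_ (fun l => ?_) l
    · simpa using contDiff_const
    · simpa using contDiff_apply ℝ ℂ l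
  refine contDiffOn_pi.2 fun l => ?_
  refine ContDiffOn.congr (f := fun w : Fin n → ℂ =>
    (i.insertNth (1 : ℂ) w : Fin (n + 1) → ℂ) (j.succAbove l) *
      ((i.insertNth (1 : ℂ) w : Fin (n + 1) → ℂ) j)⁻¹) ?_ (fun w _ => div_eq_mul_inv _ _)
  refine (hnum (j.succAbove l)).contDiffOn.mul ((hnum j).contDiffOn.inv ?_)
  intro w hw
  have hw' : affineInv i w ∈ affineOpen j := by
    have := hw.1
    simpa [affineChart] using this
  exact hw'

/-- The Fubini–Study symplectic form on `ℂℙⁿ`. The tangent space at `p` is `ℂⁿ` through the affine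
chart `chartAt _ p`, and in any affine chart with coordinate `w` the form is the imaginary part of
the Hermitian form
`((1 + |w|²) ⟨u, v⟩ - ⟨u, w⟩ ⟨w, v⟩) / (1 + |w|²)²`, where `⟨u, v⟩ = ∑ⱼ conj uⱼ * vⱼ`. -/
def fubiniStudy (p : CP n) (u v : TangentSpace 𝓘(ℝ, Fin n → ℂ) p) : ℝ :=
  let w : Fin n → ℂ := chartAt (Fin n → ℂ) p p
  let u' : Fin n → ℂ := u
  let v' : Fin n → ℂ := v
  (((1 + star w ⬝ᵥ w) * (star u' ⬝ᵥ v') - (star u' ⬝ᵥ w) * (star w ⬝ᵥ v')) /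
    (1 + star w ⬝ᵥ w) ^ 2).im

end CP

/-! ### Complements of generic hypersurfaces -/

/-- Defining equations of a generic collection of hypersurfaces `D₁, …, D_k` in `ℂℙⁿ` of degrees
`d₁, …, d_k`, i.e. of the irreducible components of a simple normal crossing divisor: the gradients
of those `Fᵢ` that vanish at a given point are linearly independent. (For a single `i` this says
that `Dᵢ` is smooth.) -/
structure GenericHypersurfaces (n : ℕ) {k : ℕ} (d : Fin k → ℕ) where
  F : Fin k → MvPolynomial (Fin (n + 1)) ℂ
  isHomogeneous : ∀ i, (F i).IsHomogeneous (d i)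
  irreducible : ∀ i, Irreducible (F i)
  normalCrossing : ∀ z : Fin (n + 1) → ℂ, z ≠ 0 →
    LinearIndependent ℂ (fun (i : {i : Fin k // MvPolynomial.eval z (F i) = 0})
      (j : Fin (n + 1)) => MvPolynomial.eval z (MvPolynomial.pderiv j (F i)))

namespace GenericHypersurfaces

variable {n k : ℕ} {d : Fin k → ℕ}

/-- The norm `‖σ‖` of the section `σ = F₁ ⋯ F_k` of `𝒪(d₁ + ⋯ + d_k)` for the standard Hermitian
metric: `[z] ↦ |F₁(z) ⋯ F_k(z)| / |z| ^ (d₁ + ⋯ + d_k)`, with `|z|` the Euclidean norm.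
Its zero set is the divisor `D₁ ∪ ⋯ ∪ D_k`. -/
def sectionNorm (D : GenericHypersurfaces n d) : CP n → ℝ :=
  Projectivization.lift
    (fun z => ‖∏ i, MvPolynomial.eval z.1 (D.F i)‖ / ‖WithLp.toLp 2 z.1‖ ^ ∑ i, d i) (by
      rintro ⟨a, ha⟩ ⟨b, hb⟩ t h
      have ht : t ≠ 0 := by
        rintro rfl
        exact ha (by simpa using h)
      have h' : a = t • b := h
      subst h'
      have hF : ∀ i, MvPolynomial.eval (t • b) (D.F i) =
          t ^ d i * MvPolynomial.eval b (D.F i) := by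
        intro i
        rw [MvPolynomial.eval_eq', MvPolynomial.eval_eq', Finset.mul_sum]
        refine Finset.sum_congr rfl fun m hm => ?_
        have hdeg : ∑ j, m j = d i := by
          rw [← (D.isHomogeneous i) (MvPolynomial.mem_support_iff.1 hm), Finsupp.weight_apply,
            Finsupp.sum_fintype _ _ (by simp)]
          simp
        simp only [Pi.smul_apply, smul_eq_mul, mul_pow, Finset.prod_mul_distrib,
          Finset.prod_pow_eq_pow_sum, hdeg]
        ring
      have ht' : ‖t‖ ^ ∑ i, d i ≠ 0 := pow_ne_zero _ (norm_ne_zero_iff.2 ht)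
      simp only [hF, Finset.prod_mul_distrib, Finset.prod_pow_eq_pow_sum, norm_mul, norm_pow,
        WithLp.toLp_smul, norm_smul, mul_pow]
      exact mul_div_mul_left _ _ ht')

/-- The compact domain `{‖σ‖ ≥ ε} = {-log ‖σ‖ ≤ -log ε}` in `ℂℙⁿ ∖ (D₁ ∪ ⋯ ∪ D_k)`. For `ε > 0`
sufficiently small it is the Weinstein domain `X_d`, the complement of a small neighborhood of the
divisor; its symplectic form is, up to a positive factor, the Fubini–Study form. -/
def domain (D : GenericHypersurfaces n d) (ε : ℝ) : Set (CP n) :=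
  {p | ε ≤ D.sectionNorm p}

end GenericHypersurfaces

/-! ### Almost symplectic embeddings -/

/-- A nondegenerate two-form on the real vector space `V`. -/
def IsNondegenerateTwoForm {V : Type*} [AddCommGroup V] [Module ℝ V] [TopologicalSpace V]
    (η : V →L[ℝ] V →L[ℝ] ℝ) : Prop :=
  (∀ u, η u u = 0) ∧ ∀ u, (∀ v, η u v = 0) → u = 0

/-- There is a smooth codimension zero embedding `ι` of `X ⊆ ℂℙⁿ` into `X' ⊆ ℂℙⁿ` that preserves
the homotopy class of the symplectic form as a nondegenerate two-form: there is a path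
`η t`, `t ∈ [0, 1]`, of nondegenerate two-forms on `X`, continuous in `(t, p)`, from the symplectic
form of `X` to the pullback under `ι` of the symplectic form of `X'`. -/
def AlmostSymplecticEmbeds {n : ℕ} (X X' : Set (CP n)) : Prop :=
  ∃ ι : CP n → CP n,
    ContMDiffOn 𝓘(ℝ, Fin n → ℂ) 𝓘(ℝ, Fin n → ℂ) ∞ ι X ∧
    Set.InjOn ι X ∧
    Set.MapsTo ι X X' ∧
    (∀ p ∈ X, Function.Bijective
      (mfderivWithin 𝓘(ℝ, Fin n → ℂ) 𝓘(ℝ, Fin n → ℂ) ι X p)) ∧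
    ∃ η : ℝ → (p : CP n) →
        (TangentSpace 𝓘(ℝ, Fin n → ℂ) p →L[ℝ] TangentSpace 𝓘(ℝ, Fin n → ℂ) p →L[ℝ] ℝ),
      ContinuousOn (fun q : ℝ × CP n =>
        Bundle.TotalSpace.mk' ((Fin n → ℂ) →L[ℝ] (Fin n → ℂ) →L[ℝ] ℝ)
          (E := fun p : CP n => TangentSpace 𝓘(ℝ, Fin n → ℂ) p →L[ℝ]
            TangentSpace 𝓘(ℝ, Fin n → ℂ) p →L[ℝ] ℝ) q.2 (η q.1 q.2))
        (Set.Icc 0 1 ×ˢ X) ∧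
      (∀ t ∈ Set.Icc (0 : ℝ) 1, ∀ p ∈ X, IsNondegenerateTwoForm (η t p)) ∧
      (∀ p ∈ X, ∀ u v, η 0 p u v = CP.fubiniStudy p u v) ∧
      (∀ p ∈ X, ∀ u v, η 1 p u v = CP.fubiniStudy (ι p)
        (mfderivWithin 𝓘(ℝ, Fin n → ℂ) 𝓘(ℝ, Fin n → ℂ) ι X p u)
        (mfderivWithin 𝓘(ℝ, Fin n → ℂ) 𝓘(ℝ, Fin n → ℂ) ι X p v))

/-- `F_n(d) = gcd(d) / gcd(gcd(d), n + 1)`. -/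
def formalF (n : ℕ) {k : ℕ} (d : Fin k → ℕ) : ℕ :=
  Finset.univ.gcd d / Nat.gcd (Finset.univ.gcd d) (n + 1)

end

/-! Topologically, the hyperplane class generates a subgroup of order `gcd d` in `H²(X_d; ℤ)`, and
`c₁(X_d)` is `n + 1` times it, so `c₁(X_d)` has order `F_n(d)`. An almost symplectic embedding pulls
`c₁` back to `c₁`, hence the order for `d` divides the order for `d'`. The proof replaces cohomology
by functions on cones: a trivialization of the `m`-th power of the canonical bundle or its dual
amounts to a nonvanishing continuous function on the cone over `X` in `ℂⁿ⁺¹`, homogeneous of degree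
`(n + 1) m` under `ℂˣ`.

Existence on the target: for `m = F_n(d')` the degree `(n + 1) m` is a multiple of `gcd d'`, and a
product of integer powers of the `F'_i` has that degree (`exists_homogeneous_on_domain`).

Transport: a linear Moser argument with operator square roots (`exists_moser_isotopy`) turns the
homotopy of forms into bundle maps `Ψ`. The lifted derivative of `ι` composed with `Ψ` then
preserves the symplectic forms, so its complex-linear part is invertible. Dividing the function on
the target by the `m`-th power of the determinant of that part gives a function on a compact part of
the source cone, again homogeneous of degree `(n + 1) m`
(`exists_homogeneous_of_almostSymplecticEmbeds`).

Obstruction on the source: the degree `N` of such a function is its winding number along a large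
circle in a generic line, hence the sum of its winding numbers around the points where the line
meets `D`. The smooth part of each `D_i` is connected (`joinedIn_transverseZeros`), so the `d_i`
points on `D_i` contribute equally. Thus `N = ∑ d_i w_i`, which gives `gcd d ∣ N`
(`exists_compact_gcd_dvd`). Cancelling `gcd (gcd d, n + 1)` from `gcd d ∣ (n + 1) F_n(d')` gives the
theorem. -/

noncomputable section

/-! ### Square roots near the identity -/

section SqrtSeries

variable {A : Type*} [NormedRing A] [NormedAlgebra ℝ A]

/-- The generating series `∑ catalan k * y ^ k`. -/
def catalanSeries (y : A) : A := ∑' k : ℕ, (catalan k : ℝ) • y ^ k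

theorem norm_catalan_smul_pow_le [NormOneClass A] (y : A) (k : ℕ) :
    ‖(catalan k : ℝ) • y ^ k‖ ≤ (4 * ‖y‖) ^ k := by
  have h1 : (catalan k : ℝ) ≤ 4 ^ k := by
    have h := succ_mul_catalan_eq_centralBinom k
    have h2 := Nat.centralBinom_le_four_pow k
    have : catalan k ≤ 4 ^ k := by nlinarith [Nat.zero_le (catalan k)]
    exact_mod_cast this
  rw [norm_smul, mul_pow]
  exact mul_le_mul (by simpa using h1) (norm_pow_le _ _) (norm_nonneg _) (by positivity)

theorem summable_norm_catalan [NormOneClass A] {y : A} (hy : 4 * ‖y‖ < 1) :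
    Summable fun k : ℕ => ‖(catalan k : ℝ) • y ^ k‖ :=
  Summable.of_nonneg_of_le (fun _ => norm_nonneg _) (norm_catalan_smul_pow_le y)
    (summable_geometric_of_lt_one (by positivity) hy)

theorem four_mul_norm_lt {x : A} (hx : ‖1 - x‖ < 1) : 4 * ‖(4 : ℝ)⁻¹ • (1 - x)‖ < 1 := by
  rw [norm_smul, ← mul_assoc]; norm_num; exact hx

variable [CompleteSpace A]

/-- The Cauchy product turns the convolution recurrence of the Catalan numbers into this quadratic
equation. -/
theorem catalanSeries_eq [NormOneClass A] {y : A} (hy : 4 * ‖y‖ < 1) :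
    catalanSeries y = 1 + y * (catalanSeries y * catalanSeries y) := by
  have hs := summable_norm_catalan hy
  unfold catalanSeries
  rw [tsum_mul_tsum_eq_tsum_sum_antidiagonal_of_summable_norm hs hs]
  rw [hs.of_norm.tsum_eq_zero_add, ← Summable.tsum_mul_left]
  · congr 1
    · simp
    · refine tsum_congr fun k => ?_
      rw [catalan_succ', Finset.mul_sum, Nat.cast_sum, Finset.sum_smul]
      refine Finset.sum_congr rfl fun ij hij => ?_
      rw [smul_mul_smul_comm, ← pow_add, Finset.HasAntidiagonal.mem_antidiagonal.1 hij, mul_smul_comm, ← pow_succ',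
        Nat.cast_mul]
  · exact (summable_norm_sum_mul_antidiagonal_of_summable_norm hs hs).of_norm

theorem commute_catalanSeries [NormOneClass A] {y : A} (hy : 4 * ‖y‖ < 1) :
    Commute y (catalanSeries y) := by
  have hs := (summable_norm_catalan hy).of_norm
  change y * _ = _ * y
  rw [catalanSeries, ← hs.tsum_mul_left, ← hs.tsum_mul_right]
  refine tsum_congr fun k => ?_
  rw [mul_smul_comm, smul_mul_assoc, ← pow_succ, ← pow_succ']

/-- The square root of `x` given by the power series of `√(1 - 4 y)` at `y = (1 - x) / 4`. -/
def sqrtSeries (x : A) : A :=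
  1 - (2 : ℝ) • (((4 : ℝ)⁻¹ • (1 - x)) * catalanSeries ((4 : ℝ)⁻¹ • (1 - x)))

/-- With `x = 1 - 4 y` and `c = 1 + y c²` commuting with `y`, the square of `1 - 2 y c` is `1 - 4 y
c + 4 y (c - 1) = 1 - 4 y`. -/
theorem sqrtSeries_mul_self [NormOneClass A] {x : A} (hx : ‖1 - x‖ < 1) :
    sqrtSeries x * sqrtSeries x = x := by
  have hy := four_mul_norm_lt hx
  have hxy : x = 1 - (4 : ℝ) • ((4 : ℝ)⁻¹ • (1 - x)) := by
    rw [smul_smul]; norm_num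
  unfold sqrtSeries
  conv_rhs => rw [hxy]
  generalize (4 : ℝ)⁻¹ • (1 - x) = y at hy
  have hc := commute_catalanSeries hy
  have he := catalanSeries_eq hy
  generalize catalanSeries y = c at hc he
  have h1 : y * c * (y * c) = y * (c - 1) := by
    have : c - 1 = y * (c * c) := by
      conv_lhs => rw [he]
      abel
    rw [this]
    rw [mul_assoc, ← mul_assoc c y c, ← hc.eq, mul_assoc]
  rw [sub_mul, mul_sub, mul_sub, one_mul, one_mul, mul_one, smul_mul_smul_comm, h1, mul_sub,
    smul_sub, mul_one]
  module

theorem continuousOn_sqrtSeries [NormOneClass A] :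
    ContinuousOn (sqrtSeries : A → A) {x | ‖1 - x‖ < 1} := by
  have hC : ContinuousOn (catalanSeries : A → A) {y | 4 * ‖y‖ < 1} := by
    intro y hy
    obtain ⟨r, hr1, hr2⟩ := exists_between (show 4 * ‖y‖ < 1 from hy)
    have hr0 : 0 ≤ r := le_trans (by positivity) hr1.le
    have : ContinuousOn (catalanSeries : A → A) {y | 4 * ‖y‖ < r} := by
      refine continuousOn_tsum (u := fun k => r ^ k) (fun k => by fun_prop)
        (summable_geometric_of_lt_one hr0 hr2) fun k z hz => ?_
      exact (norm_catalan_smul_pow_le z k).trans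
        (pow_le_pow_left₀ (by positivity) (le_of_lt hz) k)
    refine (this.continuousAt ?_).continuousWithinAt
    exact (isOpen_lt (by fun_prop) continuous_const).mem_nhds hr1
  have hl : Continuous fun x : A => (4 : ℝ)⁻¹ • (1 - x) := by fun_prop
  have h := hC.comp (s := {x | ‖1 - x‖ < 1}) hl.continuousOn fun x hx => four_mul_norm_lt hx
  exact continuousOn_const.sub ((hl.continuousOn.mul h).const_smul _)

/-- Intertwining relations pass to the square root. -/
theorem intertwine_sqrtSeries [NormOneClass A] {x y l : A} (hx : ‖1 - x‖ < 1) (hy : ‖1 - y‖ < 1)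
    (h : l * x = y * l) : l * sqrtSeries x = sqrtSeries y * l := by
  have hx' := four_mul_norm_lt hx
  have hy' := four_mul_norm_lt hy
  have h' : l * ((4 : ℝ)⁻¹ • (1 - x)) = ((4 : ℝ)⁻¹ • (1 - y)) * l := by
    rw [mul_smul_comm, smul_mul_assoc, mul_sub, sub_mul, h, mul_one, one_mul]
  unfold sqrtSeries
  generalize (4 : ℝ)⁻¹ • (1 - x) = x' at *
  generalize (4 : ℝ)⁻¹ • (1 - y) = y' at *
  have hpow : ∀ k : ℕ, l * x' ^ k = y' ^ k * l := fun k =>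
    (show SemiconjBy l x' y' from h').pow_right k
  have hc : l * catalanSeries x' = catalanSeries y' * l := by
    rw [catalanSeries, catalanSeries, ← (summable_norm_catalan hx').of_norm.tsum_mul_left,
      ← (summable_norm_catalan hy').of_norm.tsum_mul_right]
    refine tsum_congr fun k => ?_
    rw [mul_smul_comm, smul_mul_assoc, hpow]
  rw [mul_sub, sub_mul, mul_one, one_mul, mul_smul_comm, smul_mul_assoc, ← mul_assoc, h',
    mul_assoc, hc, mul_assoc]

end SqrtSeries

section SqrtAdjoint

variable {E : Type*} [NormedAddCommGroup E] [NormedSpace ℝ E] [CompleteSpace E] [Nontrivial E]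

/-- The square root of an operator that is self-adjoint for a bilinear form is self-adjoint. -/
theorem selfAdjoint_sqrtSeries (η : E →L[ℝ] E →L[ℝ] ℝ) {B : E →L[ℝ] E} (hB : ‖1 - B‖ < 1)
    (h : ∀ u v, η (B u) v = η u (B v)) (u v : E) :
    η (sqrtSeries B u) v = η u (sqrtSeries B v) := by
  have hB' := four_mul_norm_lt hB
  have h' : ∀ u v, η (((4 : ℝ)⁻¹ • (1 - B)) u) v = η u (((4 : ℝ)⁻¹ • (1 - B)) v) := by
    intro u v
    simp [h]
  unfold sqrtSeries
  have hcomm := commute_catalanSeries hB'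
  generalize (4 : ℝ)⁻¹ • (1 - B) = y at *
  have hpow : ∀ (k : ℕ) u v, η ((y ^ k) u) v = η u ((y ^ k) v) := by
    intro k
    induction k with
    | zero => intro u v; simp
    | succ k ih =>
      intro u v
      calc η ((y ^ (k + 1)) u) v = η ((y ^ k) (y u)) v := by rw [pow_succ]; rfl
        _ = η u ((y ^ (k + 1)) v) := by rw [ih, h', pow_succ']; rfl
  have hc : ∀ u v, η (catalanSeries y u) v = η u (catalanSeries y v) := by
    intro u v
    have hs := (summable_norm_catalan hB').of_norm
    have e1 := ((η.flip v).comp (ContinuousLinearMap.apply ℝ E u)).map_tsum hs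
    have e2 := ((η u).comp (ContinuousLinearMap.apply ℝ E v)).map_tsum hs
    simp only [ContinuousLinearMap.comp_apply, ContinuousLinearMap.apply_apply,
      ContinuousLinearMap.flip_apply] at e1 e2
    rw [catalanSeries, e1, e2]
    refine tsum_congr fun k => ?_
    have := hpow k u v
    simp only [map_smul, smul_apply, this]
  have hyc : ∀ u v, η ((y * catalanSeries y) u) v = η u ((y * catalanSeries y) v) := by
    intro u v
    rw [mul_apply_eq_comp, h', hc, ← mul_apply_eq_comp, hcomm.eq]
  have := hyc u v
  simp only [sub_apply, smul_apply, map_sub, map_smul,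
    this, one_apply_eq_self]

end SqrtAdjoint

/-! ### Moser isotopies of linear two-forms -/

section Moser

variable {E : Type*} [NormedAddCommGroup E] [NormedSpace ℝ E]

theorem IsNondegenerateTwoForm.swap {η : E →L[ℝ] E →L[ℝ] ℝ} (h : IsNondegenerateTwoForm η)
    (u v : E) : η u v = -η v u := by
  have := h.1 (u + v)
  simp only [map_add, add_apply, h.1 u, h.1 v] at this
  linarith

theorem IsNondegenerateTwoForm.ext_left {η : E →L[ℝ] E →L[ℝ] ℝ} (h : IsNondegenerateTwoForm η)
    {u u' : E} (h' : ∀ v, η u v = η u' v) : u = u' := by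
  refine sub_eq_zero.1 (h.2 _ fun v => ?_)
  simp [h']

variable [FiniteDimensional ℝ E]

theorem IsNondegenerateTwoForm.isInvertible {η : E →L[ℝ] E →L[ℝ] ℝ}
    (h : IsNondegenerateTwoForm η) : η.IsInvertible := by
  have hinj : Function.Injective η.toLinearMap := by
    rw [injective_iff_map_eq_zero]
    intro u hu
    refine h.2 u fun v => ?_
    have : η u = 0 := hu
    simp [this]
  have hfr : Module.finrank ℝ E = Module.finrank ℝ (E →L[ℝ] ℝ) := by
    rw [← (LinearMap.toContinuousLinearMap : (E →ₗ[ℝ] ℝ) ≃ₗ[ℝ] (E →L[ℝ] ℝ)).finrank_eq]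
    exact (Subspace.dual_finrank_eq (K := ℝ) (V := E)).symm
  refine ⟨(LinearEquiv.ofInjectiveOfFinrankEq η.toLinearMap hinj hfr).toContinuousLinearEquiv, ?_⟩
  ext u v
  rfl

variable [Nontrivial E] {Z : Type*} [PseudoMetricSpace Z]

/-- A path of nondegenerate two-forms parametrized by a compact set is a path of pullbacks. -/
theorem exists_moser_isotopy {K : Set Z} (hK : IsCompact K) (η : ℝ → Z → E →L[ℝ] E →L[ℝ] ℝ)
    (hη : ContinuousOn (fun q : ℝ × Z => η q.1 q.2) (Set.Icc 0 1 ×ˢ K))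
    (hnd : ∀ t ∈ Set.Icc (0 : ℝ) 1, ∀ z ∈ K, IsNondegenerateTwoForm (η t z)) :
    ∃ Ψ : Z → E →L[ℝ] E, ContinuousOn Ψ K ∧
      (∀ z ∈ K, ∀ u v, η 1 z (Ψ z u) (Ψ z v) = η 0 z u v) ∧
      ∀ z ∈ K, ∀ z' ∈ K, ∀ L : E ≃L[ℝ] E,
        (∀ t ∈ Set.Icc (0 : ℝ) 1, ∀ u v, η t z' (L u) (L v) = η t z u v) →
        ∀ u, Ψ z' (L u) = L (Ψ z u) := by
  have : CompleteSpace E := FiniteDimensional.complete ℝ E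
  let I : Set ℝ := Set.Icc 0 1
  -- `B (s, t, z)` is `η_t⁻¹ η_s`. It is self-adjoint for `η_t`, so its square root `R` is too, and
  -- `η_t (R u) (R v) = η_t (B u) v = η_s u v`: `R` pulls `η_t` back to `η_s`.
  let B : ℝ × ℝ × Z → E →L[ℝ] E := fun q => (η q.2.1 q.2.2).inverse ∘L η q.1 q.2.2
  have hB : ∀ s t z, t ∈ I → z ∈ K → ∀ u v, η t z (B (s, t, z) u) v = η s z u v := by
    intro s t z ht hz u v
    have h := (hnd t ht z hz).isInvertible
    simp only [B, ContinuousLinearMap.comp_apply, ContinuousLinearMap.IsInvertible.self_apply_inverse h]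
  have hBc : ContinuousOn B (I ×ˢ I ×ˢ K) := by
    have h1 : ContinuousOn (fun q : ℝ × ℝ × Z => η q.1 q.2.2) (I ×ˢ I ×ˢ K) :=
      hη.comp (f := fun q : ℝ × ℝ × Z => (q.1, q.2.2)) (by fun_prop) fun q hq => ⟨hq.1, hq.2.2⟩
    have h2 : ContinuousOn (fun q : ℝ × ℝ × Z => η q.2.1 q.2.2) (I ×ˢ I ×ˢ K) :=
      hη.comp (f := fun q : ℝ × ℝ × Z => (q.2.1, q.2.2)) (by fun_prop)
        fun q hq => ⟨hq.2.1, hq.2.2⟩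
    refine ContinuousOn.clm_comp (fun q hq => ?_) h1
    obtain ⟨e, he⟩ := (hnd q.2.1 hq.2.1 q.2.2 hq.2.2).isInvertible
    have h3 : ContinuousAt ContinuousLinearMap.inverse (η q.2.1 q.2.2) := by
      rw [← he]
      exact (contDiffAt_map_inverse (𝕜 := ℝ) (n := 0) e).continuousAt
    exact ContinuousAt.comp_continuousWithinAt
      (f := fun q : ℝ × ℝ × Z => η q.2.1 q.2.2) h3 (h2 q hq)
  have hBs : ∀ s z, s ∈ I → z ∈ K → B (s, s, z) = 1 := by
    intro s z hs hz
    ext u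
    exact (hnd s hs z hz).ext_left fun v => hB s s z hs hz u v
  have hcomp : IsCompact (I ×ˢ I ×ˢ K) := isCompact_Icc.prod (isCompact_Icc.prod hK)
  -- Since `B (s, s, z) = 1`, compactness keeps `B (s, t, z)` within distance `1` of the identity
  -- for `|s - t| < δ`, uniformly in `z`. The interval is cut into `N + 1` steps shorter than `δ`,
  -- and the square roots of the steps are composed.
  obtain ⟨δ, hδ, hδ'⟩ := Metric.uniformContinuousOn_iff.1
    (hcomp.uniformContinuousOn_of_continuous hBc) 1 one_pos
  have hsmall : ∀ s t z, s ∈ I → t ∈ I → z ∈ K → |s - t| < δ → ‖1 - B (s, t, z)‖ < 1 := by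
    intro s t z hs ht hz hst
    rw [← hBs s z hs hz, ← dist_eq_norm]
    refine hδ' _ ⟨hs, hs, hz⟩ _ ⟨hs, ht, hz⟩ ?_
    simp [Prod.dist_eq, Real.dist_eq, hst]
  obtain ⟨N, hN⟩ := exists_nat_one_div_lt hδ
  have key : ∀ k : ℕ, k ≤ N + 1 → ∃ Ψ : Z → E →L[ℝ] E, ContinuousOn Ψ K ∧
      (∀ z ∈ K, ∀ u v, η (k / (N + 1 : ℕ)) z (Ψ z u) (Ψ z v) = η 0 z u v) ∧
      ∀ z ∈ K, ∀ z' ∈ K, ∀ L : E ≃L[ℝ] E,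
        (∀ t ∈ I, ∀ u v, η t z' (L u) (L v) = η t z u v) → ∀ u, Ψ z' (L u) = L (Ψ z u) := by
    intro k
    induction k with
    | zero =>
      intro _
      refine ⟨fun _ => 1, continuousOn_const, fun z hz u v => ?_, fun z _ z' _ L _ u => rfl⟩
      simp
    | succ k ih =>
      intro hk
      obtain ⟨Ψ, hΨc, hΨ, hΨn⟩ := ih (by omega)
      have hN0 : (0 : ℝ) < (N + 1 : ℕ) := by positivity
      have hkI : ∀ j : ℕ, j ≤ N + 1 → ((j : ℝ) / (N + 1 : ℕ)) ∈ I := fun j hj =>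
        ⟨by positivity, by rw [div_le_one hN0]; exact_mod_cast hj⟩
      have hs := hkI k (by omega)
      have ht := hkI (k + 1) hk
      have hst : |(k : ℝ) / (N + 1 : ℕ) - ((k + 1 : ℕ) : ℝ) / (N + 1 : ℕ)| < δ := by
        rw [← sub_div, abs_div, abs_of_pos hN0]
        push_cast at hN ⊢
        simpa using hN
      set s : ℝ := (k : ℝ) / (N + 1 : ℕ)
      set t : ℝ := ((k + 1 : ℕ) : ℝ) / (N + 1 : ℕ)
      have hsm := fun z hz => hsmall s t z hs ht hz hst
      refine ⟨fun z => sqrtSeries (B (s, t, z)) ∘L Ψ z, ?_, ?_, ?_⟩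
      · refine ContinuousOn.clm_comp ?_ hΨc
        refine continuousOn_sqrtSeries.comp (f := fun z => B (s, t, z)) ?_ fun z hz => hsm z hz
        exact hBc.comp (f := fun z => (s, t, z)) (by fun_prop) fun z hz => ⟨hs, ht, hz⟩
      · intro z hz u v
        have hadj : ∀ u v, η t z (B (s, t, z) u) v = η t z u (B (s, t, z) v) := by
          intro u v
          rw [hB s t z ht hz, (hnd t ht z hz).swap, hB s t z ht hz, (hnd s hs z hz).swap]
        rw [ContinuousLinearMap.comp_apply, ContinuousLinearMap.comp_apply,
          ← selfAdjoint_sqrtSeries _ (hsm z hz) hadj, ← mul_apply_eq_comp,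
          sqrtSeries_mul_self (hsm z hz), hB s t z ht hz, hΨ z hz]
      · intro z hz z' hz' L hL u
        -- A linear isomorphism that preserves all the forms intertwines the operators `B`, hence
        -- their square roots. This will make `Ψ` equivariant under scaling of the cone.
        have hLB : (L : E →L[ℝ] E) * B (s, t, z) = B (s, t, z') * (L : E →L[ℝ] E) := by
          ext u
          refine (hnd t ht z' hz').ext_left fun v => ?_
          obtain ⟨v, rfl⟩ := L.surjective v
          simp only [mul_apply_eq_comp, ContinuousLinearEquiv.coe_coe]
          rw [hL t ht, hB s t z ht hz, hB s t z' ht hz', hL s hs]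
        have := intertwine_sqrtSeries (hsm z hz) (hsm z' hz') hLB
        have h2 := DFunLike.congr_fun this (Ψ z u)
        simp only [mul_apply_eq_comp, ContinuousLinearEquiv.coe_coe] at h2
        rw [ContinuousLinearMap.comp_apply, ContinuousLinearMap.comp_apply, hΨn z hz z' hz' L hL, h2]
  obtain ⟨Ψ, h1, h2, h3⟩ := key (N + 1) le_rfl
  refine ⟨Ψ, h1, ?_, h3⟩
  rwa [div_self (by positivity)] at h2

end Moser

namespace CP

variable {n : ℕ}

/-! ### The projection `ℂⁿ⁺¹ ∖ {0} → ℂℙⁿ` -/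

open Classical in
/-- The projection `z ↦ [z]`, with an arbitrary value at `0`. -/
def proj (z : Fin (n + 1) → ℂ) : CP n :=
  if h : z ≠ 0 then Projectivization.mk ℂ z h
  else Projectivization.mk ℂ (Pi.single 0 1) (by simp)

theorem proj_eq {z : Fin (n + 1) → ℂ} (hz : z ≠ 0) : proj z = Projectivization.mk ℂ z hz :=
  dif_pos hz

theorem proj_smul {z : Fin (n + 1) → ℂ} {c : ℂ} (hc : c ≠ 0) : proj (c • z) = proj z := by
  by_cases hz : z = 0
  · simp [hz]
  · rw [proj_eq hz, proj_eq (smul_ne_zero hc hz), Projectivization.mk_eq_mk_iff']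
    exact ⟨c, rfl⟩

theorem isOpen_ne_zero : IsOpen {z : Fin (n + 1) → ℂ | z ≠ 0} := isOpen_ne

theorem proj_mem_affineOpen {z : Fin (n + 1) → ℂ} (hz : z ≠ 0) (i : Fin (n + 1)) :
    proj z ∈ affineOpen i ↔ z i ≠ 0 := by
  rw [proj_eq hz, mk_mem_affineOpen]

theorem affineCoord_proj {z : Fin (n + 1) → ℂ} (hz : z ≠ 0) (i : Fin (n + 1)) :
    affineCoord i (proj z) = fun j => z (i.succAbove j) / z i := by
  rw [proj_eq hz, affineCoord_mk]

theorem continuousOn_proj : ContinuousOn (proj : (Fin (n + 1) → ℂ) → CP n) {z | z ≠ 0} := by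
  rw [continuousOn_iff_continuous_domRestrict]
  convert! (continuous_mk' (n := n)) using 1
  funext v
  exact proj_eq v.2

theorem contMDiffOn_affineCoord (i : Fin (n + 1)) :
    ContMDiffOn 𝓘(ℝ, Fin n → ℂ) 𝓘(ℝ, Fin n → ℂ) ∞ (affineCoord i : CP n → _)
      (affineOpen i) := by
  have h : affineChart i ∈ IsManifold.maximalAtlas 𝓘(ℝ, Fin n → ℂ) ∞ (CP n) :=
    IsManifold.subset_maximalAtlas (Set.mem_range_self i)
  exact contMDiffOn_of_mem_maximalAtlas h

/-- The index of the preferred chart at `p`. -/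
def chartIndex (p : CP n) : Fin (n + 1) := (exists_mem_affineOpen p).choose

theorem mem_affineOpen_chartIndex (p : CP n) : p ∈ affineOpen (chartIndex p) :=
  (exists_mem_affineOpen p).choose_spec

theorem apply_chartIndex_ne_zero {z : Fin (n + 1) → ℂ} (hz : z ≠ 0) :
    z (chartIndex (proj z)) ≠ 0 :=
  (proj_mem_affineOpen hz _).1 (mem_affineOpen_chartIndex _)

theorem contDiffAt_coord_div {z : Fin (n + 1) → ℂ} {i : Fin (n + 1)} (hi : z i ≠ 0) :
    ContDiffAt ℝ ∞ (fun (z : Fin (n + 1) → ℂ) (j : Fin n) => z (i.succAbove j) / z i) z := by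
  refine contDiffAt_pi.2 fun j => ?_
  simp only [div_eq_mul_inv]
  refine ContDiffAt.mul ?_ (ContDiffAt.inv ?_ hi)
  · exact (contDiff_apply ℝ ℂ _).contDiffAt
  · exact (contDiff_apply ℝ ℂ _).contDiffAt

theorem contMDiffAt_proj {z : Fin (n + 1) → ℂ} (hz : z ≠ 0) :
    ContMDiffAt 𝓘(ℝ, Fin (n + 1) → ℂ) 𝓘(ℝ, Fin n → ℂ) ∞ (proj : _ → CP n) z := by
  rw [contMDiffAt_iff_target]
  refine ⟨continuousOn_proj.continuousAt (isOpen_ne_zero.mem_nhds hz), ?_⟩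
  have hi := apply_chartIndex_ne_zero hz
  refine ContDiffAt.contMDiffAt ?_
  refine (contDiffAt_coord_div hi).congr_of_eventuallyEq ?_
  filter_upwards [isOpen_ne_zero.mem_nhds hz] with y hy
  exact affineCoord_proj hy _

/-- The derivative of `proj`, with the tangent spaces read in the preferred charts. -/
def dproj (z : Fin (n + 1) → ℂ) : (Fin (n + 1) → ℂ) →L[ℝ] (Fin n → ℂ) :=
  mfderiv 𝓘(ℝ, Fin (n + 1) → ℂ) 𝓘(ℝ, Fin n → ℂ) (proj : _ → CP n) z

theorem dproj_apply {z : Fin (n + 1) → ℂ} (hz : z ≠ 0) (u : Fin (n + 1) → ℂ) :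
    dproj z u =
      fun j => (u ((chartIndex (proj z)).succAbove j) * z (chartIndex (proj z)) -
        z ((chartIndex (proj z)).succAbove j) * u (chartIndex (proj z))) /
          z (chartIndex (proj z)) ^ 2 := by
  have hi := apply_chartIndex_ne_zero hz
  have hmd := (contMDiffAt_proj hz).mdifferentiableAt (by simp)
  have h1 : dproj z =
      fderiv ℝ (fun (y : Fin (n + 1) → ℂ) (j : Fin n) =>
        y ((chartIndex (proj z)).succAbove j) / y (chartIndex (proj z))) z := by
    rw [dproj, hmd.mfderiv]
    change fderivWithin ℝ (affineCoord (chartIndex (proj z)) ∘ proj :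
      (Fin (n + 1) → ℂ) → (Fin n → ℂ)) (Set.range id) z = _
    rw [Set.range_id, fderivWithin_univ]
    refine Filter.EventuallyEq.fderiv_eq ?_
    filter_upwards [isOpen_ne_zero.mem_nhds hz] with y hy
    exact affineCoord_proj hy _
  rw [h1]
  -- The differential is evaluated as a derivative along the real line `z + t u`, which leaves the
  -- quotient rule in one variable.
  have h2 := ((contDiffAt_coord_div hi).differentiableAt (by simp)).hasFDerivAt.hasLineDerivAt u
  refine h2.unique ?_
  refine hasDerivAt_pi.2 fun j => ?_
  have h3 : ∀ l, HasDerivAt (fun t : ℝ => (z + t • u) l) (u l) 0 := by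
    intro l
    have := ((hasDerivAt_id (0 : ℝ)).smul_const (u l)).const_add (z l)
    simpa using this
  have h4 := (h3 ((chartIndex (proj z)).succAbove j)).fun_div (h3 (chartIndex (proj z)))
    (by simpa using hi)
  simpa using h4

theorem dproj_smul {z : Fin (n + 1) → ℂ} (hz : z ≠ 0) (c : ℂ) (u : Fin (n + 1) → ℂ) :
    dproj z (c • u) =
      c • dproj z u := by
  rw [dproj_apply hz, dproj_apply hz]
  funext j
  simp only [Pi.smul_apply, smul_eq_mul]
  ring

theorem dproj_self {z : Fin (n + 1) → ℂ} (hz : z ≠ 0) (c : ℂ) :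
    dproj z (c • z) =
      0 := by
  rw [dproj_apply hz]
  funext j
  simp only [Pi.smul_apply, smul_eq_mul, Pi.zero_apply]
  ring

theorem exists_eq_smul_of_dproj_eq_zero {z u : Fin (n + 1) → ℂ} (hz : z ≠ 0)
    (h : dproj z u =
      0) : ∃ c : ℂ, u = c • z := by
  have hi := apply_chartIndex_ne_zero hz
  rw [dproj_apply hz] at h
  refine ⟨u (chartIndex (proj z)) / z (chartIndex (proj z)), ?_⟩
  funext l
  refine Fin.succAboveCases (chartIndex (proj z)) ?_ (fun j => ?_) l
  · simp [hi]
  · have := congrFun h j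
    simp only [Pi.zero_apply, div_eq_zero_iff, ne_eq, OfNat.ofNat_ne_zero, not_false_eq_true, pow_eq_zero_iff, hi, or_false] at this
    simp only [Pi.smul_apply, smul_eq_mul]
    field_simp
    linear_combination this

theorem dproj_surjective {z : Fin (n + 1) → ℂ} (hz : z ≠ 0) (v : Fin n → ℂ) :
    ∃ u, dproj z u =
      v := by
  have hi := apply_chartIndex_ne_zero hz
  refine ⟨z (chartIndex (proj z)) • (chartIndex (proj z)).insertNth (0 : ℂ) v, ?_⟩
  rw [dproj_apply hz]
  funext j
  simp only [Pi.smul_apply, smul_eq_mul, Fin.insertNth_apply_succAbove,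
    Fin.insertNth_apply_same]
  field_simp
  ring

/-- A section of the tangent bundle along `proj`, obtained by pushing forward a constant vector. -/
theorem continuousOn_dproj (u : Fin (n + 1) → ℂ) :
    ContinuousOn (fun z : Fin (n + 1) → ℂ => Bundle.TotalSpace.mk' (Fin n → ℂ)
      (E := fun p : CP n => TangentSpace 𝓘(ℝ, Fin n → ℂ) p) (proj z)
      (dproj z u)) {z | z ≠ 0} := by
  have h : ContMDiffOn 𝓘(ℝ, Fin (n + 1) → ℂ) 𝓘(ℝ, Fin n → ℂ) ∞ (proj : _ → CP n) {z | z ≠ 0} :=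
    fun z hz => (contMDiffAt_proj hz).contMDiffWithinAt
  have h2 := h.continuousOn_tangentMapWithin (by simp) isOpen_ne_zero.uniqueMDiffOn
  have h3 : Continuous fun z : Fin (n + 1) → ℂ =>
      (Bundle.TotalSpace.mk' (Fin (n + 1) → ℂ)
        (E := fun z : Fin (n + 1) → ℂ => TangentSpace 𝓘(ℝ, Fin (n + 1) → ℂ) z) z u) := by
    rw [← (tangentBundleModelSpaceHomeomorph 𝓘(ℝ, Fin (n + 1) → ℂ)).comp_continuous_iff]
    exact continuous_id.prodMk continuous_const
  refine (h2.comp h3.continuousOn fun z hz => hz).congr fun z hz => ?_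
  simp only [Function.comp, tangentMapWithin]
  rw [mfderivWithin_of_isOpen isOpen_ne_zero hz]
  rfl

/-- The pullback of a family of bilinear forms under `proj` is invariant under scaling. -/
theorem pullback_proj_smul (Ω : (p : CP n) → TangentSpace 𝓘(ℝ, Fin n → ℂ) p →
      TangentSpace 𝓘(ℝ, Fin n → ℂ) p → ℝ) {z : Fin (n + 1) → ℂ} (hz : z ≠ 0) {c : ℂ} (hc : c ≠ 0)
    (u v : Fin (n + 1) → ℂ) :
    Ω (proj (c • z))
      (dproj (c • z) (c • u))
      (dproj (c • z) (c • v)) =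
    Ω (proj z)
      (dproj z u)
      (dproj z v) := by
  let L : (Fin (n + 1) → ℂ) →L[ℝ] (Fin (n + 1) → ℂ) :=
    c • ContinuousLinearMap.id ℝ (Fin (n + 1) → ℂ)
  have hfun : (proj ∘ L : (Fin (n + 1) → ℂ) → CP n) = proj := by
    funext y
    exact proj_smul hc
  have hd : mfderiv 𝓘(ℝ, Fin (n + 1) → ℂ) 𝓘(ℝ, Fin n → ℂ) (proj ∘ L : _ → CP n) z =
      (mfderiv 𝓘(ℝ, Fin (n + 1) → ℂ) 𝓘(ℝ, Fin n → ℂ) (proj : _ → CP n) (c • z)).comp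
        (mfderiv 𝓘(ℝ, Fin (n + 1) → ℂ) 𝓘(ℝ, Fin (n + 1) → ℂ) L z) :=
    mfderiv_comp z ((contMDiffAt_proj (smul_ne_zero hc hz)).mdifferentiableAt (by simp))
      L.differentiableAt.mdifferentiableAt
  have hL : mfderiv 𝓘(ℝ, Fin (n + 1) → ℂ) 𝓘(ℝ, Fin (n + 1) → ℂ) L z = L := by
    rw [mfderiv_eq_fderiv]
    exact L.fderiv
  rw [hL] at hd
  -- The tangent spaces depend on base points that are only propositionally equal, so the comparison
  -- is made along an equality of whole maps.
  have gen : ∀ f g : (Fin (n + 1) → ℂ) → CP n, f = g →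
      Ω (f z) (mfderiv 𝓘(ℝ, Fin (n + 1) → ℂ) 𝓘(ℝ, Fin n → ℂ) f z u)
        (mfderiv 𝓘(ℝ, Fin (n + 1) → ℂ) 𝓘(ℝ, Fin n → ℂ) f z v) =
      Ω (g z) (mfderiv 𝓘(ℝ, Fin (n + 1) → ℂ) 𝓘(ℝ, Fin n → ℂ) g z u)
        (mfderiv 𝓘(ℝ, Fin (n + 1) → ℂ) 𝓘(ℝ, Fin n → ℂ) g z v) := by
    rintro f g rfl
    rfl
  have := gen _ _ hfun
  rw [hd] at this
  exact this

/-! ### Local sections -/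

/-- The section `p ↦ (p_l / p_i)_l` of the projection over `U_i`. -/
def affineSection (i : Fin (n + 1)) (p : CP n) : Fin (n + 1) → ℂ :=
  i.insertNth (1 : ℂ) (affineCoord i p)

theorem affineSection_ne_zero (i : Fin (n + 1)) (p : CP n) : affineSection i p ≠ 0 :=
  insertNth_one_ne_zero i _

theorem proj_affineSection {i : Fin (n + 1)} {p : CP n} (hp : p ∈ affineOpen i) :
    proj (affineSection i p) = p := by
  rw [proj_eq (affineSection_ne_zero i p)]
  exact (affineChart i).left_inv hp

theorem contMDiffOn_affineSection (i : Fin (n + 1)) :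
    ContMDiffOn 𝓘(ℝ, Fin n → ℂ) 𝓘(ℝ, Fin (n + 1) → ℂ) ∞ (affineSection i : CP n → _)
      (affineOpen i) := by
  have h : ContDiff ℝ ∞ fun w : Fin n → ℂ => (i.insertNth (1 : ℂ) w : Fin (n + 1) → ℂ) := by
    refine contDiff_pi.2 fun l => ?_
    refine Fin.succAboveCases i ?_ (fun l => ?_) l
    · simpa using contDiff_const
    · simpa using contDiff_apply ℝ ℂ l
  exact h.contMDiff.comp_contMDiffOn (contMDiffOn_affineCoord i)

/-! ### Positivity of the Fubini–Study form -/

theorem fubiniStudy_neg_right (p : CP n) (u v : Fin n → ℂ) :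
    fubiniStudy p u (-v : Fin n → ℂ) = -fubiniStudy p u v := by
  simp only [fubiniStudy]
  rw [← Complex.neg_im]
  congr 1
  rw [dotProduct_neg, dotProduct_neg]
  ring

/-- By Cauchy–Schwarz the numerator `(1 + |w|²) |u|² - |⟨u, w⟩|²` is at least `|u|²`. -/
theorem fubiniStudy_I_smul_pos (p : CP n) {u : Fin n → ℂ} (hu : u ≠ 0) :
    0 < fubiniStudy p u (Complex.I • u : Fin n → ℂ) := by
  simp only [fubiniStudy]
  generalize (chartAt (Fin n → ℂ) p p : Fin n → ℂ) = w
  let a : EuclideanSpace ℂ (Fin n) := WithLp.toLp 2 u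
  let b : EuclideanSpace ℂ (Fin n) := WithLp.toLp 2 w
  have ha : a ≠ 0 := by simpa [a] using hu
  have e1 : star w ⬝ᵥ w = ((‖b‖ ^ 2 : ℝ) : ℂ) := by
    have := inner_self_eq_norm_sq_to_K (𝕜 := ℂ) b
    rw [EuclideanSpace.inner_eq_star_dotProduct, dotProduct_comm] at this
    rw [this]; push_cast; rfl
  have e2 : star u ⬝ᵥ u = ((‖a‖ ^ 2 : ℝ) : ℂ) := by
    have := inner_self_eq_norm_sq_to_K (𝕜 := ℂ) a
    rw [EuclideanSpace.inner_eq_star_dotProduct, dotProduct_comm] at this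
    rw [this]; push_cast; rfl
  have e3 : (star u ⬝ᵥ w) * (star w ⬝ᵥ u) = ((‖inner ℂ a b‖ ^ 2 : ℝ) : ℂ) := by
    have h1 : star u ⬝ᵥ w = inner ℂ a b := by
      rw [EuclideanSpace.inner_eq_star_dotProduct, dotProduct_comm]
    have h2 : star w ⬝ᵥ u = inner ℂ b a := by
      rw [EuclideanSpace.inner_eq_star_dotProduct, dotProduct_comm]
    rw [h1, h2, ← inner_conj_symm b a, Complex.mul_conj, Complex.normSq_eq_norm_sq]
  have e4 : ((1 + star w ⬝ᵥ w) * (star u ⬝ᵥ (Complex.I • u)) -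
      (star u ⬝ᵥ w) * (star w ⬝ᵥ (Complex.I • u))) / (1 + star w ⬝ᵥ w) ^ 2 =
      (((((1 + ‖b‖ ^ 2) * ‖a‖ ^ 2 - ‖inner ℂ a b‖ ^ 2) / (1 + ‖b‖ ^ 2) ^ 2 : ℝ)) : ℂ) *
        Complex.I := by
    rw [dotProduct_smul, dotProduct_smul, smul_eq_mul, smul_eq_mul]
    push_cast at e1 e2 e3 ⊢
    rw [← e1, ← e2, ← e3]
    ring
  rw [e4, Complex.im_ofReal_mul, Complex.I_im, mul_one]
  have hcs := norm_inner_le_norm (𝕜 := ℂ) a b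
  have hcs2 : ‖inner ℂ a b‖ ^ 2 ≤ ‖a‖ ^ 2 * ‖b‖ ^ 2 := by
    rw [← mul_pow]
    exact pow_le_pow_left₀ (norm_nonneg _) hcs 2
  have hap : 0 < ‖a‖ ^ 2 := by positivity
  refine div_pos ?_ (by positivity)
  nlinarith

end CP

/-! ### Determinants of complex-linear parts -/

section ComplexLinearPart

variable {m : ℕ}

/-- The matrix of the complex-linear part `u ↦ (L u - i L (i u)) / 2` of a real-linear map. -/
def complexPart (L : (Fin m → ℂ) →L[ℝ] (Fin m → ℂ)) : Matrix (Fin m) (Fin m) ℂ :=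
  Matrix.of fun j k => (L (Pi.single k 1) j - Complex.I * L (Pi.single k Complex.I) j) / 2

theorem complexPart_mulVec (L : (Fin m → ℂ) →L[ℝ] (Fin m → ℂ)) (u : Fin m → ℂ) :
    (complexPart L).mulVec u = (2 : ℂ)⁻¹ • (L u - Complex.I • L (Complex.I • u)) := by
  let P : (Fin m → ℂ) →ₗ[ℂ] (Fin m → ℂ) :=
    { toFun := fun u => (2 : ℂ)⁻¹ • (L u - Complex.I • L (Complex.I • u))
      map_add' := fun u v => by simp only [smul_add, map_add]; module
      map_smul' := fun c u => by
        have h1 : ∀ (a : ℝ) v, L ((a : ℂ) • v) = (a : ℂ) • L v := by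
          intro a v
          rw [Complex.coe_smul, map_smul, Complex.coe_smul]
        have h2 : L (c • u) = (c.re : ℂ) • L u + (c.im : ℂ) • L (Complex.I • u) := by
          conv_lhs => rw [← Complex.re_add_im c, add_smul, mul_smul, map_add, h1, h1]
        have h3 : L (Complex.I • c • u) =
            (c.re : ℂ) • L (Complex.I • u) - (c.im : ℂ) • L u := by
          have : Complex.I • c • u = (c.re : ℂ) • Complex.I • u - (c.im : ℂ) • u := by
            conv_lhs => rw [← Complex.re_add_im c]
            rw [smul_smul, smul_smul, ← sub_smul]
            congr 1
            linear_combination (c.im : ℂ) * Complex.I_mul_I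
          rw [this, map_sub, h1, h1]
        rw [h2, h3]
        simp only [RingHom.id_apply]
        conv_rhs => rw [← Complex.re_add_im c]
        funext j
        simp only [Pi.smul_apply, Pi.add_apply, Pi.sub_apply, smul_eq_mul]
        linear_combination (2 : ℂ)⁻¹ * (c.im * L (Complex.I • u) j) * Complex.I_mul_I }
  change _ = P u
  have : complexPart L = LinearMap.toMatrix' P := by
    ext j k
    rw [LinearMap.toMatrix'_apply]
    change _ = ((2 : ℂ)⁻¹ • (L (Pi.single k 1) - Complex.I • L (Complex.I • Pi.single k 1))) j
    rw [← Pi.single_smul]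
    simp only [complexPart, Matrix.of_apply, Pi.smul_apply, Pi.sub_apply, smul_eq_mul, mul_one]
    ring
  rw [this, LinearMap.toMatrix'_mulVec]

/-- The determinant of the complex-linear part. -/
def complexDet (L : (Fin m → ℂ) →L[ℝ] (Fin m → ℂ)) : ℂ := (complexPart L).det

theorem continuous_complexDet : Continuous (complexDet (m := m)) := by
  refine Continuous.matrix_det (continuous_matrix fun j k => ?_)
  have h : ∀ v : Fin m → ℂ, Continuous fun L : (Fin m → ℂ) →L[ℝ] (Fin m → ℂ) => L v j :=
    fun v => (continuous_apply j).comp (ContinuousLinearMap.apply ℝ (Fin m → ℂ) v).continuous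
  exact ((h _).sub (continuous_const.mul (h _))).div_const _

theorem complexDet_smul (c : ℂ) (L : (Fin m → ℂ) →L[ℝ] (Fin m → ℂ)) :
    complexDet (c • L) = c ^ m * complexDet L := by
  have : complexPart (c • L) = c • complexPart L := by
    ext j k
    simp only [complexPart, Matrix.of_apply, Matrix.smul_apply, smul_apply, Pi.smul_apply,
      smul_eq_mul]
    ring
  rw [complexDet, this, Matrix.det_smul, Fintype.card_fin, complexDet]

theorem complexDet_comp_smul (c : ℂ) {L L' : (Fin m → ℂ) →L[ℝ] (Fin m → ℂ)}
    (h : ∀ u, L' u = L (c • u)) : complexDet L' = c ^ m * complexDet L := by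
  have : complexPart L' = c • complexPart L := by
    refine Matrix.mulVec_injective (funext fun u => ?_)
    rw [complexPart_mulVec, Matrix.smul_mulVec, ← Matrix.mulVec_smul, complexPart_mulVec, h, h,
      smul_comm c Complex.I u]
  rw [complexDet, this, Matrix.det_smul, Fintype.card_fin, complexDet]

theorem complexDet_ne_zero {L : (Fin m → ℂ) →L[ℝ] (Fin m → ℂ)}
    (h : ∀ u, L (Complex.I • u) = -(Complex.I • L u) → u = 0) : complexDet L ≠ 0 := by
  refine (Matrix.isUnit_iff_isUnit_det _).1 (Matrix.mulVec_injective_iff_isUnit.1 ?_) |>.ne_zero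
  rw [← Matrix.coe_mulVecLin, injective_iff_map_eq_zero]
  intro u hu
  rw [Matrix.mulVecLin_apply, complexPart_mulVec, smul_eq_zero] at hu
  refine h u ?_
  have h2 : L u = Complex.I • L (Complex.I • u) :=
    sub_eq_zero.1 (hu.resolve_left (by norm_num))
  rw [h2, smul_smul, Complex.I_mul_I]
  simp

end ComplexLinearPart

/-! ### Hermitian coefficients -/

section HermitianCoeff

variable {m : ℕ}

/-- The coefficient of `z` in the orthogonal projection of `u` to `ℂ z`. -/
def hermCoeff (z : Fin m → ℂ) : (Fin m → ℂ) →L[ℂ] ℂ :=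
  (star z ⬝ᵥ z)⁻¹ • ∑ j, star (z j) • ContinuousLinearMap.proj (R := ℂ) (φ := fun _ => ℂ) j

theorem hermCoeff_apply (z u : Fin m → ℂ) : hermCoeff z u = (star z ⬝ᵥ z)⁻¹ * (star z ⬝ᵥ u) := by
  simp [hermCoeff, dotProduct]

theorem star_dotProduct_self_ne_zero {z : Fin m → ℂ} (hz : z ≠ 0) : star z ⬝ᵥ z ≠ 0 := by
  open ComplexOrder in
  rwa [ne_eq, dotProduct_star_self_eq_zero]

theorem hermCoeff_self {z : Fin m → ℂ} (hz : z ≠ 0) : hermCoeff z z = 1 := by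
  rw [hermCoeff_apply, inv_mul_cancel₀ (star_dotProduct_self_ne_zero hz)]

theorem hermCoeff_smul_left {c : ℂ} (z u : Fin m → ℂ) :
    hermCoeff (c • z) u = c⁻¹ * hermCoeff z u := by
  rw [hermCoeff_apply, hermCoeff_apply]
  by_cases hc : c = 0
  · simp [hc]
  · have hc' : star c ≠ 0 := star_ne_zero.2 hc
    rw [star_smul, smul_dotProduct, smul_dotProduct, dotProduct_smul]
    simp only [smul_eq_mul, mul_inv]
    field_simp

theorem hermCoeff_smul_smul {c : ℂ} (hc : c ≠ 0) (z u : Fin m → ℂ) :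
    hermCoeff (c • z) (c • u) = hermCoeff z u := by
  rw [hermCoeff_smul_left, map_smul, smul_eq_mul, inv_mul_cancel_left₀ hc]

theorem continuousOn_hermCoeff (u : Fin m → ℂ) :
    ContinuousOn (fun z => hermCoeff z u) {z : Fin m → ℂ | z ≠ 0} := by
  simp only [hermCoeff_apply]
  refine ContinuousOn.mul (ContinuousOn.inv₀ ?_ fun z hz => star_dotProduct_self_ne_zero hz) ?_
  · exact (Continuous.dotProduct continuous_star continuous_id).continuousOn
  · exact (Continuous.dotProduct continuous_star continuous_const).continuousOn

/-- Replace the component along `G` of the values of `D` by the coefficient along `z`. -/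
def adjustedDeriv (z G : Fin m → ℂ) (D : (Fin m → ℂ) →L[ℝ] (Fin m → ℂ)) :
    (Fin m → ℂ) →L[ℝ] (Fin m → ℂ) :=
  D + ((hermCoeff z).restrictScalars ℝ - (hermCoeff G).restrictScalars ℝ ∘L D).smulRight G

theorem adjustedDeriv_apply (z G : Fin m → ℂ) (D : (Fin m → ℂ) →L[ℝ] (Fin m → ℂ))
    (u : Fin m → ℂ) :
    adjustedDeriv z G D u = D u + (hermCoeff z u - hermCoeff G (D u)) • G := rfl

/-- For a scale-invariant lift `G` the derivative `D` kills the line `ℂ z`. The adjustment sends `z`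
to `G` and makes the area forms on `ℂ z` and `ℂ G` correspond, so that invertibility becomes
possible. -/
theorem hermCoeff_adjustedDeriv (z : Fin m → ℂ) {G : Fin m → ℂ} (hG : G ≠ 0)
    (D : (Fin m → ℂ) →L[ℝ] (Fin m → ℂ)) (u : Fin m → ℂ) :
    hermCoeff G (adjustedDeriv z G D u) = hermCoeff z u := by
  rw [adjustedDeriv_apply, map_add, map_smul, hermCoeff_self hG, smul_eq_mul, mul_one]
  ring

/-- Rescaling the lift `G` by a function `a` changes its derivative `D` to `a D + da · G`. Here `β`
plays the role of `da`; this term points along `G` and the adjustment discards it. -/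
theorem adjustedDeriv_smul (z : Fin m → ℂ) {G : Fin m → ℂ} (hG : G ≠ 0) {a : ℂ} (ha : a ≠ 0)
    {D D' : (Fin m → ℂ) →L[ℝ] (Fin m → ℂ)} (β : (Fin m → ℂ) → ℂ)
    (h : ∀ u, D' u = a • D u + β u • G) :
    adjustedDeriv z (a • G) D' = a • adjustedDeriv z G D := by
  ext1 u
  rw [smul_apply, adjustedDeriv_apply, adjustedDeriv_apply, h,
    hermCoeff_smul_left, map_add, map_smul, map_smul, hermCoeff_self hG]
  simp only [smul_eq_mul]
  rw [mul_add, inv_mul_cancel_left₀ ha, mul_one, smul_add, smul_smul, smul_smul, add_assoc,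
    ← add_smul]
  congr 2
  field_simp
  ring

theorem adjustedDeriv_smul_source {z : Fin m → ℂ} {c : ℂ} (hc : c ≠ 0) (G : Fin m → ℂ)
    {D D' : (Fin m → ℂ) →L[ℝ] (Fin m → ℂ)} (h : ∀ u, D' (c • u) = D u) (u : Fin m → ℂ) :
    adjustedDeriv (c • z) G D' (c • u) = adjustedDeriv z G D u := by
  rw [adjustedDeriv_apply, adjustedDeriv_apply, h, hermCoeff_smul_smul hc]

end HermitianCoeff

namespace CP

variable {n : ℕ}

/-! ### Lifting two-forms from `ℂℙⁿ` to `ℂⁿ⁺¹` -/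

/-- The two-form `(a, b) ↦ Im (conj a * b)` on `ℂ`. -/
def areaForm : ℂ →L[ℝ] ℂ →L[ℝ] ℝ :=
  (ContinuousLinearMap.compL ℝ ℂ ℂ ℝ Complex.imCLM).comp
    ((ContinuousLinearMap.mul ℝ ℂ).comp (Complex.conjCLE : ℂ →L[ℝ] ℂ))

theorem areaForm_apply (a b : ℂ) : areaForm a b = (star a * b).im := rfl

/-- The lift to `ℂⁿ⁺¹` of a family of forms on `ℂℙⁿ`: the pullback under the projection, plus the
standard form on the line `ℂ z`. -/
def liftForm (Ω : CP n → (Fin n → ℂ) → (Fin n → ℂ) → ℝ) (z u v : Fin (n + 1) → ℂ) : ℝ :=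
  Ω (proj z) (dproj z u) (dproj z v) + areaForm (hermCoeff z u) (hermCoeff z v)

theorem liftForm_apply (Ω : CP n → (Fin n → ℂ) → (Fin n → ℂ) → ℝ) (z u v : Fin (n + 1) → ℂ) :
    liftForm Ω z u v =
      Ω (proj z) (dproj z u) (dproj z v) + areaForm (hermCoeff z u) (hermCoeff z v) := rfl

theorem liftForm_smul (Ω : CP n → (Fin n → ℂ) → (Fin n → ℂ) → ℝ) {z : Fin (n + 1) → ℂ}
    (hz : z ≠ 0) {c : ℂ} (hc : c ≠ 0) (u v : Fin (n + 1) → ℂ) :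
    liftForm Ω (c • z) (c • u) (c • v) = liftForm Ω z u v := by
  rw [liftForm_apply, liftForm_apply, hermCoeff_smul_smul hc, hermCoeff_smul_smul hc]
  congr 1
  exact pullback_proj_smul Ω hz hc u v

theorem areaForm_I_smul (a : ℂ) : areaForm a (Complex.I • a) = ‖a‖ ^ 2 := by
  rw [areaForm_apply, smul_eq_mul, mul_left_comm, Complex.star_def, ← Complex.normSq_eq_conj_mul_self,
    mul_comm, Complex.im_ofReal_mul, Complex.I_im, mul_one, Complex.normSq_eq_norm_sq]

/-- The Fubini–Study form, with the tangent spaces read as `ℂⁿ`. -/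
def fubiniStudyChart : CP n → (Fin n → ℂ) → (Fin n → ℂ) → ℝ := fubiniStudy

theorem fubiniStudyChart_neg_right (p : CP n) (u v : Fin n → ℂ) :
    fubiniStudyChart p u (-v) = -fubiniStudyChart p u v := fubiniStudy_neg_right p u v

theorem fubiniStudyChart_I_smul_pos (p : CP n) {u : Fin n → ℂ} (hu : u ≠ 0) :
    0 < fubiniStudyChart p u (Complex.I • u) := fubiniStudy_I_smul_pos p hu

theorem fubiniStudyChart_zero_left (p : CP n) (v : Fin n → ℂ) :
    fubiniStudyChart p 0 v = 0 := by
  simp [fubiniStudyChart, fubiniStudy]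

theorem liftForm_fubiniStudyChart_neg_right {z : Fin (n + 1) → ℂ} (u v : Fin (n + 1) → ℂ) :
    liftForm fubiniStudyChart z u (-v) = -liftForm fubiniStudyChart z u v := by
  rw [liftForm_apply, liftForm_apply, map_neg, map_neg, map_neg, fubiniStudyChart_neg_right]
  ring

/-- The horizontal and vertical terms are both nonnegative on `(u, i u)`. The first is positive
unless `u` is a multiple of `z`, and then the second is. -/
theorem liftForm_fubiniStudyChart_I_smul_pos {z : Fin (n + 1) → ℂ} (hz : z ≠ 0)
    {u : Fin (n + 1) → ℂ} (hu : u ≠ 0) : 0 < liftForm fubiniStudyChart z u (Complex.I • u) := by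
  rw [liftForm_apply, dproj_smul hz, map_smul, areaForm_I_smul]
  by_cases h : dproj z u = 0
  · obtain ⟨c, rfl⟩ := exists_eq_smul_of_dproj_eq_zero hz h
    have hc : c ≠ 0 := by rintro rfl; simp at hu
    rw [h, fubiniStudyChart_zero_left, map_smul, hermCoeff_self hz]
    simp [hc]
  · have :=  fubiniStudyChart_I_smul_pos (proj z) h
    positivity

/-- `liftForm` for continuous bilinear forms. -/
def liftFormL (θ : CP n → (Fin n → ℂ) →L[ℝ] (Fin n → ℂ) →L[ℝ] ℝ) (z : Fin (n + 1) → ℂ) :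
    (Fin (n + 1) → ℂ) →L[ℝ] (Fin (n + 1) → ℂ) →L[ℝ] ℝ :=
  ContinuousLinearMap.bilinearComp
      (θ (proj z)) (dproj z) (dproj z) +
    areaForm.bilinearComp ((hermCoeff z).restrictScalars ℝ) ((hermCoeff z).restrictScalars ℝ)

theorem liftFormL_apply (θ : CP n → (Fin n → ℂ) →L[ℝ] (Fin n → ℂ) →L[ℝ] ℝ) (z u v : Fin (n + 1) → ℂ) :
    liftFormL θ z u v = liftForm (fun p u v => θ p u v) z u v := rfl

theorem isNondegenerateTwoForm_liftFormL {θ : CP n → (Fin n → ℂ) →L[ℝ] (Fin n → ℂ) →L[ℝ] ℝ} {z : Fin (n + 1) → ℂ} (hz : z ≠ 0)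
    (h : IsNondegenerateTwoForm (θ (proj z))) : IsNondegenerateTwoForm (liftFormL θ z) := by
  have harea : ∀ a : ℂ, areaForm a a = 0 := by
    intro a
    rw [areaForm_apply, Complex.star_def, ← Complex.normSq_eq_conj_mul_self, Complex.ofReal_im]
  refine ⟨fun u => ?_, fun u hu => ?_⟩
  · rw [liftFormL_apply, liftForm_apply, harea, add_zero]
    exact h.1 _
  · have hd : dproj z u = 0 := by
      refine h.2 _ fun v => ?_
      obtain ⟨w, hw⟩ := dproj_surjective hz v
      -- Removing the vertical component of the test vector kills the area term and leaves its
      -- projection unchanged.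
      have h2 := hu (w - hermCoeff z w • z)
      rw [liftFormL_apply, liftForm_apply, (dproj z).map_sub, (hermCoeff z).map_sub, (hermCoeff z).map_smul,
        hermCoeff_self hz, smul_eq_mul, mul_one, sub_self, map_zero, add_zero, dproj_self hz,
        sub_zero, hw] at h2
      exact h2
    obtain ⟨c, rfl⟩ := exists_eq_smul_of_dproj_eq_zero hz hd
    -- Now `u = c z` is vertical, and pairing it with `i u` gives `|c|²`.
    have h2 := hu (Complex.I • c • z)
    rw [liftFormL_apply, liftForm_apply, (hermCoeff z).map_smul Complex.I, areaForm_I_smul,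
      (hermCoeff z).map_smul, hermCoeff_self hz, hd, map_zero] at h2
    simp only [zero_apply, smul_eq_mul, mul_one, zero_add, ne_eq, OfNat.ofNat_ne_zero, not_false_eq_true,
      pow_eq_zero_iff, norm_eq_zero] at h2
    rw [h2, zero_smul]

/-- Evaluation of bundle-valued bilinear maps is continuous into the trivial line bundle, whose
fibre coordinate is the number sought. -/
theorem continuousOn_bilin_tangent {M : Type*} [TopologicalSpace M] {s : Set M} {b : M → CP n}
    {φ : (m : M) → TangentSpace 𝓘(ℝ, Fin n → ℂ) (b m) →L[ℝ]
      TangentSpace 𝓘(ℝ, Fin n → ℂ) (b m) →L[ℝ] ℝ}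
    {v w : (m : M) → TangentSpace 𝓘(ℝ, Fin n → ℂ) (b m)}
    (hφ : ContinuousOn (fun m => Bundle.TotalSpace.mk' ((Fin n → ℂ) →L[ℝ] (Fin n → ℂ) →L[ℝ] ℝ)
      (E := fun p : CP n => TangentSpace 𝓘(ℝ, Fin n → ℂ) p →L[ℝ]
        TangentSpace 𝓘(ℝ, Fin n → ℂ) p →L[ℝ] ℝ) (b m) (φ m)) s)
    (hv : ContinuousOn (fun m => Bundle.TotalSpace.mk' (Fin n → ℂ)
      (E := fun p : CP n => TangentSpace 𝓘(ℝ, Fin n → ℂ) p) (b m) (v m)) s)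
    (hw : ContinuousOn (fun m => Bundle.TotalSpace.mk' (Fin n → ℂ)
      (E := fun p : CP n => TangentSpace 𝓘(ℝ, Fin n → ℂ) p) (b m) (w m)) s) :
    ContinuousOn (fun m => φ m (v m) (w m)) s := by
  intro x hx
  have h : ContinuousWithinAt (fun m =>
      Bundle.TotalSpace.mk' ℝ (E := Bundle.Trivial (CP n) ℝ) (b m) (φ m (v m) (w m))) s x :=
    ContinuousWithinAt.clm_bundle_apply₂ (F₁ := Fin n → ℂ) (F₂ := Fin n → ℂ)
      (hφ x hx) (hv x hx) (hw x hx)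
  rw [FiberBundle.continuousWithinAt_totalSpace] at h
  exact h.2

theorem continuousOn_liftFormL {X : Set (CP n)}
    {η : ℝ → CP n → (Fin n → ℂ) →L[ℝ] (Fin n → ℂ) →L[ℝ] ℝ}
    (hη : ContinuousOn (fun q : ℝ × CP n =>
        Bundle.TotalSpace.mk' ((Fin n → ℂ) →L[ℝ] (Fin n → ℂ) →L[ℝ] ℝ)
          (E := fun p : CP n => TangentSpace 𝓘(ℝ, Fin n → ℂ) p →L[ℝ]
            TangentSpace 𝓘(ℝ, Fin n → ℂ) p →L[ℝ] ℝ) q.2 (η q.1 q.2))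
        (Set.Icc 0 1 ×ˢ X)) {K : Set (Fin (n + 1) → ℂ)} (hK0 : ∀ z ∈ K, z ≠ 0)
    (hKX : ∀ z ∈ K, proj z ∈ X) :
    ContinuousOn (fun q : ℝ × (Fin (n + 1) → ℂ) => liftFormL (η q.1) q.2)
      (Set.Icc 0 1 ×ˢ K) := by
  rw [continuousOn_clm_apply]
  intro u
  rw [continuousOn_clm_apply]
  intro v
  simp only [liftFormL_apply, liftForm_apply]
  have hsnd : Set.MapsTo (fun q : ℝ × (Fin (n + 1) → ℂ) => q.2) (Set.Icc (0 : ℝ) 1 ×ˢ K)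
      {z | z ≠ 0} := fun q hq => hK0 _ hq.2
  have hherm : ∀ u, ContinuousOn (fun q : ℝ × (Fin (n + 1) → ℂ) => hermCoeff q.2 u)
      (Set.Icc (0 : ℝ) 1 ×ˢ K) := fun u =>
    (continuousOn_hermCoeff u).comp continuous_snd.continuousOn hsnd
  refine ContinuousOn.add ?_ ?_
  · have hproj : ContinuousOn (fun q : ℝ × (Fin (n + 1) → ℂ) => (q.1, proj q.2))
        (Set.Icc (0 : ℝ) 1 ×ˢ K) :=
      continuous_fst.continuousOn.prodMk
        (continuousOn_proj.comp continuous_snd.continuousOn hsnd)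
    have h1 := hη.comp hproj fun q hq => ⟨hq.1, hKX _ hq.2⟩
    have h2 : ∀ u, ContinuousOn (fun q : ℝ × (Fin (n + 1) → ℂ) =>
        Bundle.TotalSpace.mk' (Fin n → ℂ)
          (E := fun p : CP n => TangentSpace 𝓘(ℝ, Fin n → ℂ) p) (proj q.2) (dproj q.2 u))
        (Set.Icc (0 : ℝ) 1 ×ˢ K) := fun u =>
      (continuousOn_dproj u).comp continuous_snd.continuousOn hsnd
    exact continuousOn_bilin_tangent h1 (h2 u) (h2 v)
  · have := hherm u
    have h4 := hherm v
    simp only [areaForm_apply]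
    exact Complex.continuous_im.comp_continuousOn ((continuous_star.comp_continuousOn this).mul h4)

end CP

namespace CP

variable {n : ℕ}

theorem continuousAt_hermCoeff_comp {m : ℕ} {Y : Type*} [TopologicalSpace Y] {y : Y}
    {G w : Y → Fin m → ℂ} (hG : ContinuousAt G y) (hw : ContinuousAt w y) (h0 : G y ≠ 0) :
    ContinuousAt (fun x => hermCoeff (G x) (w x)) y := by
  have hc : Continuous fun p : (Fin m → ℂ) × (Fin m → ℂ) => star p.1 ⬝ᵥ p.2 :=
    Continuous.dotProduct (continuous_star.comp continuous_fst) continuous_snd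
  have h1 : ContinuousAt (fun x => star (G x) ⬝ᵥ G x) y :=
    hc.continuousAt.comp (f := fun x => (G x, G x)) (hG.prodMk hG)
  have h2 : ContinuousAt (fun x => star (G x) ⬝ᵥ w x) y :=
    hc.continuousAt.comp (f := fun x => (G x, w x)) (hG.prodMk hw)
  simp only [hermCoeff_apply]
  exact (h1.inv₀ (star_dotProduct_self_ne_zero h0)).mul h2

/-! ### Lifting maps between subsets of `ℂℙⁿ` -/

/-- The local lift `z ↦ (ι[z]_l / ι[z]_j)_l` of `ι`, defined where `ι[z]` lies in `U_j`. -/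
def liftMap (ι : CP n → CP n) (j : Fin (n + 1)) (z : Fin (n + 1) → ℂ) : Fin (n + 1) → ℂ :=
  affineSection j (ι (proj z))

theorem liftMap_ne_zero (ι : CP n → CP n) (j : Fin (n + 1)) (z : Fin (n + 1) → ℂ) :
    liftMap ι j z ≠ 0 := affineSection_ne_zero _ _

theorem proj_liftMap {ι : CP n → CP n} {j : Fin (n + 1)} {z : Fin (n + 1) → ℂ}
    (h : ι (proj z) ∈ affineOpen j) : proj (liftMap ι j z) = ι (proj z) := proj_affineSection h

theorem liftMap_smul (ι : CP n → CP n) (j : Fin (n + 1)) (z : Fin (n + 1) → ℂ) {c : ℂ}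
    (hc : c ≠ 0) : liftMap ι j (c • z) = liftMap ι j z := by
  rw [liftMap, liftMap, proj_smul hc]

theorem affineSection_apply_same (i : Fin (n + 1)) (p : CP n) : affineSection i p i = 1 := by
  simp [affineSection]

theorem affineSection_apply_ne_zero {i j : Fin (n + 1)} {p : CP n} (hi : p ∈ affineOpen i)
    (hj : p ∈ affineOpen j) : affineSection i p j ≠ 0 := by
  rw [← proj_mem_affineOpen (affineSection_ne_zero i p), proj_affineSection hi]
  exact hj

theorem affineSection_change {i j : Fin (n + 1)} {p : CP n} (hi : p ∈ affineOpen i)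
    (hj : p ∈ affineOpen j) :
    affineSection j p = (affineSection i p j)⁻¹ • affineSection i p := by
  have h0 := affineSection_apply_ne_zero hi hj
  have h : proj (affineSection j p) = proj (affineSection i p) := by
    rw [proj_affineSection hi, proj_affineSection hj]
  rw [proj_eq (affineSection_ne_zero _ _), proj_eq (affineSection_ne_zero _ _),
    Projectivization.mk_eq_mk_iff'] at h
  obtain ⟨a, ha⟩ := h
  have h1 := congrFun ha j
  rw [Pi.smul_apply, smul_eq_mul, affineSection_apply_same] at h1
  rw [← ha, eq_inv_of_mul_eq_one_left h1]

/-! ### Derivatives of local lifts and their change under scaling and change of chart -/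

section

variable {ι : CP n → CP n} {U : Set (CP n)} (hU : IsOpen U)
  (hι : ContMDiffOn 𝓘(ℝ, Fin n → ℂ) 𝓘(ℝ, Fin n → ℂ) ∞ ι U)

include hU hι

theorem eventually_mem_affineOpen {j : Fin (n + 1)} {z : Fin (n + 1) → ℂ} (hz : z ≠ 0)
    (hzU : proj z ∈ U) (hj : ι (proj z) ∈ affineOpen j) :
    ∀ᶠ y in 𝓝 z, y ≠ 0 ∧ proj y ∈ U ∧ ι (proj y) ∈ affineOpen j := by
  have h1 : ContinuousAt (proj : _ → CP n) z :=
    continuousOn_proj.continuousAt (isOpen_ne_zero.mem_nhds hz)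
  have h2 : ContinuousAt (fun y => ι (proj y)) z :=
    ContinuousAt.comp (hι.continuousOn.continuousAt (hU.mem_nhds hzU)) h1
  filter_upwards [isOpen_ne_zero.mem_nhds hz, h1 (hU.mem_nhds hzU),
    h2 ((isOpen_affineOpen j).mem_nhds hj)] with y a b c using ⟨a, b, c⟩

theorem contDiffAt_liftMap {j : Fin (n + 1)} {z : Fin (n + 1) → ℂ} (hz : z ≠ 0)
    (hzU : proj z ∈ U) (hj : ι (proj z) ∈ affineOpen j) :
    ContDiffAt ℝ ∞ (liftMap ι j) z := by
  rw [← contMDiffAt_iff_contDiffAt]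
  have h1 := contMDiffAt_proj hz
  have h2 := (hι _ hzU).contMDiffAt (hU.mem_nhds hzU)
  have h3 := (contMDiffOn_affineSection j _ hj).contMDiffAt ((isOpen_affineOpen j).mem_nhds hj)
  exact (h3.comp z (h2.comp z h1))

/-- The derivative of `ι` in terms of its local lifts, tested on a family of forms. -/
theorem form_fderiv_liftMap (Ω : CP n → (Fin n → ℂ) → (Fin n → ℂ) → ℝ) {j : Fin (n + 1)}
    {z : Fin (n + 1) → ℂ} (hz : z ≠ 0) (hzU : proj z ∈ U) (hj : ι (proj z) ∈ affineOpen j)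
    (u v : Fin (n + 1) → ℂ) :
    Ω (proj (liftMap ι j z)) (dproj (liftMap ι j z) (fderiv ℝ (liftMap ι j) z u))
      (dproj (liftMap ι j z) (fderiv ℝ (liftMap ι j) z v)) =
    Ω (ι (proj z)) (mfderiv 𝓘(ℝ, Fin n → ℂ) 𝓘(ℝ, Fin n → ℂ) ι (proj z) (dproj z u))
      (mfderiv 𝓘(ℝ, Fin n → ℂ) 𝓘(ℝ, Fin n → ℂ) ι (proj z) (dproj z v)) := by
  have gen : ∀ f g : (Fin (n + 1) → ℂ) → CP n, f =ᶠ[𝓝 z] g →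
      Ω (f z) (mfderiv 𝓘(ℝ, Fin (n + 1) → ℂ) 𝓘(ℝ, Fin n → ℂ) f z u)
        (mfderiv 𝓘(ℝ, Fin (n + 1) → ℂ) 𝓘(ℝ, Fin n → ℂ) f z v) =
      Ω (g z) (mfderiv 𝓘(ℝ, Fin (n + 1) → ℂ) 𝓘(ℝ, Fin n → ℂ) g z u)
        (mfderiv 𝓘(ℝ, Fin (n + 1) → ℂ) 𝓘(ℝ, Fin n → ℂ) g z v) := by
    intro f g h
    have h1 : (mfderiv 𝓘(ℝ, Fin (n + 1) → ℂ) 𝓘(ℝ, Fin n → ℂ) f z :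
        (Fin (n + 1) → ℂ) →L[ℝ] (Fin n → ℂ)) =
        mfderiv 𝓘(ℝ, Fin (n + 1) → ℂ) 𝓘(ℝ, Fin n → ℂ) g z := h.mfderiv_eq
    have h2 := h.eq_of_nhds
    have h3 : Ω (f z) (mfderiv 𝓘(ℝ, Fin (n + 1) → ℂ) 𝓘(ℝ, Fin n → ℂ) f z u)
        (mfderiv 𝓘(ℝ, Fin (n + 1) → ℂ) 𝓘(ℝ, Fin n → ℂ) f z v) =
        Ω (g z) (mfderiv 𝓘(ℝ, Fin (n + 1) → ℂ) 𝓘(ℝ, Fin n → ℂ) f z u)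
        (mfderiv 𝓘(ℝ, Fin (n + 1) → ℂ) 𝓘(ℝ, Fin n → ℂ) f z v) := by rw [h2]
    exact h3.trans (congrArg₂ (Ω (g z)) (DFunLike.congr_fun h1 u) (DFunLike.congr_fun h1 v))
  have hev : (proj ∘ liftMap ι j) =ᶠ[𝓝 z] (ι ∘ proj) := by
    filter_upwards [eventually_mem_affineOpen hU hι hz hzU hj] with y hy
    exact proj_liftMap hy.2.2
  have hG := (contDiffAt_liftMap hU hι hz hzU hj).differentiableAt (by simp)
  have d1 : mfderiv 𝓘(ℝ, Fin (n + 1) → ℂ) 𝓘(ℝ, Fin n → ℂ) (proj ∘ liftMap ι j) z =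
      (mfderiv 𝓘(ℝ, Fin (n + 1) → ℂ) 𝓘(ℝ, Fin n → ℂ) (proj : _ → CP n) (liftMap ι j z)).comp
        (mfderiv 𝓘(ℝ, Fin (n + 1) → ℂ) 𝓘(ℝ, Fin (n + 1) → ℂ) (liftMap ι j) z) :=
    mfderiv_comp z ((contMDiffAt_proj (liftMap_ne_zero ι j z)).mdifferentiableAt (by simp))
      hG.mdifferentiableAt
  have d2 : mfderiv 𝓘(ℝ, Fin (n + 1) → ℂ) 𝓘(ℝ, Fin n → ℂ) (ι ∘ proj) z =
      (mfderiv 𝓘(ℝ, Fin n → ℂ) 𝓘(ℝ, Fin n → ℂ) ι (proj z)).comp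
        (mfderiv 𝓘(ℝ, Fin (n + 1) → ℂ) 𝓘(ℝ, Fin n → ℂ) (proj : _ → CP n) z) :=
    mfderiv_comp z (((hι _ hzU).contMDiffAt (hU.mem_nhds hzU)).mdifferentiableAt (by simp))
      ((contMDiffAt_proj hz).mdifferentiableAt (by simp))
  have := gen _ _ hev
  rw [d1, d2, mfderiv_eq_fderiv] at this
  exact this

/-- The adjusted derivative of a local lift, a lift of the derivative of `ι`. -/
theorem liftForm_adjustedDeriv (Ω : CP n → (Fin n → ℂ) → (Fin n → ℂ) → ℝ) {j : Fin (n + 1)}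
    {z : Fin (n + 1) → ℂ} (hz : z ≠ 0) (hzU : proj z ∈ U) (hj : ι (proj z) ∈ affineOpen j)
    (u v : Fin (n + 1) → ℂ) :
    liftForm Ω (liftMap ι j z) (adjustedDeriv z (liftMap ι j z) (fderiv ℝ (liftMap ι j) z) u)
      (adjustedDeriv z (liftMap ι j z) (fderiv ℝ (liftMap ι j) z) v) =
    Ω (ι (proj z)) (mfderiv 𝓘(ℝ, Fin n → ℂ) 𝓘(ℝ, Fin n → ℂ) ι (proj z) (dproj z u))
      (mfderiv 𝓘(ℝ, Fin n → ℂ) 𝓘(ℝ, Fin n → ℂ) ι (proj z) (dproj z v)) +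
      areaForm (hermCoeff z u) (hermCoeff z v) := by
  have hG := liftMap_ne_zero ι j z
  rw [liftForm_apply, hermCoeff_adjustedDeriv z hG, hermCoeff_adjustedDeriv z hG,
    ← form_fderiv_liftMap hU hι Ω hz hzU hj]
  have h : ∀ u, dproj (liftMap ι j z)
      (adjustedDeriv z (liftMap ι j z) (fderiv ℝ (liftMap ι j) z) u) =
      dproj (liftMap ι j z) (fderiv ℝ (liftMap ι j) z u) := by
    intro u
    rw [adjustedDeriv_apply, (dproj _).map_add, dproj_self hG, add_zero]
  rw [h, h]

/-- This is the chain rule applied to the scale invariance `liftMap ι j (c • z) = liftMap ι j z`. -/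
theorem fderiv_liftMap_smul {j : Fin (n + 1)} {z : Fin (n + 1) → ℂ} (hz : z ≠ 0)
    (hzU : proj z ∈ U) (hj : ι (proj z) ∈ affineOpen j) {c : ℂ} (hc : c ≠ 0)
    (u : Fin (n + 1) → ℂ) :
    fderiv ℝ (liftMap ι j) (c • z) (c • u) = fderiv ℝ (liftMap ι j) z u := by
  let L : (Fin (n + 1) → ℂ) →L[ℝ] (Fin (n + 1) → ℂ) :=
    c • ContinuousLinearMap.id ℝ (Fin (n + 1) → ℂ)
  have hfun : liftMap ι j ∘ L = liftMap ι j := by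
    funext y
    exact liftMap_smul ι j y hc
  have hG : DifferentiableAt ℝ (liftMap ι j) (L z) :=
    (contDiffAt_liftMap hU hι (smul_ne_zero hc hz) (by rwa [proj_smul hc])
      (by rwa [proj_smul hc])).differentiableAt (by simp)
  have h := fderiv_comp z hG L.differentiableAt
  rw [hfun, L.fderiv] at h
  rw [h]
  rfl

/-- Two lifts differ by a scalar function, and the determinant in dimension `n + 1` picks up its `(n
+ 1)`-st power. This is the factor that homogeneity of degree `(n + 1) m` will absorb. -/
theorem complexDet_adjustedDeriv_change {i j : Fin (n + 1)} {z : Fin (n + 1) → ℂ} (hz : z ≠ 0)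
    (hzU : proj z ∈ U) (hi : ι (proj z) ∈ affineOpen i) (hj : ι (proj z) ∈ affineOpen j)
    (Ψ : (Fin (n + 1) → ℂ) →L[ℝ] (Fin (n + 1) → ℂ)) :
    complexDet (adjustedDeriv z (liftMap ι j z) (fderiv ℝ (liftMap ι j) z) ∘L Ψ) =
      (liftMap ι i z j)⁻¹ ^ (n + 1) *
        complexDet (adjustedDeriv z (liftMap ι i z) (fderiv ℝ (liftMap ι i) z) ∘L Ψ) := by
  have h0 : liftMap ι i z j ≠ 0 := affineSection_apply_ne_zero hi hj
  have hGi := (contDiffAt_liftMap hU hι hz hzU hi).differentiableAt (by simp)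
  have ha : DifferentiableAt ℝ (fun y => (liftMap ι i y j)⁻¹) z :=
    (differentiableAt_pi.1 hGi j).fun_inv h0
  have hev : liftMap ι j =ᶠ[𝓝 z] fun y => (liftMap ι i y j)⁻¹ • liftMap ι i y := by
    filter_upwards [eventually_mem_affineOpen hU hι hz hzU hi,
      eventually_mem_affineOpen hU hι hz hzU hj] with y h1 h2
    exact affineSection_change h1.2.2 h2.2.2
  have hD : ∀ u, fderiv ℝ (liftMap ι j) z u = (liftMap ι i z j)⁻¹ • fderiv ℝ (liftMap ι i) z u +
      fderiv ℝ (fun y => (liftMap ι i y j)⁻¹) z u • liftMap ι i z := by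
    intro u
    rw [hev.fderiv_eq, fderiv_fun_smul ha hGi]
    rfl
  have h := adjustedDeriv_smul z (liftMap_ne_zero ι i z) (inv_ne_zero h0) _ hD
  have hG : liftMap ι j z = (liftMap ι i z j)⁻¹ • liftMap ι i z := affineSection_change hi hj
  rw [hG, h, ContinuousLinearMap.smul_comp, complexDet_smul]

theorem continuousAt_adjustedDeriv {j : Fin (n + 1)} {z : Fin (n + 1) → ℂ} (hz : z ≠ 0)
    (hzU : proj z ∈ U) (hj : ι (proj z) ∈ affineOpen j) :
    ContinuousAt (fun y => adjustedDeriv y (liftMap ι j y) (fderiv ℝ (liftMap ι j) y)) z := by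
  have h1 := contDiffAt_liftMap hU hι hz hzU hj
  have hc : ∀ u, ContinuousAt (fun y => fderiv ℝ (liftMap ι j) y u) z := fun u =>
    (ContinuousLinearMap.apply ℝ (Fin (n + 1) → ℂ) u).continuous.continuousAt.comp
      (f := fderiv ℝ (liftMap ι j)) (h1.fderiv_right (m := 0) (by simp)).continuousAt
  rw [← continuousWithinAt_univ]
  have key : ∀ u, ContinuousAt
      (fun y => adjustedDeriv y (liftMap ι j y) (fderiv ℝ (liftMap ι j) y) u) z := by
    intro u
    simp only [adjustedDeriv_apply]
    refine (hc u).add (ContinuousAt.fun_smul ?_ h1.continuousAt)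
    refine ((continuousOn_hermCoeff u).continuousAt (isOpen_ne_zero.mem_nhds hz)).sub ?_
    exact continuousAt_hermCoeff_comp h1.continuousAt (hc u) (liftMap_ne_zero ι j z)
  exact continuousWithinAt_clm_apply.2 fun u => (key u).continuousWithinAt

end

/-- An almost symplectic embedding transports nonvanishing homogeneous functions whose degree is a
multiple of `n + 1`, i.e. trivializations of a power of the canonical bundle. -/
theorem exists_homogeneous_of_almostSymplecticEmbeds {X X' U : Set (CP n)}
    (h : AlmostSymplecticEmbeds X X') (hU : IsOpen U) (hUX : U ⊆ X)
    {K : Set (Fin (n + 1) → ℂ)} (hK : IsCompact K) (hK0 : ∀ z ∈ K, z ≠ 0)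
    (hKU : ∀ z ∈ K, proj z ∈ U) (m : ℕ) {g : (Fin (n + 1) → ℂ) → ℂ}
    (hgc : ContinuousOn g {z | z ≠ 0 ∧ proj z ∈ X'}) (hg0 : ∀ z ≠ 0, proj z ∈ X' → g z ≠ 0)
    (hgh : ∀ c : ℂ, c ≠ 0 → ∀ z ≠ 0, proj z ∈ X' → g (c • z) = c ^ ((n + 1) * m) * g z) :
    ∃ f : (Fin (n + 1) → ℂ) → ℂ, ContinuousOn f K ∧ (∀ z ∈ K, f z ≠ 0) ∧
      ∀ z ∈ K, ∀ c : ℂ, c ≠ 0 → c • z ∈ K → f (c • z) = c ^ ((n + 1) * m) * f z := by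
  obtain ⟨ι, hι, -, hmaps, -, η, hηc, hηnd, hη0, hη1⟩ := h
  have hιU := hι.mono hUX
  -- The whole path of forms is lifted to the cone, with the same area term at all times. `Ψ z`
  -- carries the lifted Fubini–Study form to the lift of its pullback under `ι`.
  obtain ⟨Ψ, hΨc, hΨ, hΨn⟩ := exists_moser_isotopy hK
    (fun t z => liftFormL (n := n) (η t) z)
    (continuousOn_liftFormL hηc hK0 fun z hz => hUX (hKU z hz))
    (fun t ht z hz => isNondegenerateTwoForm_liftFormL (hK0 z hz)
      (hηnd t ht _ (hUX (hKU z hz))))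
  let δ : Fin (n + 1) → (Fin (n + 1) → ℂ) → ℂ := fun j z =>
    complexDet (adjustedDeriv z (liftMap ι j z) (fderiv ℝ (liftMap ι j) z) ∘L Ψ z)
  have hδ0 : ∀ j, ∀ z ∈ K, ι (proj z) ∈ affineOpen j → δ j z ≠ 0 := by
    intro j z hz hj
    -- If `L = adjusted derivative ∘ Ψ` were antilinear on some `u ≠ 0`, then invariance of the form
    -- would give `0 < ω(u, i u) = ω(L u, -i L u) ≤ 0`.
    refine complexDet_ne_zero fun u hu => ?_
    by_contra hu0
    have h1 : ∀ v, liftForm fubiniStudyChart (liftMap ι j z)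
        ((adjustedDeriv z (liftMap ι j z) (fderiv ℝ (liftMap ι j) z) ∘L Ψ z) u)
        ((adjustedDeriv z (liftMap ι j z) (fderiv ℝ (liftMap ι j) z) ∘L Ψ z) v) =
        liftForm fubiniStudyChart z u v := by
      intro v
      have hzX := hUX (hKU z hz)
      have e0 := hη0 (proj z) hzX (dproj z u) (dproj z v)
      have e1 := hη1 (proj z) hzX (dproj z (Ψ z u)) (dproj z (Ψ z v))
      rw [mfderivWithin_of_mem_nhds (Filter.mem_of_superset (hU.mem_nhds (hKU z hz)) hUX)] at e1
      have e2 := hΨ z hz u v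
      rw [ContinuousLinearMap.comp_apply, ContinuousLinearMap.comp_apply,
        liftForm_adjustedDeriv hU hιU _ (hK0 z hz) (hKU z hz) hj]
      refine (congrArg (· + _) e1.symm).trans (e2.trans ?_)
      exact congrArg (· + _) e0
    have h2 := h1 (Complex.I • u)
    rw [hu, liftForm_fubiniStudyChart_neg_right] at h2
    have h3 := liftForm_fubiniStudyChart_I_smul_pos (hK0 z hz) hu0
    have h4 : 0 ≤ liftForm fubiniStudyChart (liftMap ι j z)
        ((adjustedDeriv z (liftMap ι j z) (fderiv ℝ (liftMap ι j) z) ∘L Ψ z) u)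
        (Complex.I • (adjustedDeriv z (liftMap ι j z) (fderiv ℝ (liftMap ι j) z) ∘L Ψ z) u) := by
      generalize (adjustedDeriv z (liftMap ι j z) (fderiv ℝ (liftMap ι j) z) ∘L Ψ z) u = w
      by_cases hw : w = 0
      · subst hw
        rw [liftForm_apply, (dproj _).map_zero, fubiniStudyChart_zero_left, map_zero]
        simp
      · exact (liftForm_fubiniStudyChart_I_smul_pos (liftMap_ne_zero ι j z) hw).le
    linarith
  have hX' : ∀ j, ∀ z ∈ K, ι (proj z) ∈ affineOpen j → proj (liftMap ι j z) ∈ X' := by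
    intro j z hz hj
    rw [proj_liftMap hj]
    exact hmaps (hUX (hKU z hz))
  -- Changing the local lift multiplies numerator and denominator by the same `(n + 1) m`-th power,
  -- so the quotients for different `j` agree where both are defined.
  let F : Fin (n + 1) → (Fin (n + 1) → ℂ) → ℂ := fun j z => g (liftMap ι j z) / δ j z ^ m
  have hF : ∀ i j, ∀ z ∈ K, ι (proj z) ∈ affineOpen i → ι (proj z) ∈ affineOpen j →
      F j z = F i z := by
    intro i j z hz hi hj
    have ha : liftMap ι i z j ≠ 0 := affineSection_apply_ne_zero hi hj
    have hd : δ j z = (liftMap ι i z j)⁻¹ ^ (n + 1) * δ i z :=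
      complexDet_adjustedDeriv_change hU hιU (hK0 z hz) (hKU z hz) hi hj _
    have hG : liftMap ι j z = (liftMap ι i z j)⁻¹ • liftMap ι i z := affineSection_change hi hj
    simp only [F]
    rw [hd, mul_pow, ← pow_mul, hG,
      hgh _ (inv_ne_zero ha) _ (liftMap_ne_zero ι i z) (hX' i z hz hi)]
    exact mul_div_mul_left _ _ (pow_ne_zero _ (inv_ne_zero ha))
  refine ⟨fun z => F (chartIndex (ι (proj z))) z, ?_, ?_, ?_⟩
  · intro z hz
    set j := chartIndex (ι (proj z)) with hj_def
    have hj : ι (proj z) ∈ affineOpen j := mem_affineOpen_chartIndex _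
    have hev : (fun z => F (chartIndex (ι (proj z))) z) =ᶠ[𝓝[K] z] F j := by
      filter_upwards [self_mem_nhdsWithin, mem_nhdsWithin_of_mem_nhds
        (eventually_mem_affineOpen hU hιU (hK0 z hz) (hKU z hz) hj)] with y hy hy'
      exact hF _ _ y hy hy'.2.2 (mem_affineOpen_chartIndex _)
    refine ContinuousWithinAt.congr_of_eventuallyEq ?_ hev rfl
    refine ContinuousWithinAt.div ?_ (ContinuousWithinAt.pow ?_ m)
      (pow_ne_zero _ (hδ0 j z hz hj))
    · refine (hgc _ ⟨liftMap_ne_zero ι j z, hX' j z hz hj⟩).comp_of_preimage_mem_nhdsWithin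
        (contDiffAt_liftMap hU hιU (hK0 z hz) (hKU z hz) hj).continuousAt.continuousWithinAt ?_
      filter_upwards [self_mem_nhdsWithin, mem_nhdsWithin_of_mem_nhds
        (eventually_mem_affineOpen hU hιU (hK0 z hz) (hKU z hz) hj)] with y hy hy'
      exact ⟨liftMap_ne_zero ι j y, hX' j y hy hy'.2.2⟩
    · exact continuous_complexDet.continuousAt.comp_continuousWithinAt
        ((continuousAt_adjustedDeriv hU hιU (hK0 z hz) (hKU z hz) hj).continuousWithinAt.clm_comp
          (hΨc z hz))
  · intro z hz
    have hj := mem_affineOpen_chartIndex (ι (proj z))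
    exact div_ne_zero (hg0 _ (liftMap_ne_zero ι _ z) (hX' _ z hz hj))
      (pow_ne_zero _ (hδ0 _ z hz hj))
  · intro z hz c hc hcz
    have hj := mem_affineOpen_chartIndex (ι (proj z))
    simp only [proj_smul hc]
    generalize chartIndex (ι (proj z)) = j at hj
    simp only [F]
    -- The lift itself is scale invariant, so the homogeneity of the quotient comes entirely from
    -- `δ`: precomposition with multiplication by `c` multiplies the determinant by `c ^ (n + 1)`.
    have hd : δ j z = c ^ (n + 1) * δ j (c • z) := by
      refine complexDet_comp_smul c fun u => ?_
      let L : (Fin (n + 1) → ℂ) ≃L[ℝ] (Fin (n + 1) → ℂ) :=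
        (ContinuousLinearEquiv.smulLeft (Units.mk0 c hc))
      -- Multiplication by `c` preserves every lifted form, so the naturality of `Ψ` applies to it.
      have hL := hΨn z hz (c • z) hcz L (fun t ht u v =>
        liftForm_smul (fun p u v => η t p u v) (hK0 z hz) hc u v) u
      have hL' : Ψ (c • z) (c • u) = c • Ψ z u := hL
      rw [ContinuousLinearMap.comp_apply, ContinuousLinearMap.comp_apply, hL',
        liftMap_smul ι j z hc]
      exact (adjustedDeriv_smul_source hc _
        (fderiv_liftMap_smul hU hιU (hK0 z hz) (hKU z hz) hj hc) _).symm
    rw [hd, liftMap_smul ι j z hc, mul_pow, ← pow_mul, ← mul_div_assoc,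
      mul_div_mul_left _ _ (pow_ne_zero _ hc)]

end CP

/-! ### Homogeneous functions without zeros on the complement of a divisor -/

namespace GenericHypersurfaces

variable {n k : ℕ} {d : Fin k → ℕ}

theorem _root_.MvPolynomial.IsHomogeneous.eval_smul_eq {σ : Type*} [Fintype σ]
    {F : MvPolynomial σ ℂ} {e : ℕ} (hF : F.IsHomogeneous e) (c : ℂ) (z : σ → ℂ) :
    MvPolynomial.eval (c • z) F = c ^ e * MvPolynomial.eval z F := by
  rw [MvPolynomial.eval_eq', MvPolynomial.eval_eq', Finset.mul_sum]
  refine Finset.sum_congr rfl fun m hm => ?_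
  have hdeg : ∑ j, m j = e := by
    rw [← hF (MvPolynomial.mem_support_iff.1 hm), Finsupp.weight_apply,
      Finsupp.sum_fintype _ _ (by simp)]
    simp
  simp only [Pi.smul_apply, smul_eq_mul, mul_pow, Finset.prod_mul_distrib,
    Finset.prod_pow_eq_pow_sum, hdeg]
  ring

theorem sectionNorm_proj (D : GenericHypersurfaces n d) {z : Fin (n + 1) → ℂ} (hz : z ≠ 0) :
    D.sectionNorm (CP.proj z) =
      ‖∏ i, MvPolynomial.eval z (D.F i)‖ / ‖WithLp.toLp 2 z‖ ^ ∑ i, d i := by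
  rw [CP.proj_eq hz]
  rfl

theorem continuous_sectionNorm (D : GenericHypersurfaces n d) : Continuous D.sectionNorm := by
  have hq : Topology.IsQuotientMap
      (fun v : {v : Fin (n + 1) → ℂ // v ≠ 0} => Projectivization.mk' ℂ v) :=
    isQuotientMap_quotient_mk'
  rw [hq.continuous_iff]
  change Continuous fun z : {v : Fin (n + 1) → ℂ // v ≠ 0} =>
    ‖∏ i, MvPolynomial.eval z.1 (D.F i)‖ / ‖WithLp.toLp 2 z.1‖ ^ ∑ i, d i
  refine Continuous.div ?_ ?_ fun z => ?_
  · refine (continuous_finsetProd _ fun i _ => ?_).norm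
    exact (MvPolynomial.continuous_eval _).comp continuous_subtype_val
  · exact ((PiLp.continuous_toLp 2 _).comp continuous_subtype_val).norm.pow _
  · have : WithLp.toLp 2 z.1 ≠ 0 := by simpa using z.2
    positivity

theorem eval_ne_zero_of_mem_domain (D : GenericHypersurfaces n d) {ε : ℝ} (hε : 0 < ε)
    {z : Fin (n + 1) → ℂ} (hz : z ≠ 0) (h : CP.proj z ∈ D.domain ε) (i : Fin k) :
    MvPolynomial.eval z (D.F i) ≠ 0 := by
  intro h0
  have h1 : ε ≤ D.sectionNorm (CP.proj z) := h
  rw [D.sectionNorm_proj hz, Finset.prod_eq_zero (Finset.mem_univ i) h0, norm_zero, zero_div] at h1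
  linarith

/-- The line bundle `𝒪(N)` is trivial on the complement of the hypersurfaces if `gcd d ∣ N`. -/
theorem exists_homogeneous_on_domain (D : GenericHypersurfaces n d) {ε : ℝ} (hε : 0 < ε) {N : ℕ}
    (hN : Finset.univ.gcd d ∣ N) :
    ∃ g : (Fin (n + 1) → ℂ) → ℂ, ContinuousOn g {z | z ≠ 0 ∧ CP.proj z ∈ D.domain ε} ∧
      (∀ z ≠ 0, CP.proj z ∈ D.domain ε → g z ≠ 0) ∧
      ∀ c : ℂ, c ≠ 0 → ∀ z ≠ 0, CP.proj z ∈ D.domain ε → g (c • z) = c ^ N * g z := by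
  -- Bézout coefficients of either sign are allowed as exponents, since the `F i` do not vanish on
  -- the domain.
  obtain ⟨a, ha⟩ : ∃ a : Fin k → ℤ, ∑ i, a i * (d i : ℤ) = N := by
    obtain ⟨b, hb⟩ := Finset.gcd_eq_sum_mul Finset.univ fun i => (d i : ℤ)
    have h1 : (Finset.univ.gcd fun i => (d i : ℤ)) ∣ (N : ℤ) := by
      have h2 : (Finset.univ.gcd fun i => (d i : ℤ)).natAbs ∣ Finset.univ.gcd d :=
        Finset.dvd_gcd fun i hi => Int.natAbs_dvd_natAbs.2
          (Finset.gcd_dvd (f := fun i => (d i : ℤ)) hi)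
      exact Int.natAbs_dvd.1 (Int.natCast_dvd_natCast.2 (h2.trans hN))
    obtain ⟨c, hc⟩ := h1
    refine ⟨fun i => c * b i, ?_⟩
    rw [hc, hb, Finset.sum_mul]
    exact Finset.sum_congr rfl fun i _ => by ring
  have h0 := fun z hz h i => D.eval_ne_zero_of_mem_domain (z := z) hε hz h i
  refine ⟨fun z => ∏ i, MvPolynomial.eval z (D.F i) ^ a i, ?_, ?_, ?_⟩
  · refine continuousOn_finsetProd _ fun i _ => ContinuousOn.zpow₀ ?_ _ fun z hz =>
      Or.inl (h0 z hz.1 hz.2 i)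
    exact (MvPolynomial.continuous_eval _).continuousOn
  · exact fun z hz h => Finset.prod_ne_zero_iff.2 fun i _ => zpow_ne_zero _ (h0 z hz h i)
  · intro c hc z _ _
    simp only [(D.isHomogeneous _).eval_smul_eq, mul_zpow, Finset.prod_mul_distrib]
    congr 1
    have hsum : ∀ (s : Finset (Fin k)) (b : Fin k → ℤ), c ^ ∑ i ∈ s, b i = ∏ i ∈ s, c ^ b i := by
      intro s b
      induction s using Finset.cons_induction with
      | empty => simp
      | cons i s hi ih => rw [Finset.sum_cons, Finset.prod_cons, zpow_add₀ hc, ih]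
    rw [← zpow_natCast, ← ha, hsum]
    exact Finset.prod_congr rfl fun i _ => by rw [← zpow_natCast, ← zpow_mul, mul_comm]

end GenericHypersurfaces

/-! ### Winding numbers of continuous functions -/

section Winding

open Complex Metric

/-- The exponential is a covering of `ℂ ∖ {0}`, so maps from simply connected, locally path
connected spaces lift through it. -/
theorem exists_log_lift {X : Type*} [TopologicalSpace X] [SimplyConnectedSpace X]
    [LocallyPathConnectedSpace X] {f : X → ℂ} (hf : Continuous f) (h0 : ∀ x, f x ≠ 0) :
    ∃ l : X → ℂ, Continuous l ∧ ∀ x, exp (l x) = f x := by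
  obtain ⟨x₀⟩ : Nonempty X := inferInstance
  obtain ⟨l, ⟨-, hl⟩, -⟩ := isCoveringMapOn_exp.existsUnique_continuousMap_lifts
    ⟨f, hf⟩ (exp_log (h0 x₀)) (fun x => h0 x)
  exact ⟨l, l.continuous, fun x => congrFun hl x⟩

/-- A continuous function with values in `2πi ℤ` on a connected space is constant. -/
theorem exists_int_of_exp_eq_one {X : Type*} [TopologicalSpace X] [PreconnectedSpace X]
    [Nonempty X] {g : X → ℂ} (hg : Continuous g) (h : ∀ x, exp (g x) = 1) :
    ∃ w : ℤ, ∀ x, g x = w * (2 * Real.pi * I) := by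
  have h1 : ∀ x, ∃ w : ℤ, g x = w * (2 * Real.pi * I) := fun x => exp_eq_one_iff.1 (h x)
  choose w hw using h1
  have hre : ∀ x, ((w x : ℝ)) = (g x).im / (2 * Real.pi) := by
    intro x
    rw [hw x]
    have : ((w x : ℂ) * (2 * Real.pi * I)).im = w x * (2 * Real.pi) := by
      have : ((w x : ℂ) * (2 * Real.pi * I)) = ((w x * (2 * Real.pi) : ℝ) : ℂ) * I := by
        push_cast; ring
      rw [this, im_ofReal_mul, I_im, mul_one]
    rw [this]
    field_simp
  have hc : Continuous w := by
    rw [Int.isClosedEmbedding_coe_real.isEmbedding.continuous_iff]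
    have : (Int.cast ∘ w : X → ℝ) = fun x => (g x).im / (2 * Real.pi) := funext hre
    rw [this]
    exact (continuous_im.comp hg).div_const _
  obtain ⟨x₀⟩ := ‹Nonempty X›
  refine ⟨w x₀, fun x => ?_⟩
  rw [hw x, isPreconnected_univ.constant hc.continuousOn (Set.mem_univ x) (Set.mem_univ x₀)]

/-- The winding number around a circle exists and is locally constant in families. -/
theorem exists_winding {δ : ℝ} (hδ : 0 < δ) {F : ℝ → ℂ → ℂ}
    (hF : ContinuousOn (fun q : ℝ × ℂ => F q.1 q.2) (Set.Icc 0 1 ×ˢ sphere 0 δ))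
    (h0 : ∀ s ∈ Set.Icc (0 : ℝ) 1, ∀ t ∈ sphere (0 : ℂ) δ, F s t ≠ 0) :
    ∃ w : ℤ, ∀ s ∈ Set.Icc (0 : ℝ) 1, ∃ h : ℂ → ℂ, ContinuousOn h (sphere 0 δ) ∧
      ∀ t ∈ sphere (0 : ℂ) δ, F s t = exp (h t) * t ^ w := by
  -- Clamping `s` to `[0, 1]` and unrolling the circle gives a function on the simply connected
  -- plane.
  let p : ℝ × ℝ → ℝ × ℂ := fun q => (Set.projIcc 0 1 zero_le_one q.1, δ * exp (q.2 * I))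
  have hp : Continuous p := by
    refine Continuous.prodMk ?_ (by fun_prop)
    exact continuous_subtype_val.comp (continuous_projIcc.comp continuous_fst)
  have hmem : ∀ q, p q ∈ Set.Icc (0 : ℝ) 1 ×ˢ sphere (0 : ℂ) δ := by
    intro q
    refine ⟨Subtype.coe_prop _, ?_⟩
    simp [p, norm_exp_ofReal_mul_I, abs_of_pos hδ]
  obtain ⟨l, hl, hl'⟩ := exists_log_lift (X := ℝ × ℝ) (hF.comp_continuous hp hmem)
    fun q => h0 _ (hmem q).1 _ (hmem q).2
  have hper : ∀ q : ℝ × ℝ, p (q.1, q.2 + 2 * Real.pi) = p q := by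
    intro q
    simp only [p, Prod.mk.injEq, true_and]
    congr 1
    push_cast
    rw [add_mul, exp_add, exp_two_pi_mul_I, mul_one]
  -- The increment of the logarithm over one period is `2πi` times an integer that is constant on
  -- the whole plane, hence independent of `s`.
  obtain ⟨w, hw⟩ := exists_int_of_exp_eq_one
    (g := fun q : ℝ × ℝ => l (q.1, q.2 + 2 * Real.pi) - l q) (by fun_prop) (by
      intro q
      rw [exp_sub, hl', hl', Function.comp_apply, Function.comp_apply, hper]
      exact div_self (h0 _ (hmem q).1 _ (hmem q).2))
  refine ⟨w, fun s hs => ?_⟩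
  -- `H` is a logarithm of `F s t * t ^ (-w)`; it is `2π`-periodic and therefore descends to the
  -- circle.
  let H : ℝ → ℂ := fun θ => l (s, θ) - w * (θ * I) - w * Real.log δ
  have hH : Continuous H := by fun_prop
  have hHper : ∀ (j : ℤ) θ, H (θ + j * (2 * Real.pi)) = H θ := by
    have h1 : Function.Periodic H (2 * Real.pi) := by
      intro θ
      have := hw (s, θ)
      simp only [H]
      push_cast
      linear_combination this
    intro j θ
    exact (h1.int_mul j) θ
  have hHval : ∀ θ : ℝ, F s (δ * exp (θ * I)) = exp (H θ) * (δ * exp (θ * I)) ^ w := by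
    intro θ
    have h1 : p (s, θ) = (s, δ * exp (θ * I)) := by
      simp [p, Set.projIcc_of_mem _ hs]
    have h2 := hl' (s, θ)
    rw [Function.comp_apply, h1] at h2
    change exp (l (s, θ)) = F s (δ * exp (θ * I)) at h2
    rw [← h2]
    have h3 : (δ : ℂ) * exp (θ * I) = exp (Real.log δ + θ * I) := by
      rw [exp_add, ← ofReal_exp, Real.exp_log hδ]
    rw [h3, ← exp_int_mul, ← exp_add]
    congr 1
    simp only [H]
    ring
  have hsph : ∀ t ∈ sphere (0 : ℂ) δ, ∀ a : ℂ, a ≠ 0 → ‖a‖ = δ →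
      t = δ * exp ((arg (t / a) + arg a : ℝ) * I) := by
    intro t ht a ha hna
    have hnt : ‖t‖ = δ := by simpa using ht
    have h1 := norm_mul_exp_arg_mul_I (t / a)
    have h2 := norm_mul_exp_arg_mul_I a
    rw [norm_div, hnt, hna, div_self hδ.ne', ofReal_one, one_mul] at h1
    rw [hna] at h2
    push_cast
    rw [add_mul, exp_add, h1, mul_left_comm, h2]
    field_simp
  refine ⟨fun t => H (arg t), ?_, ?_⟩
  · intro a ha
    have hna : ‖a‖ = δ := by simpa using ha
    have ha0 : a ≠ 0 := by rintro rfl; simp at hna; exact hδ.ne hna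
    -- `arg` may jump at `a`, whereas `arg (t / a) + arg a` is continuous there and differs from
    -- `arg t` by a multiple of `2π`, which `H` does not see.
    have hc : ContinuousAt (fun t => H (arg (t / a) + arg a)) a := by
      refine hH.continuousAt.comp (f := fun t : ℂ => arg (t / a) + arg a)
        (ContinuousAt.add ?_ continuousAt_const)
      refine ContinuousAt.comp (g := arg) (f := fun t : ℂ => t / a) (continuousAt_arg ?_)
        (continuousAt_id.div_const a)
      simp [div_self ha0]
    refine hc.continuousWithinAt.congr (fun t ht => ?_) ?_
    · have h1 := hsph t ht a ha0 hna
      have h2 : t = δ * exp (arg t * I) := by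
        have := norm_mul_exp_arg_mul_I t
        rwa [show ‖t‖ = δ by simpa using ht, eq_comm] at this
      have h3 : exp ((arg (t / a) + arg a : ℝ) * I) = exp (arg t * I) :=
        mul_left_cancel₀ (ofReal_ne_zero.2 hδ.ne') (h1.symm.trans h2)
      obtain ⟨j, hj⟩ := exp_eq_exp_iff_exists_int.1 h3
      have h4 : arg (t / a) + arg a = arg t + j * (2 * Real.pi) := by
        have : (((arg (t / a) + arg a : ℝ)) : ℂ) = ((arg t + j * (2 * Real.pi) : ℝ) : ℂ) := by
          refine mul_right_cancel₀ I_ne_zero ?_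
          rw [hj]; push_cast; ring
        exact_mod_cast this
      rw [h4, hHper]
    · simp [div_self ha0]
  · intro t ht
    have h2 : t = δ * exp (arg t * I) := by
      have := norm_mul_exp_arg_mul_I t
      rwa [show ‖t‖ = δ by simpa using ht, eq_comm] at this
    have := hHval (arg t)
    rwa [← h2] at this

/-- A nonvanishing function on a closed disc has a continuous logarithm. -/
theorem exists_log_closedBall {R : ℝ} (hR : 0 < R) {f : ℂ → ℂ}
    (hf : ContinuousOn f (closedBall 0 R)) (h0 : ∀ t ∈ closedBall (0 : ℂ) R, f t ≠ 0) :
    ∃ l : ℂ → ℂ, ContinuousOn l (closedBall 0 R) ∧ ∀ t ∈ closedBall (0 : ℂ) R, exp (l t) = f t := by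
  -- The radial retraction of the plane onto the disc.
  let ρ : ℂ → ℂ := fun t => ((R / max R ‖t‖ : ℝ) : ℂ) * t
  have hmax : ∀ t : ℂ, 0 < max R ‖t‖ := fun t => lt_max_of_lt_left hR
  have hρ : Continuous ρ := by
    refine Continuous.mul (continuous_ofReal.comp ?_) continuous_id
    exact continuous_const.div (by fun_prop) fun t => (hmax t).ne'
  have hmem : ∀ t, ρ t ∈ closedBall (0 : ℂ) R := by
    intro t
    rw [mem_closedBall_zero_iff, norm_mul, norm_real, Real.norm_of_nonneg (by positivity),
      div_mul_eq_mul_div, div_le_iff₀ (hmax t)]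
    exact mul_le_mul_of_nonneg_left (le_max_right _ _) hR.le
  have hid : ∀ t ∈ closedBall (0 : ℂ) R, ρ t = t := by
    intro t ht
    rw [mem_closedBall_zero_iff] at ht
    have hR' : (R : ℂ) ≠ 0 := ofReal_ne_zero.2 hR.ne'
    simp [ρ, max_eq_left ht, hR']
  obtain ⟨l, hl, hl'⟩ := exists_log_lift (X := ℂ) (hf.comp_continuous hρ hmem)
    fun t => h0 _ (hmem t)
  refine ⟨l, hl.continuousOn, fun t ht => ?_⟩
  rw [hl' t, Function.comp_apply, hid t ht]

/-- Powers with nonzero exponent have no continuous logarithm on a circle. -/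
theorem eq_zero_of_zpow_eq_exp {R : ℝ} (hR : 0 < R) {w : ℤ} {h : ℂ → ℂ}
    (hc : ContinuousOn h (sphere 0 R)) (hw : ∀ t ∈ sphere (0 : ℂ) R, t ^ w = exp (h t)) : w = 0 := by
  have hmem : ∀ θ : ℝ, (R : ℂ) * exp (θ * I) ∈ sphere (0 : ℂ) R := by
    intro θ
    simp [norm_exp_ofReal_mul_I, abs_of_pos hR]
  have hcc : Continuous fun θ : ℝ => h (R * exp (θ * I)) :=
    hc.comp_continuous (by fun_prop) hmem
  -- Both `h` and `w (log R + iθ)` are logarithms of `t ^ w`, so their difference is constant.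
  -- Comparing `θ = 0` with `θ = 2π` gives `2πi w = 0`.
  obtain ⟨j, hj⟩ := exists_int_of_exp_eq_one
    (g := fun θ : ℝ => h (R * exp (θ * I)) - w * (Real.log R + θ * I)) (hcc.sub (by fun_prop)) (by
      intro θ
      have h3 : (R : ℂ) * exp (θ * I) = exp (Real.log R + θ * I) := by
        rw [exp_add, ← ofReal_exp, Real.exp_log hR]
      rw [exp_sub, ← hw _ (hmem θ), h3, ← exp_int_mul]
      exact div_self (exp_ne_zero _))
  have e1 := hj 0
  have e2 := hj (2 * Real.pi)
  have e3 : exp (((2 * Real.pi : ℝ) : ℂ) * I) = exp (((0 : ℝ) : ℂ) * I) := by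
    push_cast
    rw [exp_two_pi_mul_I, zero_mul, exp_zero]
  rw [e3] at e2
  have e4 : (w : ℂ) * (2 * Real.pi * I) = 0 := by
    push_cast at e1 e2
    linear_combination e1 - e2
  have : (w : ℂ) = 0 := (mul_eq_zero.1 e4).resolve_right two_pi_I_ne_zero
  exact_mod_cast this

/-- Extend a nonvanishing function over a disc when it has a logarithm on the boundary. -/
theorem exists_fill_disc {A : Set ℂ} (hA : IsClosed A) {r : ℂ} {δ : ℝ}
    (hball : ∀ t ∈ A, δ ≤ dist t r) {f : ℂ → ℂ} (hf : ContinuousOn f A) (h0 : ∀ t ∈ A, f t ≠ 0)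
    {h : ℂ → ℂ} (hc : ContinuousOn h (sphere r δ)) (hexp : ∀ t ∈ sphere r δ, f t = exp (h t)) :
    ∃ g : ℂ → ℂ, ContinuousOn g (A ∪ closedBall r δ) ∧ (∀ t ∈ A ∪ closedBall r δ, g t ≠ 0) ∧
      ∀ t, δ ≤ dist t r → g t = f t := by
  -- By Tietze the boundary logarithm extends to the plane; its exponential fills the disc.
  obtain ⟨K, hK⟩ := ContinuousMap.exists_restrict_eq (isClosed_sphere (x := r) (ε := δ))
    (Y := ℂ) ⟨_, continuousOn_iff_continuous_domRestrict.1 hc⟩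
  have hK' : ∀ t ∈ sphere r δ, K t = h t := fun t ht => DFunLike.congr_fun hK ⟨t, ht⟩
  classical
  let g : ℂ → ℂ := fun t => if dist t r < δ then exp (K t) else f t
  have hgout : ∀ t, δ ≤ dist t r → g t = f t := fun t ht => if_neg (not_lt.2 ht)
  have hgin : ∀ t ∈ closedBall r δ, g t = exp (K t) := by
    intro t ht
    by_cases h1 : dist t r < δ
    · exact if_pos h1
    · have h2 : t ∈ sphere r δ := le_antisymm ht (not_lt.1 h1)
      rw [hgout t (not_lt.1 h1), hexp t h2, hK' t h2]
  refine ⟨g, ContinuousOn.union_of_isClosed ?_ ?_ hA isClosed_closedBall, ?_, hgout⟩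
  · exact hf.congr fun t ht => hgout t (hball t ht)
  · exact (continuous_exp.comp K.continuous).continuousOn.congr hgin
  · rintro t (ht | ht)
    · rw [hgout t (hball t ht)]
      exact h0 t ht
    · rw [hgin t ht]
      exact exp_ne_zero _

/-- The holes are filled one at a time. Since the centres are at least `2δ` apart, filling one disc
does not alter the function on the boundary circles of the others. -/
theorem exists_fill_discs {R δ : ℝ} {S : Finset ℂ}
    (hdisj : ∀ r ∈ S, ∀ r' ∈ S, r ≠ r' → 2 * δ ≤ dist r r') {f : ℂ → ℂ}
    (hf : ContinuousOn f {t | ‖t‖ ≤ R ∧ ∀ r ∈ S, δ ≤ dist t r})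
    (h0 : ∀ t, ‖t‖ ≤ R → (∀ r ∈ S, δ ≤ dist t r) → f t ≠ 0)
    (h : ∀ r ∈ S, ∃ h : ℂ → ℂ, ContinuousOn h (sphere r δ) ∧ ∀ t ∈ sphere r δ, f t = exp (h t)) :
    ∃ g : ℂ → ℂ, ContinuousOn g (closedBall 0 R) ∧ (∀ t ∈ closedBall (0 : ℂ) R, g t ≠ 0) ∧
      ∀ t, (∀ r ∈ S, δ ≤ dist t r) → g t = f t := by
  classical
  have key : ∀ T ⊆ S, ∃ g : ℂ → ℂ,
      ContinuousOn g {t | ‖t‖ ≤ R ∧ ∀ r ∈ S \ T, δ ≤ dist t r} ∧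
      (∀ t, ‖t‖ ≤ R → (∀ r ∈ S \ T, δ ≤ dist t r) → g t ≠ 0) ∧
      ∀ t, (∀ r ∈ T, δ ≤ dist t r) → g t = f t := by
    intro T
    induction T using Finset.induction_on with
    | empty =>
      intro _
      exact ⟨f, by simpa using hf, by simpa using h0, fun _ _ => rfl⟩
    | insert a T ha ih =>
      intro hT
      obtain ⟨g, hg, hg0, hgf⟩ := ih ((Finset.subset_insert a T).trans hT)
      have haS : a ∈ S := hT (Finset.mem_insert_self a T)
      obtain ⟨k, hk, hk'⟩ := h a haS
      have hcl : IsClosed {t : ℂ | ‖t‖ ≤ R ∧ ∀ r ∈ S \ T, δ ≤ dist t r} := by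
        have : {t : ℂ | ‖t‖ ≤ R ∧ ∀ r ∈ S \ T, δ ≤ dist t r} =
            {t : ℂ | ‖t‖ ≤ R} ∩ ⋂ r ∈ S \ T, {t | δ ≤ dist t r} := by
          ext t; simp
        rw [this]
        exact (isClosed_le continuous_norm continuous_const).inter
          (isClosed_biInter fun r _ => isClosed_le continuous_const (by fun_prop))
      have haT : a ∈ S \ T := Finset.mem_sdiff.2 ⟨haS, ha⟩
      have hsph : ∀ t ∈ sphere a δ, g t = exp (k t) := by
        intro t ht
        rw [← hk' t ht]
        refine hgf t fun r hr => ?_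
        have hra : a ≠ r := by rintro rfl; exact ha hr
        have h1 := hdisj a haS r (hT (Finset.mem_insert_of_mem hr)) hra
        have h2 := dist_triangle_left a r t
        rw [mem_sphere] at ht
        linarith
      obtain ⟨g', hg', hg'0, hg'f⟩ := exists_fill_disc hcl (r := a) (δ := δ)
        (fun t ht => ht.2 a haT) hg (fun t ht => hg0 t ht.1 ht.2) hk hsph
      have hsub : ∀ t : ℂ, ‖t‖ ≤ R → (∀ r ∈ S \ insert a T, δ ≤ dist t r) →
          t ∈ {t : ℂ | ‖t‖ ≤ R ∧ ∀ r ∈ S \ T, δ ≤ dist t r} ∪ closedBall a δ := by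
        intro t ht h1
        by_cases h2 : dist t a ≤ δ
        · exact Or.inr h2
        · refine Or.inl ⟨ht, fun r hr => ?_⟩
          by_cases hra : r = a
          · subst hra; exact (not_le.1 h2).le
          · exact h1 r (by simp_all)
      refine ⟨g', hg'.mono fun t ht => hsub t ht.1 ht.2, fun t ht h1 => hg'0 t (hsub t ht h1), ?_⟩
      intro t ht
      rw [hg'f t (ht a (Finset.mem_insert_self _ _)),
        hgf t fun r hr => ht r (Finset.mem_insert_of_mem hr)]
  obtain ⟨g, h1, h2, h3⟩ := key S subset_rfl
  refine ⟨g, h1.mono fun t ht => ⟨by simpa using ht, by simp⟩, fun t ht => h2 t (by simpa using ht)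
    (by simp), h3⟩

/-- The argument principle for continuous functions on a disc with holes. -/
theorem winding_eq_sum {R δ : ℝ} (hδ : 0 < δ) {S : Finset ℂ} (hS : ∀ r ∈ S, ‖r‖ + δ ≤ R)
    (hdisj : ∀ r ∈ S, ∀ r' ∈ S, r ≠ r' → 2 * δ ≤ dist r r') {f : ℂ → ℂ}
    (hf : ContinuousOn f {t | ‖t‖ ≤ R ∧ ∀ r ∈ S, δ ≤ dist t r})
    (h0 : ∀ t, ‖t‖ ≤ R → (∀ r ∈ S, δ ≤ dist t r) → f t ≠ 0) {w : ℂ → ℤ}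
    (h : ∀ r ∈ S, ∃ h : ℂ → ℂ, ContinuousOn h (sphere r δ) ∧
      ∀ t ∈ sphere r δ, f t = exp (h t) * (t - r) ^ w r) (hR : 0 < R) {N : ℤ} {u : ℂ → ℂ}
    (hu : ContinuousOn u (sphere 0 R)) (hN : ∀ t ∈ sphere (0 : ℂ) R, f t = exp (u t) * t ^ N) :
    N = ∑ r ∈ S, w r := by
  classical
  -- Dividing by `(t - r) ^ w r` removes the winding around every hole, so `g` extends without zeros
  -- over the full disc and has a logarithm there.
  let g : ℂ → ℂ := fun t => f t * ∏ r ∈ S, (t - r) ^ (-w r)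
  have hne : ∀ t, (∀ r ∈ S, δ ≤ dist t r) → ∀ r ∈ S, t - r ≠ 0 := by
    intro t ht r hr h1
    have := ht r hr
    rw [sub_eq_zero.1 h1, dist_self] at this
    linarith
  have hg : ContinuousOn g {t | ‖t‖ ≤ R ∧ ∀ r ∈ S, δ ≤ dist t r} := by
    refine hf.mul (continuousOn_finsetProd _ fun r hr => ?_)
    exact ContinuousOn.zpow₀ (by fun_prop) _ fun t ht => Or.inl (hne t ht.2 r hr)
  have hg0 : ∀ t, ‖t‖ ≤ R → (∀ r ∈ S, δ ≤ dist t r) → g t ≠ 0 := fun t ht h1 =>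
    mul_ne_zero (h0 t ht h1) (Finset.prod_ne_zero_iff.2 fun r hr => zpow_ne_zero _ (hne t h1 r hr))
  have hgs : ∀ r ∈ S, ∃ h : ℂ → ℂ, ContinuousOn h (sphere r δ) ∧
      ∀ t ∈ sphere r δ, g t = exp (h t) := by
    intro r hr
    obtain ⟨k, hk, hk'⟩ := h r hr
    -- On the circle around `r`, the factor `t - r' = (r - r') (1 + (t - r) / (r - r'))` has a
    -- logarithm because the last quotient has norm less than `1`.
    have hslit : ∀ r' ∈ S.erase r, ∀ t ∈ sphere r δ, 1 + (t - r) / (r - r') ∈ slitPlane := by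
      intro r' hr' t ht
      refine mem_slitPlane_of_norm_lt_one ?_
      have h1 := hdisj r hr r' (Finset.mem_of_mem_erase hr') (Finset.ne_of_mem_erase hr').symm
      rw [mem_sphere, dist_eq_norm] at ht
      rw [dist_eq_norm] at h1
      rw [norm_div, ht, div_lt_one (by linarith)]
      linarith
    refine ⟨fun t => k t + ∑ r' ∈ S.erase r,
      ((-w r' : ℤ) : ℂ) * (log (1 + (t - r) / (r - r')) + log (r - r')), ?_, ?_⟩
    · refine hk.add (continuousOn_finsetSum _ fun r' hr' => continuousOn_const.mul ?_)
      refine ContinuousOn.add (ContinuousOn.clog (by fun_prop) (hslit r' hr')) continuousOn_const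
    · intro t ht
      have htr : t - r ≠ 0 := by
        rw [mem_sphere, dist_eq_norm] at ht
        rw [← norm_ne_zero_iff, ht]
        exact hδ.ne'
      simp only [g]
      rw [hk' t ht, exp_add, exp_sum, ← Finset.mul_prod_erase S _ hr]
      have : ∀ r' ∈ S.erase r, exp (((-w r' : ℤ) : ℂ) * (log (1 + (t - r) / (r - r')) +
          log (r - r'))) = (t - r') ^ (-w r') := by
        intro r' hr'
        have hrr : r - r' ≠ 0 := sub_ne_zero.2 (Finset.ne_of_mem_erase hr').symm
        rw [exp_int_mul, exp_add, exp_log (slitPlane_ne_zero (hslit r' hr' t ht)), exp_log hrr]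
        congr 1
        field_simp
        ring
      rw [Finset.prod_congr rfl this]
      have h2 : (t - r) ^ w r * (t - r) ^ (-w r) = 1 := by
        rw [zpow_neg, mul_inv_cancel₀ (zpow_ne_zero _ htr)]
      linear_combination (exp (k t) * ∏ x ∈ S.erase r, (t - x) ^ (-w x)) * h2
  obtain ⟨G, hG, hG0, hGg⟩ := exists_fill_discs hdisj hg hg0 hgs
  obtain ⟨l, hl, hl'⟩ := exists_log_closedBall hR hG hG0
  have hout : ∀ t ∈ sphere (0 : ℂ) R, ∀ r ∈ S, δ ≤ dist t r := by
    intro t ht r hr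
    rw [mem_sphere_zero_iff_norm] at ht
    have h1 := hS r hr
    have h2 := norm_sub_norm_le t r
    rw [dist_eq_norm]
    linarith
  -- On the outer circle `t - r = t (1 - r / t)`, and the second factor has a logarithm; each factor
  -- `t - r` thus contributes one turn.
  have hslit : ∀ r ∈ S, ∀ t ∈ sphere (0 : ℂ) R, 1 - r / t ∈ slitPlane := by
    intro r hr t ht
    rw [sub_eq_add_neg]
    refine mem_slitPlane_of_norm_lt_one ?_
    rw [mem_sphere_zero_iff_norm] at ht
    rw [norm_neg, norm_div, ht, div_lt_one hR]
    linarith [hS r hr]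
  have ht0 : ∀ t ∈ sphere (0 : ℂ) R, t ≠ 0 := by
    rintro t ht rfl
    simp at ht
    exact hR.ne ht
  suffices N - ∑ r ∈ S, w r = 0 by linarith
  refine eq_zero_of_zpow_eq_exp hR
    (h := fun t => l t - u t + ∑ r ∈ S, ((w r : ℤ) : ℂ) * log (1 - r / t)) ?_ ?_
  · refine ((hl.mono sphere_subset_closedBall).sub hu).add
      (continuousOn_finsetSum _ fun r hr => continuousOn_const.mul ?_)
    refine ContinuousOn.clog (continuousOn_const.sub ?_) (hslit r hr)
    exact continuousOn_const.div continuousOn_id ht0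
  · intro t ht
    have h1 : ∀ r ∈ S, exp (((w r : ℤ) : ℂ) * log (1 - r / t)) = (t - r) ^ w r * t ^ (-w r) := by
      intro r hr
      rw [exp_int_mul, exp_log (slitPlane_ne_zero (hslit r hr t ht)), zpow_neg, ← inv_zpow,
        ← mul_zpow]
      congr 1
      have := ht0 t ht
      field_simp
    have hprod : ∏ r ∈ S, t ^ (-w r) = t ^ (-∑ r ∈ S, w r) := by
      have ht' := ht0 t ht
      clear h1 hGg hG hG0 hslit hout hgs hg hg0 hne h h0 hf hdisj hS
      induction S using Finset.induction_on with
      | empty => simp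
      | insert a S ha ih => rw [Finset.prod_insert ha, Finset.sum_insert ha, ih, neg_add,
          zpow_add₀ ht']
    have hcancel : (∏ r ∈ S, (t - r) ^ (-w r)) * ∏ r ∈ S, (t - r) ^ w r = 1 := by
      rw [← Finset.prod_mul_distrib]
      refine Finset.prod_eq_one fun r hr => ?_
      rw [zpow_neg, inv_mul_cancel₀ (zpow_ne_zero _ (hne t (hout t ht) r hr))]
    rw [exp_add, exp_sub, exp_sum, Finset.prod_congr rfl h1, Finset.prod_mul_distrib, hprod,
      hl' t (sphere_subset_closedBall ht), hGg t (hout t ht), sub_eq_add_neg,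
      zpow_add₀ (ht0 t ht)]
    simp only [g]
    rw [hN t ht]
    have := exp_ne_zero (u t)
    field_simp
    linear_combination (-1 : ℂ) * (t ^ N * t ^ (-∑ r ∈ S, w r)) * hcancel

end Winding

/-! ### Functions that are polynomial along lines -/

section PolynomialGrowth

open Filter

/-- Removable singularities at finitely many points. -/
theorem exists_entire_extension (Z : Finset ℂ) {g : ℂ → ℂ} (hg : ∀ s ∉ Z, DifferentiableAt ℂ g s)
    (hb : ∀ c, ∃ M : ℝ, ∀ᶠ s in 𝓝 c, s ∉ Z → ‖g s‖ ≤ M) :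
    ∃ G : ℂ → ℂ, Differentiable ℂ G ∧ ∀ s ∉ Z, G s = g s := by
  classical
  induction Z using Finset.induction_on generalizing g with
  | empty => exact ⟨g, fun s => hg s (by simp), fun s _ => rfl⟩
  | insert a Z ha ih =>
    let g' := Function.update g a (limUnder (𝓝[≠] a) g)
    have hne : ∀ s, s ≠ a → g' =ᶠ[𝓝 s] g := fun s hs => by
      filter_upwards [isOpen_ne.mem_nhds hs] with t ht
      exact Function.update_of_ne ht _ _
    have hda : DifferentiableAt ℂ g' a := by
      obtain ⟨M, hM⟩ := hb a
      let s : Set ℂ := {t | (t ∉ insert a Z → ‖g t‖ ≤ M) ∧ t ∉ Z}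
      have hs : s ∈ 𝓝 a := by
        filter_upwards [hM, Z.finite_toSet.isClosed.isOpen_compl.mem_nhds (x := a) (by simpa using ha)]
          with t h1 h2 using ⟨h1, h2⟩
      refine (Complex.differentiableOn_update_limUnder_of_bddAbove hs ?_ ?_).differentiableAt hs
      · intro t ht
        refine (hg t ?_).differentiableWithinAt
        have h1 : t ≠ a := ht.2
        simp [h1, ht.1.2]
      · refine ⟨M, ?_⟩
        rintro _ ⟨t, ht, rfl⟩
        have h1 : t ≠ a := ht.2
        exact ht.1.1 (by simp [h1, ht.1.2])
    obtain ⟨G, hG, hGg⟩ := ih (g := g') (fun s hs => by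
      by_cases hsa : s = a
      · rw [hsa]; exact hda
      · exact ((hne s hsa).differentiableAt_iff).2 (hg s (by simp [hsa, hs]))) (fun c => by
      by_cases hca : c = a
      · subst hca
        refine ⟨‖g' c‖ + 1, ?_⟩
        filter_upwards [hda.continuousAt.norm.eventually_lt
          (continuousAt_const (y := ‖g' c‖ + 1)) (by linarith)] with t ht _ using ht.le
      · obtain ⟨M, hM⟩ := hb c
        refine ⟨M, ?_⟩
        filter_upwards [hM, hne c hca, isOpen_ne.mem_nhds hca] with t h1 h2 h3 h4
        rw [h2]
        exact h1 (by simp only [Finset.mem_insert, not_or]; exact ⟨h3, h4⟩))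
    refine ⟨G, hG, fun s hs => ?_⟩
    simp only [Finset.mem_insert, not_or] at hs
    rw [hGg s hs.2]
    exact Function.update_of_ne hs.1 _ _

/-- An entire function of polynomial growth is a polynomial. -/
theorem exists_polynomial_of_entire {G : ℂ → ℂ} (hG : Differentiable ℂ G) {C : ℝ} {k : ℕ}
    (hC : ∀ s, ‖G s‖ ≤ C * (1 + ‖s‖) ^ k) :
    ∃ p : Polynomial ℂ, p.natDegree ≤ k ∧ ∀ s, G s = p.eval s := by
  have hC0 : 0 ≤ C := by
    have := (norm_nonneg _).trans (hC 0)
    simpa using this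
  have hz : ∀ m, k < m → iteratedDeriv m G 0 = 0 := by
    intro m hm
    rw [← norm_le_zero_iff]
    -- Cauchy's estimate on the circle of radius `R ≥ 1` bounds a derivative of order `m > k` by a
    -- constant times `R⁻¹`.
    refine ge_of_tendsto (x := (atTop : Filter ℝ))
      (f := fun R : ℝ => m.factorial * (C * 2 ^ k) * R⁻¹) ?_ ?_
    · simpa using tendsto_inv_atTop_zero.const_mul (m.factorial * (C * 2 ^ k) : ℝ)
    · filter_upwards [eventually_ge_atTop (1 : ℝ)] with R hR
      have hR0 : 0 < R := by linarith
      have h1 := Complex.norm_iteratedDeriv_le_of_forall_mem_sphere_norm_le (c := 0) m hR0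
        hG.diffContOnCl (C := C * (2 * R) ^ k) (fun z hz => by
          refine (hC z).trans (mul_le_mul_of_nonneg_left (pow_le_pow_left₀ (by positivity) ?_ k) hC0)
          rw [mem_sphere_zero_iff_norm] at hz
          rw [hz]; linarith)
      refine h1.trans ?_
      have h2 : R ^ (k + 1) ≤ R ^ m := pow_le_pow_right₀ hR hm
      rw [div_le_iff₀ (by positivity)]
      calc (m.factorial : ℝ) * (C * (2 * R) ^ k)
          = m.factorial * (C * 2 ^ k) * R⁻¹ * R ^ (k + 1) := by
            rw [mul_pow, pow_succ]; field_simp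
        _ ≤ m.factorial * (C * 2 ^ k) * R⁻¹ * R ^ m :=
            mul_le_mul_of_nonneg_left h2 (by positivity)
  refine ⟨∑ m ∈ Finset.range (k + 1),
    Polynomial.monomial m ((m.factorial : ℂ)⁻¹ * iteratedDeriv m G 0), ?_, fun s => ?_⟩
  · refine Polynomial.natDegree_sum_le_of_forall_le _ _ fun m hm => ?_
    exact (Polynomial.natDegree_monomial_le _).trans (by simp at hm; omega)
  · rw [← Complex.taylorSeries_eq_of_entire hG 0 s, tsum_eq_sum (s := Finset.range (k + 1)),
      Polynomial.eval_finsetSum]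
    · refine Finset.sum_congr rfl fun m _ => ?_
      simp only [Polynomial.eval_monomial, sub_zero, smul_eq_mul]
      ring
    · intro m hm
      rw [hz m (by simp at hm; omega)]
      simp

/-- The bound makes the points of `Z` removable, and by density it persists for the entire
extension. -/
theorem exists_polynomial_of_growth (Z : Finset ℂ) {g : ℂ → ℂ}
    (hg : ∀ s ∉ Z, DifferentiableAt ℂ g s) {C : ℝ} {k : ℕ}
    (hC : ∀ s ∉ Z, ‖g s‖ ≤ C * (1 + ‖s‖) ^ k) :
    ∃ p : Polynomial ℂ, p.natDegree ≤ k ∧ ∀ s ∉ Z, g s = p.eval s := by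
  obtain ⟨G, hG, hGg⟩ := exists_entire_extension Z hg fun c => by
    refine ⟨C * (1 + ‖c‖) ^ k + 1, ?_⟩
    have hcont : Continuous fun s : ℂ => C * (1 + ‖s‖) ^ k := by fun_prop
    filter_upwards [hcont.continuousAt.eventually_lt
      (continuousAt_const (y := C * (1 + ‖c‖) ^ k + 1)) (by linarith)] with s hs hsZ
    exact (hC s hsZ).trans hs.le
  have hdense : Dense ((Z : Set ℂ)ᶜ) := Z.finite_toSet.countable.dense_compl ℂ
  obtain ⟨p, hp, hp'⟩ := exists_polynomial_of_entire hG (C := C) (k := k) fun s => by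
    have hcl : IsClosed {s : ℂ | ‖G s‖ ≤ C * (1 + ‖s‖) ^ k} :=
      isClosed_le hG.continuous.norm (by fun_prop)
    refine hcl.closure_subset_iff.2 (fun t ht => ?_) (hdense s)
    have ht' : t ∉ Z := by simpa using ht
    change ‖G t‖ ≤ _
    rw [hGg t ht']
    exact hC t ht'
  exact ⟨p, hp, fun s hs => by rw [← hGg s hs, hp' s]⟩

/-- A function on a box that is polynomial of bounded degree in each variable is polynomial. -/
theorem exists_mvPolynomial_of_separately {m : ℕ} (k : ℕ) (S : Fin m → Set ℂ)
    (hS : ∀ i, (S i).Infinite) (a : (Fin m → ℂ) → ℂ)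
    (h : ∀ y ∈ Set.pi Set.univ S, ∀ i, ∃ p : Polynomial ℂ, p.natDegree ≤ k ∧
      ∀ s ∈ S i, a (Function.update y i s) = p.eval s) :
    ∃ A : MvPolynomial (Fin m) ℂ, ∀ y ∈ Set.pi Set.univ S, a y = MvPolynomial.eval y A := by
  induction m with
  | zero =>
    refine ⟨MvPolynomial.C (a finZeroElim), fun y _ => ?_⟩
    rw [MvPolynomial.eval_C]
    congr 1
    exact Subsingleton.elim _ _
  | succ m ih =>
    -- Degree at most `k` in the first variable is recovered by Lagrange interpolation at `k + 1`
    -- nodes of `S 0`. The slices over the nodes are polynomial by induction.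
    obtain ⟨T, hTS, hT⟩ := (hS 0).exists_subset_card_eq (k + 1)
    have hcons : ∀ c ∈ S 0, ∀ y ∈ Set.pi Set.univ (fun i => S (Fin.succ i)),
        (Fin.cons c y : Fin (m + 1) → ℂ) ∈ Set.pi Set.univ S := by
      intro c hc y hy i _
      refine Fin.cases ?_ (fun i => ?_) i
      · simpa using hc
      · simpa using hy i (Set.mem_univ _)
    have hA : ∀ c ∈ T, ∃ A : MvPolynomial (Fin m) ℂ,
        ∀ y ∈ Set.pi Set.univ (fun i => S (Fin.succ i)),
          a (Fin.cons c y) = MvPolynomial.eval y A := by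
      intro c hc
      refine ih (fun i => S (Fin.succ i)) (fun i => hS _) (fun y => a (Fin.cons c y)) ?_
      intro y hy i
      obtain ⟨p, hp, hp'⟩ := h _ (hcons c (hTS hc) y hy) (Fin.succ i)
      refine ⟨p, hp, fun s hs => ?_⟩
      rw [← hp' s hs, Fin.cons_update]
    choose! A hA using hA
    refine ⟨∑ c ∈ T, Polynomial.aeval (MvPolynomial.X 0) (Lagrange.basis T id c) *
      MvPolynomial.rename Fin.succ (A c), fun y hy => ?_⟩
    have hy' : Fin.tail y ∈ Set.pi Set.univ (fun i => S (Fin.succ i)) :=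
      fun i _ => hy _ (Set.mem_univ _)
    obtain ⟨p, hp, hp'⟩ := h y hy 0
    have hupd : ∀ c, Function.update y 0 c = Fin.cons c (Fin.tail y) := by
      intro c
      conv_lhs => rw [← Fin.cons_self_tail y, Fin.update_cons_zero]
    have hpT : p = Lagrange.interpolate T id fun c => p.eval c := by
      refine Lagrange.eq_interpolate (s := T) (v := id) (f := p) (Set.injOn_id _) ?_
      rw [hT]
      exact Polynomial.degree_le_natDegree.trans_lt (by exact_mod_cast Nat.lt_succ_of_le hp)
    have h1 : a y = p.eval (y 0) := by
      rw [← hp' (y 0) (hy 0 (Set.mem_univ _)), Function.update_eq_self]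
    rw [h1, hpT, Lagrange.interpolate_apply, Polynomial.eval_finsetSum, map_sum]
    refine Finset.sum_congr rfl fun c hc => ?_
    rw [Polynomial.eval_mul, Polynomial.eval_C, map_mul, MvPolynomial.eval_rename, mul_comm]
    congr 1
    · rw [Polynomial.aeval_def, Polynomial.hom_eval₂, Polynomial.eval, MvPolynomial.eval_X]
      congr 1
      ext
      simp
    · rw [← hp' c (hTS hc), hupd, hA c hc _ hy']
      rfl

end PolynomialGrowth

/-! ### Restricting polynomials to parallel lines -/

section LinePoly

open Polynomial

variable {σ : Type*}

/-- The polynomial `F (y + T q)` in `T`. -/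
def linePoly {A : Type*} [CommRing A] [Algebra ℂ A] (q : σ → ℂ) (y : σ → A) :
    MvPolynomial σ ℂ →ₐ[ℂ] A[X] :=
  MvPolynomial.aeval fun j => C (y j) + X * C (algebraMap ℂ A (q j))

section

variable {A B : Type*} [CommRing A] [Algebra ℂ A] [CommRing B] [Algebra ℂ B]

theorem linePoly_X (q : σ → ℂ) (y : σ → A) (j : σ) :
    linePoly q y (MvPolynomial.X j) = C (y j) + X * C (algebraMap ℂ A (q j)) :=
  MvPolynomial.aeval_X _ _

theorem map_linePoly (φ : A →ₐ[ℂ] B) (q : σ → ℂ) (y : σ → A) (F : MvPolynomial σ ℂ) :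
    (linePoly q y F).map (φ : A →+* B) = linePoly q (fun j => φ (y j)) F := by
  have : (mapAlgHom φ).comp (linePoly q y) = linePoly q fun j => φ (y j) := by
    refine MvPolynomial.algHom_ext fun j => ?_
    rw [AlgHom.comp_apply, linePoly_X, linePoly_X, coe_mapAlgHom]
    simp
  exact DFunLike.congr_fun this F

theorem eval_zero_linePoly (q : σ → ℂ) (y : σ → A) (F : MvPolynomial σ ℂ) :
    (linePoly q y F).eval 0 = MvPolynomial.aeval y F := by
  have : ((aeval (0 : A)).restrictScalars ℂ).comp (linePoly q y) = MvPolynomial.aeval y := by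
    refine MvPolynomial.algHom_ext fun j => ?_
    rw [AlgHom.comp_apply, linePoly_X, MvPolynomial.aeval_X]
    simp
  have h := DFunLike.congr_fun this F
  rw [← h]
  rfl

/-- Each factor `y_j + T q_j` has degree at most one in `T`, so a monomial of degree `e` contributes
to `T ^ e` only through its value at `q`. -/
theorem natDegree_linePoly_le [Fintype σ] (q : σ → ℂ) (y : σ → A) {F : MvPolynomial σ ℂ} {e : ℕ}
    (hF : F.IsHomogeneous e) : (linePoly q y F).natDegree ≤ e ∧
      (linePoly q y F).coeff e = algebraMap ℂ A (MvPolynomial.eval q F) := by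
  have h1 : ∀ j, (C (y j) + X * C (algebraMap ℂ A (q j))).natDegree ≤ 1 := fun j => by
    rw [X_mul_C]; compute_degree
  have hc : ∀ j, (C (y j) + X * C (algebraMap ℂ A (q j))).coeff 1 = algebraMap ℂ A (q j) :=
    fun j => by simp [coeff_C]
  have hdeg : ∀ m ∈ F.support, ∑ j, m j = e := fun m hm => by
    rw [← hF (MvPolynomial.mem_support_iff.1 hm), Finsupp.weight_apply,
      Finsupp.sum_fintype _ _ (by simp)]
    simp
  have hp : ∀ (m : σ →₀ ℕ) j, ((C (y j) + X * C (algebraMap ℂ A (q j))) ^ m j).natDegree ≤ m j :=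
    fun m j => (natDegree_pow_le_of_le _ (h1 j)).trans (by simp)
  have hprod : ∀ m ∈ F.support,
      (∏ j, (C (y j) + X * C (algebraMap ℂ A (q j))) ^ m j).natDegree ≤ e := by
    intro m hm
    rw [← hdeg m hm]
    exact (natDegree_prod_le _ _).trans (Finset.sum_le_sum fun j _ => hp m j)
  have hprodc : ∀ m ∈ F.support,
      (∏ j, (C (y j) + X * C (algebraMap ℂ A (q j))) ^ m j).coeff e =
        algebraMap ℂ A (∏ j, q j ^ m j) := by
    intro m hm
    have key : ∀ s : Finset σ,
        (∏ j ∈ s, (C (y j) + X * C (algebraMap ℂ A (q j))) ^ m j).coeff (∑ j ∈ s, m j) =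
          algebraMap ℂ A (∏ j ∈ s, q j ^ m j) := by
      intro s
      induction s using Finset.cons_induction with
      | empty => simp
      | cons a s ha ih =>
        rw [Finset.prod_cons, Finset.sum_cons, Finset.prod_cons, map_mul, ← ih,
          coeff_mul_add_eq_of_natDegree_le (hp m a) ((natDegree_prod_le _ _).trans
            (Finset.sum_le_sum fun j _ => hp m j))]
        congr 1
        have := coeff_pow_of_natDegree_le (m := m a) (h1 a)
        rw [mul_one] at this
        rw [this, hc, map_pow]
    rw [← key, hdeg m hm]
  have hsum : linePoly q y F = ∑ m ∈ F.support, C (algebraMap ℂ A (F.coeff m)) *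
      ∏ j, (C (y j) + X * C (algebraMap ℂ A (q j))) ^ m j := by
    rw [linePoly, MvPolynomial.aeval_def, MvPolynomial.eval₂_eq']
    rfl
  constructor
  · rw [hsum]
    exact natDegree_sum_le_of_forall_le _ _ fun m hm => (natDegree_C_mul_le _ _).trans (hprod m hm)
  · rw [hsum, finsetSum_coeff, MvPolynomial.eval_eq', map_sum]
    refine Finset.sum_congr rfl fun m hm => ?_
    rw [coeff_C_mul, hprodc m hm, map_mul]

theorem natDegree_linePoly [Nontrivial A] [Fintype σ] (q : σ → ℂ) (y : σ → A) {F : MvPolynomial σ ℂ} {e : ℕ}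
    (hF : F.IsHomogeneous e) (hq : MvPolynomial.eval q F ≠ 0) : (linePoly q y F).natDegree = e := by
  obtain ⟨h1, h2⟩ := natDegree_linePoly_le q y hF
  refine natDegree_eq_of_le_of_coeff_ne_zero h1 ?_
  rw [h2]
  simpa using hq

theorem leadingCoeff_linePoly [Nontrivial A] [Fintype σ] (q : σ → ℂ) (y : σ → A) {F : MvPolynomial σ ℂ} {e : ℕ}
    (hF : F.IsHomogeneous e) (hq : MvPolynomial.eval q F ≠ 0) :
    (linePoly q y F).leadingCoeff = algebraMap ℂ A (MvPolynomial.eval q F) := by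
  rw [leadingCoeff, natDegree_linePoly q y hF hq, (natDegree_linePoly_le q y hF).2]

end

theorem eval_linePoly (q y : σ → ℂ) (t : ℂ) (F : MvPolynomial σ ℂ) :
    (linePoly q y F).eval t = MvPolynomial.eval (y + t • q) F := by
  have : (aeval t).comp (linePoly q y) = MvPolynomial.aeval (y + t • q) := by
    refine MvPolynomial.algHom_ext fun j => ?_
    rw [AlgHom.comp_apply, linePoly_X, MvPolynomial.aeval_X]
    simp only [map_add, map_mul, coe_aeval_eq_eval, eval_C, eval_X, Algebra.algebraMap_self,
      RingHom.id_apply, Pi.add_apply, Pi.smul_apply, smul_eq_mul, mul_comm t]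
  have h := DFunLike.congr_fun this F
  rw [AlgHom.comp_apply, coe_aeval_eq_eval] at h
  rw [h]
  rfl

theorem map_eval_linePoly (q y : σ → ℂ) (F : MvPolynomial σ ℂ) :
    (linePoly q (MvPolynomial.X : σ → MvPolynomial σ ℂ) F).map (MvPolynomial.eval y) =
      linePoly q y F := by
  have h := map_linePoly (MvPolynomial.aeval y : MvPolynomial σ ℂ →ₐ[ℂ] ℂ) q MvPolynomial.X F
  simp only [MvPolynomial.aeval_X] at h
  rw [← h]
  rfl

/-- The substitution `y ↦ y + T q` on polynomials in `y` and `T`. -/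
def shearHom (q : σ → ℂ) : (MvPolynomial σ ℂ)[X] →ₐ[ℂ] (MvPolynomial σ ℂ)[X] :=
  eval₂AlgHom (linePoly q MvPolynomial.X) X fun _ => Commute.all _ _

theorem shearHom_C (q : σ → ℂ) (F : MvPolynomial σ ℂ) :
    shearHom q (C F) = linePoly q MvPolynomial.X F := by
  simp [shearHom]

theorem shearHom_comp_neg (q : σ → ℂ) : (shearHom q).comp (shearHom (-q)) = AlgHom.id ℂ _ := by
  have hX : ∀ q : σ → ℂ, shearHom q X = X := fun q => by simp [shearHom]
  refine Polynomial.algHom_ext' ?_ ?_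
  · refine MvPolynomial.algHom_ext fun j => ?_
    change shearHom q (shearHom (-q) (C (MvPolynomial.X j))) = C (MvPolynomial.X j)
    rw [shearHom_C, linePoly_X, map_add, map_mul, shearHom_C, hX, linePoly_X]
    have : shearHom q (C (algebraMap ℂ (MvPolynomial σ ℂ) ((-q) j))) =
        C (algebraMap ℂ (MvPolynomial σ ℂ) ((-q) j)) := (shearHom q).commutes _
    rw [this]
    simp only [Pi.neg_apply, map_neg]
    ring
  · change shearHom q (shearHom (-q) X) = X
    rw [hX, hX]

/-- A polynomial irreducible in `y` stays irreducible when `T` is adjoined, and the shear `y ↦ y + T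
q` is an automorphism with inverse the shear by `-q`. -/
theorem irreducible_linePoly (q : σ → ℂ) {F : MvPolynomial σ ℂ} (hF : Irreducible F) :
    Irreducible (linePoly q (MvPolynomial.X : σ → MvPolynomial σ ℂ) F) := by
  let e : (MvPolynomial σ ℂ)[X] ≃ₐ[ℂ] (MvPolynomial σ ℂ)[X] :=
    AlgEquiv.ofAlgHom (shearHom q) (shearHom (-q)) (shearHom_comp_neg q)
      (by simpa using shearHom_comp_neg (-q))
  have h1 : Irreducible (C F) := (prime_C_iff.2 hF.prime).irreducible
  have h2 : Irreducible (e (C F)) := (MulEquiv.irreducible_iff e).2 h1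
  rwa [show e (C F) = linePoly q MvPolynomial.X F from shearHom_C q F] at h2

theorem isCoprime_of_irreducible_of_not_dvd {K : Type*} [Field K] {f g : K[X]}
    (hf : Irreducible f) (h : ¬ f ∣ g) : IsCoprime f g :=
  hf.coprime_iff_not_dvd.2 h

/-- For generic `y` the restriction of a reduced polynomial to the line `y + T q` is separable. -/
theorem exists_discriminant [Fintype σ] {k : ℕ} {F : Fin k → MvPolynomial σ ℂ} {e : Fin k → ℕ}
    (hF : ∀ i, (F i).IsHomogeneous (e i)) (hirr : ∀ i, Irreducible (F i))
    (hdvd : ∀ i j, i ≠ j → ¬ F i ∣ F j) {q : σ → ℂ} (hq : ∀ i, MvPolynomial.eval q (F i) ≠ 0) :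
    ∃ Q : MvPolynomial σ ℂ, Q ≠ 0 ∧ ∀ y, MvPolynomial.eval y Q ≠ 0 →
      (linePoly q y (∏ i, F i)).Separable := by
  let R := MvPolynomial σ ℂ
  let f : Fin k → R[X] := fun i => linePoly q MvPolynomial.X (F i)
  -- The leading coefficient in `T` is the nonzero constant `F i (q)`. Primitivity lets Gauss's
  -- lemma carry irreducibility and divisibility to and from the fraction field.
  have hprim : ∀ i, (f i).IsPrimitive := by
    intro i
    refine isPrimitive_iff_isUnit_of_C_dvd.2 fun r hr => ?_
    have h1 := (C_dvd_iff_dvd_coeff r _).1 hr (f i).natDegree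
    refine isUnit_of_dvd_unit h1 ?_
    change IsUnit (f i).leadingCoeff
    rw [leadingCoeff_linePoly q _ (hF i) (hq i)]
    exact (isUnit_iff_ne_zero.2 (hq i)).map _
  have hirrK : ∀ i, Irreducible ((f i).map (algebraMap R (FractionRing R))) := fun i =>
    (hprim i).irreducible_iff_irreducible_map_fraction_map.1 (irreducible_linePoly q (hirr i))
  have hcop : Pairwise (Function.onFun IsCoprime fun i => (f i).map (algebraMap R (FractionRing R))) := by
    intro i j hij
    refine isCoprime_of_irreducible_of_not_dvd (hirrK i) fun h => hdvd i j hij ?_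
    have h2 : f i ∣ f j := ((hprim i).dvd_iff_fraction_map_dvd_fraction_map (FractionRing R)).2 h
    -- Setting `T = 0` recovers the original polynomials.
    have h3 := eval_dvd (x := (0 : R)) h2
    simp only [f, eval_zero_linePoly] at h3
    rwa [MvPolynomial.aeval_X_left_apply, MvPolynomial.aeval_X_left_apply] at h3
  have hsep : ((∏ i, f i).map (algebraMap R (FractionRing R))).Separable := by
    rw [Polynomial.map_prod]
    exact separable_prod hcop fun i => (hirrK i).separable
  obtain ⟨a, b, hab⟩ := hsep
  -- Clearing denominators in the Bézout identity of a polynomial and its derivative gives an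
  -- identity over `ℂ[y]` with right side `r s`; it specializes to separability wherever `r s` does
  -- not vanish.
  obtain ⟨r, hr0, hr⟩ := IsLocalization.integerNormalization_spec (nonZeroDivisors R) a
  obtain ⟨s, hs0, hs⟩ := IsLocalization.integerNormalization_spec (nonZeroDivisors R) b
  set a' := IsLocalization.integerNormalization (nonZeroDivisors R) a
  set b' := IsLocalization.integerNormalization (nonZeroDivisors R) b
  have hinj : Function.Injective (Polynomial.map (algebraMap R (FractionRing R))) :=
    Polynomial.map_injective _ (IsFractionRing.injective R (FractionRing R))
  have key : C s * a' * (∏ i, f i) + C r * b' * derivative (∏ i, f i) =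
      C (r * s) := by
    apply hinj
    have hr' : a'.map (algebraMap R (FractionRing R)) = C (algebraMap R (FractionRing R) r) * a := by
      rw [hr, ← algebraMap_smul (FractionRing R), smul_eq_C_mul]
    have hs' : b'.map (algebraMap R (FractionRing R)) = C (algebraMap R (FractionRing R) s) * b := by
      rw [hs, ← algebraMap_smul (FractionRing R), smul_eq_C_mul]
    simp only [Polynomial.map_add, Polynomial.map_mul, map_C, ← derivative_map, hr', hs', map_mul]
    linear_combination (C (algebraMap R (FractionRing R) r) * C (algebraMap R (FractionRing R) s)) * hab
  refine ⟨r * s, mul_ne_zero (nonZeroDivisors.ne_zero hr0) (nonZeroDivisors.ne_zero hs0),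
    fun y hy => ?_⟩
  have h := congrArg (Polynomial.map (MvPolynomial.eval y)) key
  have hP : (∏ i, f i).map (MvPolynomial.eval y) = linePoly q y (∏ i, F i) := by
    rw [Polynomial.map_prod, map_prod]
    exact Finset.prod_congr rfl fun i _ => map_eval_linePoly q y (F i)
  simp only [Polynomial.map_add, Polynomial.map_mul, map_C, ← derivative_map, hP] at h
  refine ⟨C (MvPolynomial.eval y (r * s))⁻¹ * (C (MvPolynomial.eval y s) *
    a'.map (MvPolynomial.eval y)), C (MvPolynomial.eval y (r * s))⁻¹ *
    (C (MvPolynomial.eval y r) * b'.map (MvPolynomial.eval y)), ?_⟩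
  have hu : C (MvPolynomial.eval y (r * s))⁻¹ * C (MvPolynomial.eval y (r * s)) =
      1 := by
    rw [← C_mul, inv_mul_cancel₀ hy, C_1]
  linear_combination C (MvPolynomial.eval y (r * s))⁻¹ * h + hu

end LinePoly

/-! ### Components of a normal crossing divisor are distinct -/

namespace GenericHypersurfaces

variable {n k : ℕ} {d : Fin k → ℕ}

theorem exists_common_nonzero (D : GenericHypersurfaces n d) :
    ∃ q : Fin (n + 1) → ℂ, ∀ i, MvPolynomial.eval q (D.F i) ≠ 0 := by
  have h : ∏ i, D.F i ≠ 0 := Finset.prod_ne_zero_iff.2 fun i _ => (D.irreducible i).ne_zero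
  by_contra! hcon
  refine h (MvPolynomial.funext fun q => ?_)
  obtain ⟨i, hi⟩ := hcon q
  rw [map_prod, map_zero]
  exact Finset.prod_eq_zero (Finset.mem_univ i) hi

/-- As `n ≥ 1`, there is a line `y + t q` missing the origin; on it `F i` restricts to a polynomial
of degree `d i ≥ 1`, which has a root. -/
theorem exists_zero (hn : 1 ≤ n) (hd : ∀ i, 1 ≤ d i) (D : GenericHypersurfaces n d) (i : Fin k) :
    ∃ z : Fin (n + 1) → ℂ, z ≠ 0 ∧ MvPolynomial.eval z (D.F i) = 0 := by
  obtain ⟨q, hq⟩ := D.exists_common_nonzero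
  obtain ⟨y, hy⟩ : ∃ y : Fin (n + 1) → ℂ, ∀ c : ℂ, y ≠ c • q := by
    by_contra! hcon
    have h1 : Module.finrank ℂ (Fin (n + 1) → ℂ) ≤ 1 :=
      finrank_le_one q fun w => (hcon w).imp fun c hc => hc.symm
    simp at h1
    omega
  have hdeg := natDegree_linePoly q y (D.isHomogeneous i) (hq i)
  obtain ⟨t, ht⟩ := IsAlgClosed.exists_root (linePoly q y (D.F i)) (by
    intro h0
    have h1 : (linePoly q y (D.F i)).natDegree = 0 := Polynomial.natDegree_eq_zero_iff_degree_le_zero.2 h0.le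
    have := hd i
    omega)
  rw [Polynomial.IsRoot, eval_linePoly] at ht
  refine ⟨y + t • q, fun h0 => hy (-t) ?_, ht⟩
  rw [neg_smul]
  exact eq_neg_of_add_eq_zero_left h0

/-- If `F j = u F i`, then at a zero of `F i` the gradient of `F j` is `u` times that of `F i`,
against the normal crossing condition. -/
theorem not_dvd (hn : 1 ≤ n) (hd : ∀ i, 1 ≤ d i) (D : GenericHypersurfaces n d) (i j : Fin k)
    (hij : i ≠ j) : ¬ D.F i ∣ D.F j := by
  rintro ⟨u, hu⟩
  obtain ⟨z, hz, hzi⟩ := D.exists_zero hn hd i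
  have hzj : MvPolynomial.eval z (D.F j) = 0 := by rw [hu, map_mul, hzi, zero_mul]
  have hl : ∀ l, MvPolynomial.eval z (MvPolynomial.pderiv l (D.F j)) =
      MvPolynomial.eval z u * MvPolynomial.eval z (MvPolynomial.pderiv l (D.F i)) := by
    intro l
    rw [hu, Derivation.leibniz, map_add, smul_eq_mul, smul_eq_mul, map_mul, map_mul, hzi,
      zero_mul, zero_add]
  have h := linearIndependent_iff'.1 (D.normalCrossing z hz) Finset.univ
    (fun a => if a.1 = i then MvPolynomial.eval z u else if a.1 = j then -1 else 0) ?_ ⟨j, hzj⟩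
    (Finset.mem_univ _)
  · simp [hij.symm] at h
  · rw [Finset.sum_eq_add (⟨i, hzi⟩ : {i : Fin k // MvPolynomial.eval z (D.F i) = 0}) ⟨j, hzj⟩
      (fun h => hij (congrArg Subtype.val h))]
    · funext l
      rw [if_pos rfl, if_neg hij.symm, if_pos rfl, Pi.add_apply, Pi.smul_apply, Pi.smul_apply,
        hl l, smul_eq_mul, smul_eq_mul, Pi.zero_apply]
      ring
    · rintro ⟨a, ha⟩ - ⟨h1, h2⟩
      rw [if_neg fun h => h1 (Subtype.ext h), if_neg fun h => h2 (Subtype.ext h), zero_smul]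
    · exact fun h => absurd (Finset.mem_univ _) h
    · exact fun h => absurd (Finset.mem_univ _) h

end GenericHypersurfaces

/-! ### The roots of a polynomial on parallel lines -/

theorem exists_implicit_root {E : Type*} [NormedAddCommGroup E] [NormedSpace ℂ E] [CompleteSpace E]
    {f : E × ℂ → ℂ} {u : E × ℂ} (hf : ContDiffAt ℂ 1 f u) {c : ℂ} (hc : c ≠ 0)
    (hd : HasDerivAt (fun t => f (u.1, t)) c u.2) :
    ∃ ρ : E → ℂ, ρ u.1 = u.2 ∧ ContDiffAt ℂ 1 ρ u.1 ∧ ∀ᶠ y in 𝓝 u.1, f (y, ρ y) = f u := by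
  have hinv : (fderiv ℂ f u ∘L .inr ℂ E ℂ).IsInvertible := by
    refine ⟨ContinuousLinearEquiv.unitsEquivAut ℂ (Units.mk0 c hc), ?_⟩
    ext
    have h1 : HasDerivAt (fun t => f (u.1, t)) (fderiv ℂ f u (0, 1)) u.2 := by
      have h2 : HasFDerivAt f (fderiv ℂ f u) (u.1, u.2) :=
        (hf.differentiableAt one_ne_zero).hasFDerivAt
      exact h2.comp_hasDerivAt u.2 ((hasDerivAt_const u.2 u.1).prodMk (hasDerivAt_id u.2))
    simp [hd.unique h1]
  exact ⟨hf.implicitFunction one_ne_zero hinv, hf.implicitFunction_apply_self one_ne_zero hinv,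
    hf.contDiffAt_implicitFunction one_ne_zero hinv,
    hf.eventually_apply_implicitFunction one_ne_zero hinv⟩

section LineRoots

open Polynomial

variable {m : ℕ} {q : Fin m → ℂ} {F P Q : MvPolynomial (Fin m) ℂ} {e : ℕ}

/-- The roots of `T ↦ F (y + T q)`. -/
def lineRoots (q : Fin m → ℂ) (F : MvPolynomial (Fin m) ℂ) (y : Fin m → ℂ) : Finset ℂ :=
  (linePoly q y F).roots.toFinset

theorem linePoly_ne_zero (hq : MvPolynomial.eval q F ≠ 0) (hF : F.IsHomogeneous e)
    (y : Fin m → ℂ) : linePoly q y F ≠ 0 := by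
  rw [← leadingCoeff_ne_zero, leadingCoeff_linePoly q y hF hq]
  exact hq

theorem mem_lineRoots (hq : MvPolynomial.eval q F ≠ 0) (hF : F.IsHomogeneous e) {y : Fin m → ℂ}
    {r : ℂ} : r ∈ lineRoots q F y ↔ MvPolynomial.eval (y + r • q) F = 0 := by
  rw [lineRoots, Multiset.mem_toFinset, mem_roots (linePoly_ne_zero hq hF y), IsRoot,
    eval_linePoly]

theorem card_lineRoots_le (hq : MvPolynomial.eval q F ≠ 0) (hF : F.IsHomogeneous e)
    (y : Fin m → ℂ) : (lineRoots q F y).card ≤ e := by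
  rw [← natDegree_linePoly q y hF hq]
  exact (Multiset.toFinset_card_le _).trans (card_roots' _)

theorem card_lineRoots (hq : MvPolynomial.eval q F ≠ 0) (hF : F.IsHomogeneous e)
    {y : Fin m → ℂ} (hs : (linePoly q y F).Separable) : (lineRoots q F y).card = e := by
  rw [lineRoots, Multiset.toFinset_card_of_nodup (nodup_roots hs),
    ← (IsAlgClosed.splits _).natDegree_eq_card_roots, natDegree_linePoly q y hF hq]

theorem linePoly_eq_prod (hq : MvPolynomial.eval q F ≠ 0) (hF : F.IsHomogeneous e)
    {y : Fin m → ℂ} (hs : (linePoly q y F).Separable) :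
    linePoly q y F = C (MvPolynomial.eval q F) * ∏ r ∈ lineRoots q F y, (X - C r) := by
  have h := (IsAlgClosed.splits (linePoly q y F)).eq_prod_roots
  rw [leadingCoeff_linePoly q y hF hq] at h
  refine h.trans ?_
  congr 1
  rw [lineRoots, Finset.prod_multiset_map_count, Finset.prod_congr rfl]
  intro r hr
  rw [Multiset.mem_toFinset] at hr
  rw [Multiset.count_eq_one_of_mem (nodup_roots hs) hr, pow_one]

theorem linePoly_add_smul (q y : Fin m → ℂ) (r : ℂ) (F : MvPolynomial (Fin m) ℂ) :
    linePoly q (y + r • q) F = (linePoly q y F).comp (X + C r) := by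
  refine Polynomial.funext fun t => ?_
  rw [eval_comp, eval_linePoly, eval_linePoly, eval_add, eval_X, eval_C, add_smul]
  congr 1
  abel_nf

theorem separable_linePoly_of_dvd (hFP : F ∣ P) {y : Fin m → ℂ} (hs : (linePoly q y P).Separable) :
    (linePoly q y F).Separable := by
  obtain ⟨u, rfl⟩ := hFP
  rw [map_mul] at hs
  exact hs.of_mul_left

/-- The points `x` of the hypersurface `F = 0` at which `P` is nonsingular in direction `q`. -/
def transverseZeros (q : Fin m → ℂ) (F P : MvPolynomial (Fin m) ℂ) : Set (Fin m → ℂ) :=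
  {x | MvPolynomial.eval x F = 0 ∧ (linePoly q x P).derivative.eval 0 ≠ 0}

theorem mem_transverseZeros (hFP : F ∣ P) {y : Fin m → ℂ} (hs : (linePoly q y P).Separable) {r : ℂ}
    (hr : MvPolynomial.eval (y + r • q) F = 0) : y + r • q ∈ transverseZeros q F P := by
  refine ⟨hr, ?_⟩
  rw [linePoly_add_smul, derivative_comp]
  have hrP : (linePoly q y P).eval r = 0 := by
    obtain ⟨u, rfl⟩ := hFP
    rw [eval_linePoly, map_mul, hr, zero_mul]
  have := hs.eval₂_derivative_ne_zero (RingHom.id ℂ) (x := r) (by simpa [eval₂_id] using hrP)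
  simpa [eval₂_id] using this

open Classical in
/-- The product of `-r` over the roots `r` of `T ↦ F (y + T q)` for which `y + r q` satisfies
`χ`. -/
def partialProd (q : Fin m → ℂ) (F : MvPolynomial (Fin m) ℂ) (χ : (Fin m → ℂ) → Prop)
    (y : Fin m → ℂ) : ℂ :=
  ∏ r ∈ (lineRoots q F y).filter fun r => χ (y + r • q), -r

/-- This is the factorization `F (y + T q) = F(q) ∏ (T - r)` at `T = 0`, with the roots split
according to `χ`. -/
theorem partialProd_mul_partialProd_not (hq : MvPolynomial.eval q F ≠ 0) (hF : F.IsHomogeneous e)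
    {y : Fin m → ℂ} (hs : (linePoly q y F).Separable) (χ : (Fin m → ℂ) → Prop) :
    MvPolynomial.eval y F = MvPolynomial.eval q F *
      (partialProd q F χ y * partialProd q F (fun x => ¬ χ x) y) := by
  classical
  have h := congrArg (Polynomial.eval 0) (linePoly_eq_prod hq hF hs)
  rw [eval_linePoly, zero_smul, add_zero] at h
  rw [h, eval_mul, eval_C, eval_prod, partialProd, partialProd]
  congr 1
  rw [← Finset.prod_filter_mul_prod_filter_not (lineRoots q F y) fun r => χ (y + r • q)]
  simp only [eval_sub, eval_X, eval_C, zero_sub]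
  congr

/-- Near a point `y₀` where they are distinct the roots depend differentiably on `y`. -/
theorem exists_local_roots (hq : MvPolynomial.eval q F ≠ 0) (hF : F.IsHomogeneous e)
    {y₀ : Fin m → ℂ} (hs : (linePoly q y₀ F).Separable) :
    ∃ ρ : ℂ → (Fin m → ℂ) → ℂ, (∀ r ∈ lineRoots q F y₀, ρ r y₀ = r ∧ DifferentiableAt ℂ (ρ r) y₀ ∧
      ∀ᶠ y in 𝓝 y₀, ContinuousAt (ρ r) y) ∧
      ∀ᶠ y in 𝓝 y₀, lineRoots q F y = (lineRoots q F y₀).image (fun r => ρ r y) ∧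
        Set.InjOn (fun r => ρ r y) (lineRoots q F y₀) := by
  have hcd : ContDiff ℂ 1 fun p : (Fin m → ℂ) × ℂ => MvPolynomial.eval (p.1 + p.2 • q) F := by
    have h1 : ContDiff ℂ 1 fun x : Fin m → ℂ => MvPolynomial.eval x F :=
      (AnalyticOnNhd.eval_mvPolynomial F).contDiff
    exact h1.comp (by fun_prop)
  have hex : ∀ r ∈ lineRoots q F y₀, ∃ ρ : (Fin m → ℂ) → ℂ, ρ y₀ = r ∧ ContDiffAt ℂ 1 ρ y₀ ∧
      ∀ᶠ y in 𝓝 y₀, MvPolynomial.eval (y + ρ y • q) F = 0 := by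
    intro r hr
    rw [mem_lineRoots hq hF] at hr
    have hd : (derivative (linePoly q y₀ F)).eval r ≠ 0 := by
      have := hs.eval₂_derivative_ne_zero (RingHom.id ℂ) (x := r)
        (by simpa [eval₂_id, eval_linePoly] using hr)
      simpa [eval₂_id] using this
    obtain ⟨ρ, h1, h2, h3⟩ := exists_implicit_root (u := (y₀, r)) hcd.contDiffAt hd (by
      have := (linePoly q y₀ F).hasDerivAt r
      simpa only [eval_linePoly] using this)
    simp only [hr] at h3
    exact ⟨ρ, h1, h2, h3⟩
  choose! ρ h1 h2 h3 using hex
  refine ⟨ρ, fun r hr => ⟨h1 r hr, (h2 r hr).differentiableAt one_ne_zero, ?_⟩, ?_⟩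
  · exact ((h2 r hr).eventually (by simp)).mono fun y hy => hy.continuousAt
  have hinj : ∀ᶠ y in 𝓝 y₀, ∀ r ∈ lineRoots q F y₀, ∀ r' ∈ lineRoots q F y₀, r ≠ r' →
      ρ r y ≠ ρ r' y := by
    refine (Filter.eventually_all_finset _).2 fun r hr => (Filter.eventually_all_finset _).2
      fun r' hr' => ?_
    by_cases hrr : r = r'
    · exact Filter.Eventually.of_forall fun y h => absurd hrr h
    · have h4 : ρ r y₀ ≠ ρ r' y₀ := by rwa [h1 r hr, h1 r' hr']
      exact (((h2 r hr).continuousAt.sub (h2 r' hr').continuousAt).eventually_ne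
        (sub_ne_zero.2 h4)).mono fun y hy _ => sub_ne_zero.1 hy
  filter_upwards [hinj, (Filter.eventually_all_finset _).2 h3] with y hy1 hy2
  have hinjOn : Set.InjOn (fun r => ρ r y) (lineRoots q F y₀) := fun r hr r' hr' h => by
    by_contra hne
    exact hy1 r hr r' hr' hne h
  -- The continued roots are `e` distinct ones and there are at most `e`, so none is missing.
  refine ⟨(Finset.eq_of_subset_of_card_le ?_ ?_).symm, hinjOn⟩
  · intro t ht
    obtain ⟨r, hr, rfl⟩ := Finset.mem_image.1 ht
    exact (mem_lineRoots hq hF).2 (hy2 r hr)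
  · rw [Finset.card_image_of_injOn hinjOn, card_lineRoots hq hF hs]
    exact card_lineRoots_le hq hF y

/-- `χ` is constant along paths in the transverse locus. Over a small ball each root moves
continuously inside that locus, so the selection by `χ` does not change and the product is one of
differentiable root functions. -/
theorem differentiableAt_partialProd (hq : MvPolynomial.eval q F ≠ 0) (hF : F.IsHomogeneous e)
    (hFP : F ∣ P) (hQ : ∀ y, MvPolynomial.eval y Q ≠ 0 → (linePoly q y P).Separable)
    {χ : (Fin m → ℂ) → Prop} (hχ : ∀ x x', JoinedIn (transverseZeros q F P) x x' → (χ x ↔ χ x'))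
    {y₀ : Fin m → ℂ} (hy₀ : MvPolynomial.eval y₀ Q ≠ 0) :
    DifferentiableAt ℂ (partialProd q F χ) y₀ := by
  classical
  have hsF : ∀ y, MvPolynomial.eval y Q ≠ 0 → (linePoly q y F).Separable := fun y hy =>
    separable_linePoly_of_dvd hFP (hQ y hy)
  obtain ⟨ρ, h1, h2⟩ := exists_local_roots hq hF (hsF y₀ hy₀)
  have hev : ∀ᶠ y in 𝓝 y₀, MvPolynomial.eval y Q ≠ 0 ∧
      (∀ r ∈ lineRoots q F y₀, ContinuousAt (ρ r) y) ∧
      lineRoots q F y = (lineRoots q F y₀).image (fun r => ρ r y) ∧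
        Set.InjOn (fun r => ρ r y) (lineRoots q F y₀) := by
    have h3 := (MvPolynomial.continuous_eval Q).continuousAt.eventually_ne hy₀
    have h4 : ∀ᶠ y in 𝓝 y₀, ∀ r ∈ lineRoots q F y₀, ContinuousAt (ρ r) y :=
      (Filter.eventually_all_finset _).2 fun r hr => (h1 r hr).2.2
    filter_upwards [h2, h3, h4] with y a1 a2 a3
    exact ⟨a2, a3, a1⟩
  obtain ⟨δ, hδ, hball⟩ := Metric.eventually_nhds_iff_ball.1 hev
  have hχr : ∀ r ∈ lineRoots q F y₀, ∀ y ∈ Metric.ball y₀ δ,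
      (χ (y + ρ r y • q) ↔ χ (y₀ + r • q)) := by
    intro r hr y hy
    have hmem : ∀ z ∈ Metric.ball y₀ δ, z + ρ r z • q ∈ transverseZeros q F P := fun z hz => by
      obtain ⟨a1, -, a3, -⟩ := hball z hz
      refine mem_transverseZeros hFP (hQ z a1) ((mem_lineRoots hq hF).1 ?_)
      rw [a3]
      exact Finset.mem_image_of_mem _ hr
    have hpc : IsPathConnected ((fun z => z + ρ r z • q) '' Metric.ball y₀ δ) := by
      refine IsPathConnected.image' ((convex_ball y₀ δ).isPathConnected ⟨y₀, by simpa⟩) ?_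
      exact continuousOn_id.add (ContinuousOn.smul (fun z hz =>
        ((hball z hz).2.1 r hr).continuousWithinAt) continuousOn_const)
    have hj := (hpc.joinedIn _ ⟨y, hy, rfl⟩ _ ⟨y₀, Metric.mem_ball_self hδ, rfl⟩).mono (by
      rintro _ ⟨z, hz, rfl⟩
      exact hmem z hz)
    have := hχ _ _ hj
    simpa only [(h1 r hr).1] using this
  have heq : partialProd q F χ =ᶠ[𝓝 y₀] fun y =>
      ∏ r ∈ (lineRoots q F y₀).filter fun r => χ (y₀ + r • q), -ρ r y := by
    filter_upwards [Metric.ball_mem_nhds y₀ hδ] with y hy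
    obtain ⟨-, -, a3, a4⟩ := hball y hy
    rw [partialProd, a3, Finset.filter_image, Finset.prod_image]
    · refine Finset.prod_congr (Finset.filter_congr fun r hr => hχr r hr y hy) fun _ _ => rfl
    · exact fun r hr r' hr' h => a4 (Finset.filter_subset _ _ hr) (Finset.filter_subset _ _ hr') h
  refine DifferentiableAt.congr_of_eventuallyEq ?_ heq
  exact (HasFDerivAt.finsetProd (g := fun r y => -ρ r y) fun r hr =>
    ((h1 r (Finset.filter_subset _ _ hr)).2.1).fun_neg.hasFDerivAt).differentiableAt

/-- For a root `r ≠ 0`, homogeneity gives `F (q + r⁻¹ y) = 0`; as `F` has no zeros near `q`, the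
vector `r⁻¹ y` cannot be small. -/
theorem exists_norm_lineRoots_le (hq : MvPolynomial.eval q F ≠ 0) (hF : F.IsHomogeneous e) :
    ∃ c : ℝ, 0 ≤ c ∧ ∀ y, ∀ r ∈ lineRoots q F y, ‖r‖ ≤ c * ‖y‖ := by
  obtain ⟨δ, hδ, hball⟩ := Metric.eventually_nhds_iff_ball.1
    ((MvPolynomial.continuous_eval F).continuousAt.eventually_ne hq)
  refine ⟨δ⁻¹, by positivity, fun y r hr => ?_⟩
  rw [mem_lineRoots hq hF] at hr
  by_cases h0 : r = 0
  · rw [h0, norm_zero]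
    positivity
  have h1 : MvPolynomial.eval (q + r⁻¹ • y) F = 0 := by
    rw [show q + r⁻¹ • y = r⁻¹ • (y + r • q) by
      rw [smul_add, smul_smul, inv_mul_cancel₀ h0, one_smul, add_comm], hF.eval_smul_eq, hr,
      mul_zero]
  have h2 : δ ≤ ‖r‖⁻¹ * ‖y‖ := by
    by_contra! hlt
    refine hball (q + r⁻¹ • y) ?_ h1
    rwa [mem_ball_iff_norm, add_sub_cancel_left, norm_smul, norm_inv]
  have hr0 : 0 < ‖r‖ := norm_pos_iff.2 h0
  rw [inv_mul_eq_div, le_div_iff₀ hr0] at h2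
  rw [inv_mul_eq_div, le_div_iff₀ hδ]
  linarith

theorem norm_partialProd_le (hq : MvPolynomial.eval q F ≠ 0) (hF : F.IsHomogeneous e) {c : ℝ}
    (hc0 : 0 ≤ c) (hc : ∀ y, ∀ r ∈ lineRoots q F y, ‖r‖ ≤ c * ‖y‖) (χ : (Fin m → ℂ) → Prop)
    (y : Fin m → ℂ) : ‖partialProd q F χ y‖ ≤ (1 + c * ‖y‖) ^ e := by
  classical
  have h1 : 1 ≤ 1 + c * ‖y‖ := by nlinarith [norm_nonneg y]
  rw [partialProd, norm_prod]
  refine ((Finset.prod_le_prod (fun r _ => norm_nonneg _) (g := fun _ => 1 + c * ‖y‖)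
    fun r hr => ?_).trans_eq (Finset.prod_const _)).trans
    (pow_le_pow_right₀ h1 ((Finset.card_filter_le _ _).trans (card_lineRoots_le hq hF y)))
  rw [norm_neg]
  linarith [hc y r (Finset.filter_subset _ _ hr)]

theorem exists_finset_update (Q : MvPolynomial (Fin m) ℂ) {y : Fin m → ℂ}
    (hy : MvPolynomial.eval y Q ≠ 0) (i : Fin m) :
    ∃ Z : Finset ℂ, ∀ s, s ∉ Z ↔ MvPolynomial.eval (Function.update y i s) Q ≠ 0 := by
  classical
  let p : ℂ[X] := MvPolynomial.aeval (fun j => if j = i then X else C (y j)) Q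
  have hp : ∀ s, p.eval s = MvPolynomial.eval (Function.update y i s) Q := by
    intro s
    have h : (aeval s).comp (MvPolynomial.aeval (R := ℂ) fun j => if j = i then (X : ℂ[X])
        else C (y j)) = MvPolynomial.aeval (Function.update y i s) := by
      refine MvPolynomial.algHom_ext fun j => ?_
      rw [AlgHom.comp_apply, MvPolynomial.aeval_X, MvPolynomial.aeval_X]
      by_cases hj : j = i
      · rw [hj, if_pos rfl, Function.update_self, aeval_X]
      · rw [if_neg hj, Function.update_of_ne hj, aeval_C]
        rfl
    exact DFunLike.congr_fun h Q
  have hp0 : p ≠ 0 := fun h => hy (by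
    rw [← Function.update_eq_self i y, ← hp, h, eval_zero])
  refine ⟨p.roots.toFinset, fun s => ?_⟩
  rw [Multiset.mem_toFinset, mem_roots hp0, IsRoot, hp]

theorem exists_polynomial_partialProd (hq : MvPolynomial.eval q F ≠ 0) (hF : F.IsHomogeneous e)
    (hFP : F ∣ P) (hQ : ∀ y, MvPolynomial.eval y Q ≠ 0 → (linePoly q y P).Separable)
    {χ : (Fin m → ℂ) → Prop} (hχ : ∀ x x', JoinedIn (transverseZeros q F P) x x' → (χ x ↔ χ x'))
    {y : Fin m → ℂ} (hy : MvPolynomial.eval y Q ≠ 0) (i : Fin m) :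
    ∃ p : ℂ[X], p.natDegree ≤ e ∧ ∀ s, MvPolynomial.eval (Function.update y i s) Q ≠ 0 →
      partialProd q F χ (Function.update y i s) = p.eval s := by
  obtain ⟨Z, hZ⟩ := exists_finset_update Q hy i
  obtain ⟨c, hc0, hc⟩ := exists_norm_lineRoots_le hq hF
  obtain ⟨p, hp, hp'⟩ := exists_polynomial_of_growth Z
    (g := fun s => partialProd q F χ (Function.update y i s))
    -- The constant comes from `1 + c (‖y‖ + ‖s‖) ≤ (1 + c (1 + ‖y‖)) (1 + ‖s‖)`.
    (C := (1 + c * (1 + ‖y‖)) ^ e) (k := e) (fun s hs => by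
      have h1 := differentiableAt_partialProd hq hF hFP hQ hχ ((hZ s).1 hs)
      exact h1.comp s (hasFDerivAt_update y s).differentiableAt) (fun s _ => by
      refine (norm_partialProd_le hq hF hc0 hc χ _).trans ?_
      rw [← mul_pow]
      have h2 : ‖Function.update y i s‖ ≤ ‖y‖ + ‖s‖ := by
        refine (pi_norm_le_iff_of_nonneg (by positivity)).2 fun j => ?_
        by_cases hj : j = i
        · rw [hj, Function.update_self]
          linarith [norm_nonneg y]
        · rw [Function.update_of_ne hj]
          linarith [norm_le_pi_norm y j, norm_nonneg s]
      have h3 := norm_nonneg y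
      have h4 := norm_nonneg s
      gcongr
      nlinarith [mul_le_mul_of_nonneg_left h2 hc0, mul_nonneg hc0 h3, mul_nonneg hc0 h4,
        mul_nonneg (mul_nonneg hc0 h3) h4])
  exact ⟨p, hp, fun s hs => hp' s ((hZ s).2 hs)⟩

/-- Moving `y₀` by `s q` translates the roots by `-s`, so the partial product becomes `∏ (s - r)`
over the selected roots. A constant value near `s = 0` forces the product to be empty. -/
theorem eval_ne_zero_of_forall_partialProd_eq (hq : MvPolynomial.eval q F ≠ 0)
    (hF : F.IsHomogeneous e) {χ : (Fin m → ℂ) → Prop} {y₀ : Fin m → ℂ} {c : ℂ}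
    (h : ∀ᶠ y in 𝓝 y₀, partialProd q F χ y = c) (r : ℂ) (hr : χ (y₀ + r • q)) :
    MvPolynomial.eval (y₀ + r • q) F ≠ 0 := by
  classical
  intro h0
  set S := (lineRoots q F y₀).filter fun r => χ (y₀ + r • q)
  have hshift : ∀ s : ℂ, partialProd q F χ (y₀ + s • q) = (∏ r ∈ S, (X - C r)).eval s := by
    intro s
    have hS : (lineRoots q F (y₀ + s • q)).filter (fun r => χ (y₀ + s • q + r • q)) =
        S.image fun r => r - s := by
      ext t
      have ht : y₀ + s • q + t • q = y₀ + (t + s) • q := by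
        rw [add_smul]
        abel
      simp only [S, Finset.mem_filter, Finset.mem_image, mem_lineRoots hq hF, ht]
      constructor
      · exact fun h => ⟨t + s, h, by ring⟩
      · rintro ⟨u, hu, rfl⟩
        rwa [sub_add_cancel]
    rw [partialProd, hS, Finset.prod_image (fun a _ b _ h => sub_left_injective h), eval_prod]
    refine Finset.prod_congr rfl fun a _ => ?_
    simp
  have hcont : Filter.Tendsto (fun s : ℂ => y₀ + s • q) (𝓝 0) (𝓝 y₀) := by
    have : Continuous fun s : ℂ => y₀ + s • q := by fun_prop
    simpa using this.tendsto 0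
  have hpoly : ∏ r ∈ S, (X - C r) = C c := by
    refine eq_of_infinite_eval_eq _ _ ((infinite_of_mem_nhds (0 : ℂ) (hcont.eventually h)).mono ?_)
    intro s hs
    simp only [Set.mem_ofPred_eq, eval_C]
    rw [← hshift]
    exact hs
  have hdeg := congrArg natDegree hpoly
  rw [natDegree_finsetProd_X_sub_C_eq_card, natDegree_C, Finset.card_eq_zero] at hdeg
  have : r ∈ S := Finset.mem_filter.2 ⟨(mem_lineRoots hq hF).2 h0, hr⟩
  rw [hdeg] at this
  exact Finset.notMem_empty _ this

/-- The smooth part of an irreducible hypersurface is connected. -/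
theorem joinedIn_transverseZeros (hirr : Irreducible F) (hq : MvPolynomial.eval q F ≠ 0)
    (hF : F.IsHomogeneous e) (hFP : F ∣ P)
    (hQ : ∀ y, MvPolynomial.eval y Q ≠ 0 → (linePoly q y P).Separable) {y₀ : Fin m → ℂ}
    (hy₀ : MvPolynomial.eval y₀ Q ≠ 0) {r r' : ℂ} (hr : MvPolynomial.eval (y₀ + r • q) F = 0)
    (hr' : MvPolynomial.eval (y₀ + r' • q) F = 0) :
    JoinedIn (transverseZeros q F P) (y₀ + r • q) (y₀ + r' • q) := by
  obtain ⟨δ, hδ, hball⟩ := Metric.eventually_nhds_iff_ball.1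
    ((MvPolynomial.continuous_eval Q).continuousAt.eventually_ne hy₀)
  set S : Fin m → Set ℂ := fun i => Metric.ball (y₀ i) δ
  have hS : ∀ i, (S i).Infinite := fun i =>
    infinite_of_mem_nhds (y₀ i) (Metric.ball_mem_nhds _ hδ)
  have hbox : Set.pi Set.univ S = Metric.ball y₀ δ := (ball_pi y₀ hδ).symm
  have hpoly : ∀ χ : (Fin m → ℂ) → Prop,
      (∀ x x', JoinedIn (transverseZeros q F P) x x' → (χ x ↔ χ x')) →
      ∃ A : MvPolynomial (Fin m) ℂ, ∀ y ∈ Metric.ball y₀ δ,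
        partialProd q F χ y = MvPolynomial.eval y A := by
    intro χ hχ
    rw [← hbox]
    refine exists_mvPolynomial_of_separately e S hS _ fun y hy i => ?_
    obtain ⟨p, hp, hp'⟩ := exists_polynomial_partialProd hq hF hFP hQ hχ
      (hball y (hbox ▸ hy)) i
    refine ⟨p, hp, fun s hs => hp' s (hball _ ?_)⟩
    rw [← hbox]
    intro j _
    by_cases hj : j = i
    · subst hj
      rwa [Function.update_self]
    · rw [Function.update_of_ne hj]
      exact hy j trivial
  -- Splitting the roots by the path component of the first point would factor `F` into two
  -- polynomials `A` and `B`. Irreducibility makes one of them constant, so one class of roots is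
  -- empty, and it is not the class of `r`.
  set χ : (Fin m → ℂ) → Prop := fun x => JoinedIn (transverseZeros q F P) (y₀ + r • q) x
  have hχ : ∀ x x', JoinedIn (transverseZeros q F P) x x' → (χ x ↔ χ x') := fun x x' h =>
    ⟨fun h' => h'.trans h, fun h' => h'.trans h.symm⟩
  have hχr : χ (y₀ + r • q) := JoinedIn.refl (mem_transverseZeros hFP (hQ y₀ hy₀) hr)
  suffices χ (y₀ + r' • q) from this
  obtain ⟨A, hA⟩ := hpoly χ hχ
  clear_value χ
  obtain ⟨B, hB⟩ := hpoly (fun x => ¬ χ x) fun x x' h => not_congr (hχ x x' h)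
  have hprod : F = MvPolynomial.C (MvPolynomial.eval q F) * A * B := by
    refine MvPolynomial.funext_set S hS fun y hy => ?_
    rw [hbox] at hy
    rw [partialProd_mul_partialProd_not hq hF (separable_linePoly_of_dvd hFP (hQ y (hball y hy))) χ,
      hA y hy, hB y hy, map_mul, map_mul, MvPolynomial.eval_C, mul_assoc]
  have hmem := Metric.ball_mem_nhds y₀ hδ
  rcases hirr.isUnit_or_isUnit hprod with hu | hu
  · obtain ⟨c, -, hc⟩ := MvPolynomial.isUnit_iff_eq_C_of_isReduced.1
      (isUnit_of_mul_isUnit_right hu)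
    refine absurd hr (eval_ne_zero_of_forall_partialProd_eq hq hF (χ := χ) (c := c) ?_ r hχr)
    filter_upwards [hmem] with y hy
    rw [hA y hy, hc, MvPolynomial.eval_C]
  · obtain ⟨c, -, hc⟩ := MvPolynomial.isUnit_iff_eq_C_of_isReduced.1 hu
    by_contra hcon
    refine absurd hr' (eval_ne_zero_of_forall_partialProd_eq hq hF (χ := fun x => ¬ χ x) (c := c)
      ?_ r' hcon)
    filter_upwards [hmem] with y hy
    rw [hB y hy, hc, MvPolynomial.eval_C]

end LineRoots

/-! ### Homogeneity degrees of nonvanishing functions on the complement of a divisor -/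

section TransverseTube

open Polynomial

variable {m : ℕ} {q : Fin m → ℂ} {F P : MvPolynomial (Fin m) ℂ}

theorem continuous_eval_map_eval (G : (MvPolynomial (Fin m) ℂ)[X]) :
    Continuous fun p : (Fin m → ℂ) × ℂ => (G.map (MvPolynomial.eval p.1)).eval p.2 := by
  simp only [eval_map, eval₂_eq_sum_range]
  exact continuous_finsetSum _ fun j _ =>
    ((MvPolynomial.continuous_eval _).comp continuous_fst).mul (continuous_snd.pow j)

/-- Small circles in direction `q` around a compact part of the smooth locus miss the divisor. -/
theorem eventually_eval_ne_zero_of_subset_transverseZeros (hFP : F ∣ P) {Γ : Set (Fin m → ℂ)}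
    (hΓ : IsCompact Γ) (hΓF : Γ ⊆ transverseZeros q F P) :
    ∀ᶠ δ in 𝓝[>] (0 : ℝ), ∀ x ∈ Γ, ∀ t ∈ Metric.sphere (0 : ℂ) δ,
      MvPolynomial.eval (x + t • q) P ≠ 0 := by
  -- `G` is the difference quotient `(P (x + t q) - P x) / t`. At `t = 0` it is the derivative along
  -- `q`, nonzero on `Γ`, hence by compactness nonzero for all small `t`; and `P x = 0` on `Γ`.
  set G := (linePoly q (MvPolynomial.X : Fin m → MvPolynomial (Fin m) ℂ) P).divX
  have hG : ∀ x : Fin m → ℂ, G.map (MvPolynomial.eval x) = (linePoly q x P).divX := by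
    intro x
    ext j
    rw [coeff_map, coeff_divX, coeff_divX, ← map_eval_linePoly q x P, coeff_map]
  have hopen : IsOpen {p : (Fin m → ℂ) × ℂ | (G.map (MvPolynomial.eval p.1)).eval p.2 ≠ 0} :=
    isOpen_ne_fun (continuous_eval_map_eval G) continuous_const
  obtain ⟨U, V, -, hV, hΓU, h0V, hUV⟩ := generalized_tube_lemma hΓ (isCompact_singleton (x := (0 : ℂ)))
    hopen (by
      rintro ⟨x, t⟩ ⟨hx, rfl⟩
      have h1 := (hΓF hx).2
      rw [← coeff_zero_eq_eval_zero, coeff_derivative] at h1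
      change (G.map (MvPolynomial.eval x)).eval 0 ≠ 0
      rw [hG, ← coeff_zero_eq_eval_zero, coeff_divX]
      simpa using h1)
  obtain ⟨δ₀, hδ₀, hball⟩ := Metric.isOpen_iff.1 hV 0 (h0V rfl)
  filter_upwards [Ioo_mem_nhdsGT hδ₀] with δ hδ x hx t ht
  rw [mem_sphere_zero_iff_norm] at ht
  have ht0 : t ≠ 0 := norm_pos_iff.1 (ht ▸ hδ.1)
  have h1 : (G.map (MvPolynomial.eval x)).eval t ≠ 0 :=
    @hUV (x, t) ⟨hΓU hx, hball (by rw [mem_ball_zero_iff, ht]; exact hδ.2)⟩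
  have h2 : (linePoly q x P).coeff 0 = 0 := by
    obtain ⟨u, rfl⟩ := hFP
    rw [coeff_zero_eq_eval_zero, eval_linePoly, zero_smul, add_zero, map_mul, (hΓF hx).1, zero_mul]
  rw [← eval_linePoly, ← divX_mul_X_add (linePoly q x P), h2, C_0, add_zero, eval_mul, eval_X, ← hG]
  exact mul_ne_zero h1 ht0

end TransverseTube

theorem JoinedIn.exists_continuous_real {X : Type*} [TopologicalSpace X] {E : Set X} {x y : X}
    (h : JoinedIn E x y) :
    ∃ γ : ℝ → X, Continuous γ ∧ γ 0 = x ∧ γ 1 = y ∧ ∀ s ∈ Set.Icc (0 : ℝ) 1, γ s ∈ E := by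
  obtain ⟨γ, hγ⟩ := h
  refine ⟨γ.extend, γ.continuous_extend, γ.extend_zero, γ.extend_one, fun s hs => ?_⟩
  rw [γ.extend_apply hs]
  exact hγ _

/-- The homogeneity degree as a sum of winding numbers around points of a line. -/
theorem degree_eq_sum_winding {m : ℕ} {q y₀ : Fin m → ℂ} {S : Finset ℂ} {R δ : ℝ} (hδ : 0 < δ)
    (hR : 0 < R) (hSR : ∀ r ∈ S, ‖r‖ + δ ≤ R)
    (hdisj : ∀ r ∈ S, ∀ r' ∈ S, r ≠ r' → 2 * δ ≤ dist r r')
    {K : Set (Fin m → ℂ)} (hK₁ : ∀ t : ℂ, ‖t‖ ≤ R → (∀ r ∈ S, δ ≤ dist t r) → y₀ + t • q ∈ K)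
    (hK₂ : ∀ s : ℂ, ‖s‖ ≤ R⁻¹ → q + s • y₀ ∈ K) {N : ℕ} {f : (Fin m → ℂ) → ℂ}
    (hf : ContinuousOn f K) (hf0 : ∀ z ∈ K, f z ≠ 0)
    (hfh : ∀ z ∈ K, ∀ c : ℂ, c ≠ 0 → c • z ∈ K → f (c • z) = c ^ N * f z) {w : ℂ → ℤ}
    (hw : ∀ r ∈ S, ∃ h : ℂ → ℂ, ContinuousOn h (Metric.sphere 0 δ) ∧
      ∀ t ∈ Metric.sphere (0 : ℂ) δ, f (y₀ + r • q + t • q) = Complex.exp (h t) * t ^ w r) :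
    (N : ℤ) = ∑ r ∈ S, w r := by
  -- Homogeneity reads `f (y₀ + t q) = t ^ N f (q + t⁻¹ y₀)`. The last factor extends without zeros
  -- over `t = ∞`, so the winding along the outer circle is exactly `N`.
  obtain ⟨l, hl, hl'⟩ := exists_log_closedBall (inv_pos.2 hR) (f := fun s => f (q + s • y₀))
    (hf.comp (by fun_prop) fun s hs => hK₂ s (mem_closedBall_zero_iff.1 hs))
    fun s hs => hf0 _ (hK₂ s (mem_closedBall_zero_iff.1 hs))
  have hsph : ∀ t ∈ Metric.sphere (0 : ℂ) R, t⁻¹ ∈ Metric.closedBall (0 : ℂ) R⁻¹ := by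
    intro t ht
    rw [mem_closedBall_zero_iff, norm_inv, mem_sphere_zero_iff_norm.1 ht]
  have hne : ∀ t ∈ Metric.sphere (0 : ℂ) R, t ≠ 0 := fun t ht =>
    norm_pos_iff.1 (by rwa [mem_sphere_zero_iff_norm.1 ht])
  refine winding_eq_sum hδ hSR hdisj (f := fun t => f (y₀ + t • q)) (u := fun t => l t⁻¹)
    (hf.comp (by fun_prop) fun t ht => hK₁ t ht.1 ht.2) (fun t h1 h2 => hf0 _ (hK₁ t h1 h2)) ?_ hR
    (hl.comp (continuousOn_id.inv₀ hne) hsph) ?_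
  · intro r hr
    obtain ⟨h, hh, hh'⟩ := hw r hr
    have hmem : ∀ t ∈ Metric.sphere r δ, t - r ∈ Metric.sphere (0 : ℂ) δ := fun t ht => by
      rwa [mem_sphere_zero_iff_norm, ← dist_eq_norm]
    refine ⟨fun t => h (t - r), hh.comp (by fun_prop) hmem, fun t ht => ?_⟩
    have := hh' (t - r) (hmem t ht)
    rwa [add_assoc, ← add_smul, add_sub_cancel] at this
  · intro t ht
    have ht' := mem_sphere_zero_iff_norm.1 ht
    have h1 : t • (q + t⁻¹ • y₀) = y₀ + t • q := by
      rw [smul_add, smul_smul, mul_inv_cancel₀ (hne t ht), one_smul, add_comm]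
    have h2 := hfh (q + t⁻¹ • y₀) (hK₂ _ (mem_closedBall_zero_iff.1 (hsph t ht))) t (hne t ht) (by
      rw [h1]
      refine hK₁ t ht'.le fun r hr => ?_
      rw [dist_eq_norm]
      have := norm_sub_norm_le t r
      linarith [hSR r hr])
    rw [h1] at h2
    change f (y₀ + t • q) = Complex.exp (l t⁻¹) * t ^ (N : ℤ)
    rw [h2, ← hl' _ (hsph t ht), zpow_natCast, mul_comm]

/-! ### A compact set on which the degree is seen to be divisible by the gcd -/

namespace GenericHypersurfaces

variable {n k : ℕ} {d : Fin k → ℕ}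

theorem isHomogeneous_prod (D : GenericHypersurfaces n d) :
    (∏ i, D.F i).IsHomogeneous (∑ i, d i) :=
  MvPolynomial.IsHomogeneous.prod _ _ _ fun i _ => D.isHomogeneous i

theorem eq_of_mem_lineRoots (D : GenericHypersurfaces n d) {q y : Fin (n + 1) → ℂ}
    (hs : (linePoly q y (∏ i, D.F i)).Separable) {r : ℂ} {i j : Fin k}
    (hi : MvPolynomial.eval (y + r • q) (D.F i) = 0)
    (hj : MvPolynomial.eval (y + r • q) (D.F j) = 0) : i = j := by
  by_contra hij
  rw [← Finset.mul_prod_erase _ _ (Finset.mem_univ i), map_mul] at hs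
  obtain ⟨a, b, hab⟩ := hs.isCoprime
  have h := congrArg (Polynomial.eval r) hab
  rw [Polynomial.eval_add, Polynomial.eval_mul, Polynomial.eval_mul, eval_linePoly, eval_linePoly,
    hi, map_prod, Finset.prod_eq_zero (Finset.mem_erase.2 ⟨Ne.symm hij, Finset.mem_univ j⟩) hj] at h
  simp at h

/-- There is a compact subset of the complement of the divisor on which the degree of a homogeneous
nonvanishing continuous function is a multiple of the greatest common divisor of the `dᵢ`. -/
theorem exists_compact_gcd_dvd (hn : 1 ≤ n) (hk : 1 ≤ k) (hd : ∀ i, 1 ≤ d i)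
    (D : GenericHypersurfaces n d) :
    ∃ K : Set (Fin (n + 1) → ℂ), IsCompact K ∧ K.Nonempty ∧
      (∀ z ∈ K, MvPolynomial.eval z (∏ i, D.F i) ≠ 0) ∧
      ∀ (N : ℕ) (f : (Fin (n + 1) → ℂ) → ℂ), ContinuousOn f K → (∀ z ∈ K, f z ≠ 0) →
        (∀ z ∈ K, ∀ c : ℂ, c ≠ 0 → c • z ∈ K → f (c • z) = c ^ N * f z) →
          Finset.univ.gcd d ∣ N := by
  classical
  have : NeZero k := ⟨by omega⟩
  obtain ⟨q, hq⟩ := D.exists_common_nonzero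
  obtain ⟨Q, hQ0, hQ⟩ := exists_discriminant D.isHomogeneous D.irreducible (D.not_dvd hn hd) hq
  obtain ⟨y₀, hy₀⟩ : ∃ y, MvPolynomial.eval y Q ≠ 0 := by
    by_contra! hcon
    exact hQ0 (MvPolynomial.funext fun y => by rw [hcon y, map_zero])
  set P := ∏ i, D.F i
  have hqP : MvPolynomial.eval q P ≠ 0 := by
    rw [map_prod]
    exact Finset.prod_ne_zero_iff.2 fun i _ => hq i
  have hFP : ∀ i, D.F i ∣ P := fun i => Finset.dvd_prod_of_mem _ (Finset.mem_univ i)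
  set S := lineRoots q P y₀
  have hS : ∀ r, r ∈ S ↔ MvPolynomial.eval (y₀ + r • q) P = 0 := fun r =>
    mem_lineRoots hqP D.isHomogeneous_prod
  have hex : ∀ r, ∃ i, r ∈ S → MvPolynomial.eval (y₀ + r • q) (D.F i) = 0 := by
    intro r
    by_cases hr : r ∈ S
    · have h := (hS r).1 hr
      rw [map_prod, Finset.prod_eq_zero_iff] at h
      obtain ⟨i, -, hi⟩ := h
      exact ⟨i, fun _ => hi⟩
    · exact ⟨0, fun h => absurd h hr⟩
  choose c hc using hex
  have hfib : ∀ i, S.filter (fun r => c r = i) = lineRoots q (D.F i) y₀ := by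
    intro i
    ext r
    rw [Finset.mem_filter, mem_lineRoots (hq i) (D.isHomogeneous i)]
    constructor
    · rintro ⟨hr, rfl⟩
      exact hc r hr
    · intro h
      have hr : r ∈ S := (hS r).2 (by
        obtain ⟨u, hu⟩ := hFP i
        rw [hu, map_mul, h, zero_mul])
      exact ⟨hr, D.eq_of_mem_lineRoots (hQ y₀ hy₀) (hc r hr) h⟩
  have hcard : ∀ i, (S.filter fun r => c r = i).card = d i := fun i => by
    rw [hfib, card_lineRoots (hq i) (D.isHomogeneous i)
      (separable_linePoly_of_dvd (hFP i) (hQ y₀ hy₀))]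
  have hbase : ∀ i, ∃ b ∈ S, c b = i := fun i => by
    obtain ⟨b, hb⟩ := Finset.card_pos.1 ((hd i).trans_eq (hcard i).symm)
    exact ⟨b, (Finset.mem_filter.1 hb).1, (Finset.mem_filter.1 hb).2⟩
  -- `c r` is the component through the root `r`, and `b i` is a base root chosen on the component
  -- `i`; every root is joined to the base root of its component inside the smooth locus.
  choose b hbS hb using hbase
  have hpath : ∀ r, ∃ γ : ℝ → Fin (n + 1) → ℂ, r ∈ S → Continuous γ ∧ γ 0 = y₀ + b (c r) • q ∧
      γ 1 = y₀ + r • q ∧ ∀ s ∈ Set.Icc (0 : ℝ) 1, γ s ∈ transverseZeros q (D.F (c r)) P := by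
    intro r
    by_cases hr : r ∈ S
    · have h1 := hc (b (c r)) (hbS _)
      rw [hb] at h1
      obtain ⟨γ, h⟩ := (joinedIn_transverseZeros (D.irreducible (c r)) (hq _) (D.isHomogeneous _)
        (hFP _) hQ hy₀ h1 (hc r hr)).exists_continuous_real
      exact ⟨γ, fun _ => h⟩
    · exact ⟨fun _ => 0, fun h => absurd h hr⟩
  choose γ hγ using hpath
  obtain ⟨δ, hδ, hδ1, hδP, hdisj⟩ : ∃ δ : ℝ, 0 < δ ∧ δ ≤ 1 ∧
      (∀ r ∈ S, ∀ s ∈ Set.Icc (0 : ℝ) 1, ∀ t ∈ Metric.sphere (0 : ℂ) δ,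
        MvPolynomial.eval (γ r s + t • q) P ≠ 0) ∧
      ∀ r ∈ S, ∀ r' ∈ S, r ≠ r' → 2 * δ ≤ dist r r' := by
    have h1 : ∀ᶠ δ in 𝓝[>] (0 : ℝ), ∀ r ∈ S, ∀ x ∈ γ r '' Set.Icc 0 1,
        ∀ t ∈ Metric.sphere (0 : ℂ) δ, MvPolynomial.eval (x + t • q) P ≠ 0 := by
      refine (Filter.eventually_all_finset _).2 fun r hr => ?_
      refine eventually_eval_ne_zero_of_subset_transverseZeros (hFP (c r))
        (isCompact_Icc.image (hγ r hr).1) ?_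
      rintro _ ⟨s, hs, rfl⟩
      exact (hγ r hr).2.2.2 s hs
    have h2 : ∀ᶠ δ in 𝓝[>] (0 : ℝ), ∀ r ∈ S, ∀ r' ∈ S, r ≠ r' → 2 * δ ≤ dist r r' := by
      refine (Filter.eventually_all_finset _).2 fun r _ =>
        (Filter.eventually_all_finset _).2 fun r' _ => ?_
      by_cases h : r = r'
      · exact Filter.Eventually.of_forall fun _ h' => absurd h h'
      · filter_upwards [Ioo_mem_nhdsGT (half_pos (dist_pos.2 h))] with δ hδ _
        linarith [hδ.2]
    obtain ⟨δ, a1, a2, a3⟩ := (h1.and (h2.and (Ioo_mem_nhdsGT (zero_lt_one' ℝ)))).exists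
    exact ⟨δ, a3.1, a3.2.le, fun r hr s hs => a1 r hr _ ⟨s, hs, rfl⟩, a2⟩
  obtain ⟨R, hR, hSR⟩ : ∃ R : ℝ, 0 < R ∧ ∀ r ∈ S, ‖r‖ + δ ≤ R := by
    have h0 : 0 ≤ ∑ r ∈ S, ‖r‖ := Finset.sum_nonneg fun _ _ => norm_nonneg _
    refine ⟨∑ r ∈ S, ‖r‖ + 1, by linarith, fun r hr => ?_⟩
    have := Finset.single_le_sum (fun r _ => norm_nonneg r) hr (f := fun r : ℂ => ‖r‖)
    linarith
  -- `K₁` is a disc in the line with holes around the points of the divisor, `K₂` covers the line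
  -- near infinity, and `K₃` consists of meridian circles transported along the paths `γ`.
  set K₁ := (fun t : ℂ => y₀ + t • q) '' (Metric.closedBall 0 R ∩ ⋂ r ∈ S, {t | δ ≤ dist t r})
  set K₂ := (fun s : ℂ => q + s • y₀) '' Metric.closedBall 0 R⁻¹
  set K₃ := ⋃ r ∈ S, (fun p : ℝ × ℂ => γ r p.1 + p.2 • q) '' (Set.Icc 0 1 ×ˢ Metric.sphere 0 δ)
  have hK₁ : ∀ t : ℂ, ‖t‖ ≤ R → (∀ r ∈ S, δ ≤ dist t r) → y₀ + t • q ∈ K₁ := fun t h1 h2 =>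
    ⟨t, ⟨mem_closedBall_zero_iff.2 h1, Set.mem_iInter₂.2 h2⟩, rfl⟩
  have hK₂ : ∀ s : ℂ, ‖s‖ ≤ R⁻¹ → q + s • y₀ ∈ K₂ := fun s h =>
    ⟨s, mem_closedBall_zero_iff.2 h, rfl⟩
  have hK₃ : ∀ r ∈ S, ∀ s ∈ Set.Icc (0 : ℝ) 1, ∀ t ∈ Metric.sphere (0 : ℂ) δ,
      γ r s + t • q ∈ K₃ := fun r hr s hs t ht =>
    Set.mem_iUnion₂.2 ⟨r, hr, (s, t), ⟨hs, ht⟩, rfl⟩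
  refine ⟨K₁ ∪ K₂ ∪ K₃, (IsCompact.union ?_ ?_).union ?_,
    ⟨q + (0 : ℂ) • y₀, Or.inl (Or.inr (hK₂ 0 (by simpa using hR.le)))⟩, ?_, ?_⟩
  · refine IsCompact.image ?_ (by fun_prop)
    exact (isCompact_closedBall 0 R).inter_right
      (isClosed_biInter fun r _ => isClosed_le continuous_const (by fun_prop))
  · exact (isCompact_closedBall 0 R⁻¹).image (by fun_prop)
  · refine S.isCompact_biUnion fun r hr => ?_
    have := (hγ r hr).1
    exact (isCompact_Icc.prod (isCompact_sphere 0 δ)).image (by fun_prop)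
  · rintro z ((⟨t, ⟨-, ht⟩, rfl⟩ | ⟨s, hs, rfl⟩) | hz)
    · intro h0
      have h1 := Set.mem_iInter₂.1 ht t ((hS t).2 h0)
      rw [Set.mem_ofPred_eq, dist_self] at h1
      linarith
    · by_cases hs0 : s = 0
      · simpa [hs0] using hqP
      · intro h0
        have h1 : q + s • y₀ = s • (y₀ + s⁻¹ • q) := by
          rw [smul_add, smul_smul, mul_inv_cancel₀ hs0, one_smul, add_comm (s • y₀)]
        simp only [h1] at h0
        rw [D.isHomogeneous_prod.eval_smul_eq] at h0
        have h2 := hSR s⁻¹ ((hS _).2 ((mul_eq_zero.1 h0).resolve_left (pow_ne_zero _ hs0)))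
        have h3 : R ≤ ‖s‖⁻¹ := by
          rw [mem_closedBall_zero_iff] at hs
          rw [← inv_inv R]
          exact inv_anti₀ (norm_pos_iff.2 hs0) hs
        rw [norm_inv] at h2
        linarith
    · obtain ⟨r, hr, ⟨s, t⟩, ⟨hs, ht⟩, rfl⟩ := Set.mem_iUnion₂.1 hz
      exact hδP r hr s hs t ht
  · intro N f hf hf0 hfh
    have hwind : ∀ r, ∃ w : ℤ, r ∈ S → ∀ s ∈ Set.Icc (0 : ℝ) 1, ∃ h : ℂ → ℂ,
        ContinuousOn h (Metric.sphere 0 δ) ∧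
        ∀ t ∈ Metric.sphere (0 : ℂ) δ, f (γ r s + t • q) = Complex.exp (h t) * t ^ w := by
      intro r
      by_cases hr : r ∈ S
      · obtain ⟨w, hw⟩ := exists_winding hδ (F := fun s t => f (γ r s + t • q))
          (hf.comp (by have := (hγ r hr).1; fun_prop)
            fun p hp => Or.inr (hK₃ r hr p.1 hp.1 p.2 hp.2))
          fun s hs t ht => hf0 _ (Or.inr (hK₃ r hr s hs t ht))
        exact ⟨w, fun _ => hw⟩
      · exact ⟨0, fun h => absurd h hr⟩
    choose w hw using hwind
    -- The tube of `r` starts at the base root and the tube of the base root ends there, so both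
    -- integers are winding numbers of `f` on the same circle.
    have hwc : ∀ r ∈ S, w r = w (b (c r)) := by
      intro r hr
      obtain ⟨h₁, hc₁, he₁⟩ := hw r hr 0 (Set.left_mem_Icc.2 zero_le_one)
      obtain ⟨h₂, hc₂, he₂⟩ := hw (b (c r)) (hbS _) 1 (Set.right_mem_Icc.2 zero_le_one)
      rw [(hγ r hr).2.1] at he₁
      rw [(hγ _ (hbS (c r))).2.2.1] at he₂
      refine sub_eq_zero.1 (eq_zero_of_zpow_eq_exp hδ (hc₂.sub hc₁) fun t ht => ?_)
      have ht0 : t ≠ 0 := norm_pos_iff.1 (by rwa [mem_sphere_zero_iff_norm.1 ht])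
      have he := (he₁ t ht).symm.trans (he₂ t ht)
      rw [zpow_sub₀ ht0, Pi.sub_apply, Complex.exp_sub,
        div_eq_div_iff (zpow_ne_zero _ ht0) (Complex.exp_ne_zero _), mul_comm, he]
    have hN := degree_eq_sum_winding hδ hR hSR hdisj
      (fun t h1 h2 => Or.inl (Or.inl (hK₁ t h1 h2))) (fun s h => Or.inl (Or.inr (hK₂ s h)))
      hf hf0 hfh (w := w) fun r hr => by
        obtain ⟨h, hh⟩ := hw r hr 1 (Set.right_mem_Icc.2 zero_le_one)
        rw [(hγ r hr).2.2.1] at hh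
        exact ⟨h, hh⟩
    rw [Finset.sum_congr rfl hwc, ← Finset.sum_fiberwise (g := c)] at hN
    have hN' : (N : ℤ) = ∑ i, (d i : ℤ) * w (b i) := by
      rw [hN]
      refine Finset.sum_congr rfl fun i _ => ?_
      rw [← hcard i, Finset.sum_congr rfl (g := fun _ => w (b i)) (fun r hr => by
        rw [(Finset.mem_filter.1 hr).2]), Finset.sum_const, nsmul_eq_mul]
    rw [← Int.natCast_dvd_natCast, hN']
    exact Finset.dvd_sum fun i _ => Dvd.dvd.mul_right
      (Int.natCast_dvd_natCast.2 (Finset.gcd_dvd (Finset.mem_univ i))) _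

end GenericHypersurfaces

end

/-! ### The obstruction -/

theorem mainTheorem10 (n : ℕ) (hn : 1 ≤ n) (k : ℕ) (hk : 1 ≤ k) (d : Fin k → ℕ)
    (hd : ∀ i, 1 ≤ d i) (D : GenericHypersurfaces n d) :
    ∃ ε₀ : ℝ, 0 < ε₀ ∧ ∀ ε : ℝ, 0 < ε → ε ≤ ε₀ →
      ∀ (k' : ℕ), 1 ≤ k' → ∀ (d' : Fin k' → ℕ), (∀ i, 1 ≤ d' i) →
      ∀ (D' : GenericHypersurfaces n d') (ε' : ℝ), 0 < ε' →
        AlmostSymplecticEmbeds (D.domain ε) (D'.domain ε') →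
          formalF n d ∣ formalF n d' := by
  obtain ⟨K, hK, hKne, hKP, hKN⟩ := D.exists_compact_gcd_dvd hn hk hd
  have hKF : ∀ z ∈ K, ∏ i, MvPolynomial.eval z (D.F i) ≠ 0 := fun z hz => by
    rw [← map_prod]
    exact hKP z hz
  have hK0 : ∀ z ∈ K, z ≠ 0 := by
    rintro z hz rfl
    refine hKF 0 hz (Finset.prod_eq_zero (Finset.mem_univ ⟨0, hk⟩) ?_)
    have h := (D.isHomogeneous ⟨0, hk⟩).eval_smul_eq 0 0
    rwa [zero_smul, zero_pow (by have := hd ⟨0, hk⟩; omega), zero_mul] at h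
  let φ : (Fin (n + 1) → ℂ) → ℝ := fun z =>
    ‖∏ i, MvPolynomial.eval z (D.F i)‖ / ‖WithLp.toLp 2 z‖ ^ ∑ i, d i
  have hden : ∀ z ∈ K, 0 < ‖WithLp.toLp 2 z‖ := fun z hz => by
    rw [norm_pos_iff, ne_eq, WithLp.toLp_eq_zero]
    exact hK0 z hz
  have hφc : ContinuousOn φ K := by
    refine ContinuousOn.div ?_ ?_ fun z hz => (pow_pos (hden z hz) _).ne'
    · exact (continuous_finsetProd _ fun i _ => MvPolynomial.continuous_eval _).norm.continuousOn
    · exact ((PiLp.continuous_toLp 2 _).norm.pow _).continuousOn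
  obtain ⟨z₀, hz₀, hmin⟩ := hK.exists_isMinOn hKne hφc
  have hφ₀ : 0 < φ z₀ := div_pos (norm_pos_iff.2 (hKF z₀ hz₀)) (pow_pos (hden z₀ hz₀) _)
  -- Half the minimum of the section norm over `K` gives a strict inequality, so that `K` projects
  -- into an open subset of the domain.
  refine ⟨φ z₀ / 2, half_pos hφ₀, fun ε hε hεle k' _ d' _ D' ε' hε' hemb => ?_⟩
  have hF : Finset.univ.gcd d' ∣ (n + 1) * formalF n d' := by
    rw [formalF, ← Nat.mul_div_assoc _ (Nat.gcd_dvd_left _ _),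
      Nat.mul_div_right_comm (Nat.gcd_dvd_right _ _)]
    exact Nat.dvd_mul_left _ _
  obtain ⟨g, hgc, hg0, hgh⟩ := D'.exists_homogeneous_on_domain hε' hF
  obtain ⟨f, hfc, hf0, hfh⟩ := CP.exists_homogeneous_of_almostSymplecticEmbeds hemb
    (U := {p | ε < D.sectionNorm p}) (isOpen_lt continuous_const D.continuous_sectionNorm)
    (fun p (hp : ε < D.sectionNorm p) => hp.le) hK hK0 (fun z hz => by
      change ε < D.sectionNorm (CP.proj z)
      rw [D.sectionNorm_proj (hK0 z hz)]
      have h1 : φ z₀ ≤ φ z := hmin hz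
      have h2 : φ z = ‖∏ i, MvPolynomial.eval z (D.F i)‖ / ‖WithLp.toLp 2 z‖ ^ ∑ i, d i := rfl
      linarith) (formalF n d') hgc hg0 hgh
  have hdvd := hKN _ f hfc hf0 hfh
  have hpos : 0 < Nat.gcd (Finset.univ.gcd d) (n + 1) := Nat.gcd_pos_of_pos_right _ (Nat.succ_pos n)
  -- From `gcd d ∣ (n + 1) F_n(d')` the common factor `gcd (gcd d, n + 1)` is cancelled; the
  -- remaining part of `n + 1` is coprime to `F_n(d)`.
  refine (Nat.coprime_div_gcd_div_gcd hpos).dvd_of_dvd_mul_left ?_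
  rw [← Nat.mul_div_right_comm (Nat.gcd_dvd_right _ _)]
  exact Nat.div_dvd_div (Nat.gcd_dvd_left _ _) hdvd
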